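/- **Setting.** Let $\Omega=\mathbb R^2/\mathbb Z^2$, $m^2>0$, and let $\mathcal P(r)=\sum_{k=1}^N a_k r^k$ be a real polynomial of even degree $N\ge 2$ with $a_N>0$ (and no constant term). For $\epsilon>0$ with $1/\epsilon\in\mathbb N$ let $\Omega_\epsilon=\Omega\cap\epsilon\mathbb Z^2$ and $X_\epsilon=\mathbb R^{\Omega_\epsilon}$, with $\|f\|_{L^2}^2=\epsilon^2\sum_{x\in\Omega_\epsilon}|f(x)|^2$ and the lattice Laplacian $\Delta^\epsilon f(x)=\epsilon^{-2}\sum_{y\sim x}(f(y)-f(x))$ (sum over the four sites $x\pm\epsilon e_i$, counted with multiplicity). Let $\nu^{\mathrm{GFF}_\epsilon}$ be the centred Gaussian measure on $X_\epsilon$ with covariance $(-\Delta^\epsilon+m^2)^{-1}$, i.e. whose covariance matrix is the kernel of this operator with respect to $\epsilon^2\sum_x$. Let $c_\epsilon$ be its variance at a site, let $:\!\phi^n(x)\!:\;=c_\epsilon^{n/2}H_n(\phi(x)/c_\epsilon^{1/2})$ with $H_n$ the probabilists' Hermite polynomials, and let $$v_0^\epsilon(\phi)=\epsilon^2\sum_{x\in\Omega_\epsilon}\sum_{k=1}^N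 a_k:\!\phi^k(x)\!: .$$ Let $(\chi_E)_{E>0}$ be concave $C^2$ functions on $\mathbb R$ such that $\chi_E(x)=x$ for $x\le E/2$, $\chi_E$ is constant for all sufficiently large $x$, $\chi_E\le\chi_{E'}$ on $[0,\infty)$ for $E\le E'$, and $\sup_{E>0}\|\chi_E'\|_\infty<\infty$. Set $v_0^{\epsilon,E}=\chi_E\circ v_0^\epsilon$, and let $\nu^{\mathcal P_\epsilon}\propto e^{-v_0^\epsilon}\,d\nu^{\mathrm{GFF}_\epsilon}$ and $\nu^{\mathcal P_\epsilon,E}\propto e^{-v_0^{\epsilon,E}}\,d\nu^{\mathrm{GFF}_\epsilon}$. Let $W$ be a cylindrical Brownian motion in the real space $L^2(\Omega)$ on a complete probability space, and let $\mathcal F^t$ be the $\sigma$-algebra generated by $\{W_s-W_t:s\ge t\}$ and the null sets. Let $W^\epsilon$ be the restriction to $\Omega_\epsilon$ of the projection of $W$ onto the span of the real Fourier modes $\cos(k\cdot x)+\sin(k\cdot x)$, $k\in 2\pi\mathbb Z^2$, $-\pi/\epsilon<k_i\le\pi/\epsilon$ (the $W^\epsilon(x)$, $x\in\Omega_\epsilon$,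 are independent Brownian motions with quadratic variation $t/\epsilon^2$). Put $q_t^\epsilon=(t(-\Delta^\epsilon+m^2)+1)^{-1}$, $Y_\infty^\epsilon=\int_0^\infty q_s^\epsilon\,dW_s^\epsilon$ and $I_\infty^\epsilon(u)=\int_0^\infty q_s^\epsilon u_s\,ds$. Let $\mathbb H_a$ be the set of $X_\epsilon$-valued processes $u=(u_t)_{t\ge 0}$ such that $u|_{[t,\infty)}$ is $\mathcal B([t,\infty))\otimes\mathcal F^t$-measurable for every $t\ge 0$ and $\int_0^\infty\|u_t\|_{L^2}^2dt<\infty$ a.s., and let $$F^{\infty,E}(u)=\mathbb E\Big[v_0^{\epsilon,E}\big(Y_\infty^\epsilon+I_\infty^\epsilon(u)\big)+\tfrac12\int_0^\infty\|u_t\|_{L^2}^2\,dt\Big]\in(-\infty,\infty],\qquad u\in\mathbb H_a .$$ **Proposition.** 1. There is a constant $C<\infty$, depending only on $m$, $\mathcal P$ and $(\chi_E)_{E>0}$, such that for every such $\epsilon$, every $E\in(0,\infty)$ and every minimiser $\bar u$ of $F^{\infty,E}$ in $\mathbb H_a$, $$\mathbb E\Big[\int_0^\infty\|\bar u_t\|_{L^2}^2\,dt\Big]\le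 C .$$ 2. For every $p\in[1,\infty)$ there is a constant $C_p<\infty$, depending only on $p$, $m$, $\mathcal P$ and $(\chi_E)_{E>0}$, such that for every such $\epsilon$ and every $E\in(0,\infty)$ the measures $\nu^{\mathcal P_\epsilon}$ and $\nu^{\mathcal P_\epsilon,E}$ are well-defined probability measures, absolutely continuous with respect to $\nu^{\mathrm{GFF}_\epsilon}$, and the unnormalised densities $e^{-v_0^\epsilon}$, $e^{-v_0^{\epsilon,E}}$ and the normalised densities $d\nu^{\mathcal P_\epsilon}/d\nu^{\mathrm{GFF}_\epsilon}$, $d\nu^{\mathcal P_\epsilon,E}/d\nu^{\mathrm{GFF}_\epsilon}$ all have norm at most $C_p$ in $L^p(\nu^{\mathrm{GFF}_\epsilon})$. -/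

import Mathlib

open MeasureTheory ProbabilityTheory Filter
open scoped NNReal ENNReal Topology

noncomputable section

namespace PPhi2

/-! ### The discretised torus and its operators

Throughout the mesh size is `ε = 1 / L` with `L ≥ 1` an integer. -/

/-- The discretised unit torus `Ω_ε`: the class of `(n₁, n₂)` stands for the point
`(ε n₁, ε n₂)` of the torus `ℝ² / ℤ²`. -/
abbrev Lattice (L : ℕ) : Type := Fin 2 → ZMod L

/-- Real fields on the lattice, `X_ε`. -/
abbrev Field (L : ℕ) : Type := Lattice L → ℝ

/-- The unit torus `Ω = ℝ² / ℤ²`. -/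
abbrev Torus : Type := UnitAddTorus (Fin 2)

/-- The position `ε x ∈ Ω` of a lattice site. -/
def site {L : ℕ} [NeZero L] (x : Lattice L) : Torus := fun i => ZMod.toAddCircle (x i)

/-- The lattice Laplacian `(Δ^ε f)(x) = ε⁻² ∑_{y ∼ x} (f y - f x)`; the neighbours of `x` are the
four sites `x ± e_i` (counted with multiplicity when the torus is so small that they coincide, so
that the Fourier multiplier of `-Δ^ε` is `ε⁻² ∑ i, (2 - 2 cos (ε k_i))` for every mesh size). -/
def laplacian (L : ℕ) : Field L →ₗ[ℝ] Field L where
  toFun f := fun x => (L : ℝ) ^ 2 *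
    ∑ i : Fin 2, ((f (x + Pi.single i 1) - f x) + (f (x - Pi.single i 1) - f x))
  map_add' f g := by
    funext x
    simp only [Pi.add_apply, ← mul_add, ← Finset.sum_add_distrib]
    congr 1
    exact Finset.sum_congr rfl fun i _ => by ring
  map_smul' c f := by
    funext x
    simp only [Pi.smul_apply, smul_eq_mul, RingHom.id_apply, Finset.mul_sum]
    exact Finset.sum_congr rfl fun i _ => by ring

variable (L : ℕ) [NeZero L]

/-- The matrix of `-Δ^ε + m²` acting on `X_ε`. -/
def massiveLaplacian (m : ℝ) : Matrix (Lattice L) (Lattice L) ℝ :=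
  m ^ 2 • (1 : Matrix (Lattice L) (Lattice L) ℝ) - LinearMap.toMatrix' (laplacian L)

/-- The matrix of the Pauli-Villars operator `q_t^ε = (t (-Δ^ε + m²) + 1)⁻¹` acting on `X_ε`. -/
def q (m : ℝ) (t : ℝ≥0) : Matrix (Lattice L) (Lattice L) ℝ :=
  ((t : ℝ) • massiveLaplacian L m + 1)⁻¹

/-- The kernel of `(-Δ^ε + m²)⁻¹` with respect to the normalised counting measure `ε² ∑ₓ`,
that is, `ε⁻²` times the matrix of this operator. -/
def gffCovariance (m : ℝ) : Matrix (Lattice L) (Lattice L) ℝ :=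
  (L : ℝ) ^ 2 • (massiveLaplacian L m)⁻¹

/-- The law `ν^{GFF_ε}` of the massive discrete Gaussian free field, a measure on `X_ε`. -/
def gff (m : ℝ) : Measure (Field L) :=
  (multivariateGaussian 0 (gffCovariance L m)).map WithLp.ofLp

/-! ### Wick powers, the Hamiltonian and the lattice `P(φ)₂` measures -/

/-- The variance `c_ε` of the Gaussian free field at `x` (it does not depend on `x`). -/
def gffVariance (m : ℝ) (x : Lattice L) : ℝ := Var[fun φ : Field L => φ x; gff L m]

/-- The Wick power `:φⁿ(x): = c^{n/2} H_n (φ(x) / c^{1/2})`, where `c = c_ε` and `H_n` is the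
probabilists' Hermite polynomial. For example `:φ⁴: = φ⁴ - 6 c φ² + 3 c²`. -/
def wickPow (m : ℝ) (n : ℕ) (φ : Field L) (x : Lattice L) : ℝ :=
  √(gffVariance L m x) ^ n *
    Polynomial.aeval (φ x / √(gffVariance L m x)) (Polynomial.hermite n)

/-- The Hamiltonian `v₀^ε(φ) = ε² ∑ₓ :P(φ(x)):`, where `:P(φ): = ∑ₖ aₖ :φᵏ:` with `1 ≤ k ≤ N` for
`P(r) = ∑ₖ aₖ rᵏ` of degree `N`. -/
def hamiltonian (m : ℝ) (P : Polynomial ℝ) (φ : Field L) : ℝ :=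
  (1 / (L : ℝ)) ^ 2 *
    ∑ x : Lattice L, ∑ k ∈ Finset.Icc 1 P.natDegree, P.coeff k * wickPow L m k φ x

/-- The measure on `X_ε` proportional to `exp (-V) dν^{GFF_ε}`. For `V = v₀^ε` this is
`ν^{P_ε}`, for `V = χ_E ∘ v₀^ε` it is `ν^{P_ε, E}`. -/
def gibbs (m : ℝ) (V : Field L → ℝ) : Measure (Field L) :=
  (gff L m).tilted fun φ => - V φ

/-- A family `(χ_E)`, `E > 0`, of energy cut-offs: each `χ_E` is `C²` and concave, equals `x` for
`x ≤ E / 2` and is constant near `+∞`; `χ_E ≤ χ_{E'}` on `[0, ∞)` for `E ≤ E'`, and the derivatives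
`χ_E'` are bounded uniformly in `E`. -/
structure IsCutoff (χ : ℝ → ℝ → ℝ) : Prop where
  contDiff : ∀ E > 0, ContDiff ℝ 2 (χ E)
  concave : ∀ E > 0, ConcaveOn ℝ Set.univ (χ E)
  eq_self : ∀ E > 0, ∀ x ≤ E / 2, χ E x = x
  eventually_const : ∀ E > 0, ∃ R M : ℝ, ∀ x > R, χ E x = M
  mono : ∀ E > 0, ∀ E' ≥ E, ∀ x ≥ 0, χ E x ≤ χ E' x
  deriv_bound : ∃ K : ℝ, ∀ E > 0, ∀ x, |deriv (χ E) x| ≤ K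

/-! ### Brownian motion -/

/-- The real Hilbert space `L²(Ω)`. -/
abbrev L2Torus : Type := Lp ℝ 2 (volume : Measure Torus)

variable {O : Type*} [MeasurableSpace O]

/-- A cylindrical Brownian motion in `L²(Ω)`: a centred Gaussian family `W_t(f) = ⟨W_t, f⟩` with
`Cov (W_s(f), W_t(g)) = min s t ⟨f, g⟩`, such that `t ↦ W_t(f)` has a.s. continuous paths. -/
structure IsCylindricalBrownianMotion (W : ℝ≥0 → L2Torus → O → ℝ) (μ : Measure O) : Prop where
  gaussian : IsGaussianProcess (fun p : ℝ≥0 × L2Torus => W p.1 p.2) μ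
  centred : ∀ t f, ∫ ω, W t f ω ∂μ = 0
  covariance : ∀ s t f g, cov[W s f, W t g; μ] = min (s : ℝ) (t : ℝ) * inner ℝ f g
  continuous_paths : ∀ f, ∀ᵐ ω ∂μ, Continuous fun t => W t f ω

/-- The backward filtration `ℱ^t`, generated by the future increments `W_s - W_t`, `s ≥ t`, and
the null sets. -/
@[reducible] def backward (W : ℝ≥0 → L2Torus → O → ℝ) (μ : Measure O) (t : ℝ≥0) : MeasurableSpace O :=
  (⨆ s : Set.Ici t, ⨆ f : L2Torus,
      MeasurableSpace.comap (fun ω => W s f ω - W t f ω) inferInstance) ⊔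
    MeasurableSpace.generateFrom {A | μ A = 0}

/-- The frequencies of the lattice: the `n ∈ ℤ²` such that `k = 2π n` lies in `Ω_ε^*`, that is,
`-π/ε < k_i ≤ π/ε`. -/
def frequencies : Finset (Fin 2 → ℤ) :=
  (Fintype.piFinset fun _ => Finset.Icc (-(L : ℤ)) L).filter
    fun n => ∀ i, -(L : ℤ) < 2 * n i ∧ 2 * n i ≤ L

/-- The real Fourier mode `cos (k · x) + sin (k · x)` with `k = 2π n`; over `n ∈ ℤ²` these modes
are an orthonormal basis of `L²(Ω)`. -/
def mode (n : Fin 2 → ℤ) : C(Torus, ℝ) where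
  toFun x := (UnitAddTorus.mFourier n x).re + (UnitAddTorus.mFourier n x).im
  continuous_toFun := by fun_prop

/-- The lattice Brownian motion `W^ε = Π_ε W` at the site `x`: the Fourier series of `W`
restricted to `k ∈ Ω_ε^*` and evaluated at `x`. The sum of the terms of `k` and `-k` is
`e^{i k · x} Ŵ_t(k) + e^{-i k · x} Ŵ_t(-k)`. The real modes matter only at frequencies with
`k_i = π/ε` (which occur when `1/ε` is even), where `-k` may be missing from `Ω_ε^*`. The
`W^ε(x)` are independent Brownian motions with quadratic variation `t / ε²`. -/
def latticeBM (W : ℝ≥0 → L2Torus → O → ℝ) (x : Lattice L) (t : ℝ≥0) (ω : O) : ℝ :=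
  ∑ n ∈ frequencies L, W t (ContinuousMap.toLp 2 volume ℝ (mode n)) ω * mode n (site x)

/-- The sum `∑ f(t_i) (B_{t_{i+1}} - B_{t_i})` over the partition of `[0, N]` of mesh `1 / N`. -/
def wienerSum (f : ℝ≥0 → ℝ) (B : ℝ≥0 → O → ℝ) (N : ℕ) (ω : O) : ℝ :=
  ∑ i ∈ Finset.range (N ^ 2),
    f ((i : ℝ≥0) / N) * (B (((i : ℝ≥0) + 1) / N) ω - B ((i : ℝ≥0) / N) ω)

open Classical in
/-- The Wiener integral `∫₀^∞ f(s) dB_s` of a (regular, square integrable) deterministic function: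
the limit of `wienerSum f B` in `L²(μ)`, which is unique up to null sets. -/
def wienerIntegral (μ : Measure O) (f : ℝ≥0 → ℝ) (B : ℝ≥0 → O → ℝ) : O → ℝ :=
  if h : ∃ Y : O → ℝ, MemLp Y 2 μ ∧
      Tendsto (fun N => eLpNorm (fun ω => wienerSum f B N ω - Y ω) 2 μ) atTop (𝓝 0)
  then h.choose else 0

/-- The field `Y_∞^ε = ∫₀^∞ q_s^ε dW_s^ε`, a Gaussian free field on the lattice. -/
def Yinfty (m : ℝ) (W : ℝ≥0 → L2Torus → O → ℝ) (μ : Measure O) (ω : O) : Field L :=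
  fun x => ∑ y, wienerIntegral μ (fun s => q L m s x y) (latticeBM L W y) ω

/-! ### The control problem -/

/-- Lebesgue measure on the time half-line `[0, ∞)`. -/
def timeMeasure : Measure ℝ≥0 := (volume.restrict (Set.Ici (0 : ℝ))).map Real.toNNReal

/-- The norm squared of `L²(Ω_ε)`, `ε² ∑ₓ |f(x)|²`, as an extended nonnegative number. -/
def normSq (f : Field L) : ℝ≥0∞ := ENNReal.ofReal ((1 / (L : ℝ)) ^ 2 * ∑ x, f x ^ 2)

/-- The energy `∫₀^∞ ‖u_t‖²_{L²} dt` of a path `u`. -/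
def energy (u : ℝ≥0 → Field L) : ℝ≥0∞ := ∫⁻ t, normSq L (u t) ∂timeMeasure

/-- The space `ℍ_a` of drifts: processes that are progressively measurable for the backward
filtration and a.s. square integrable. -/
def IsDrift (W : ℝ≥0 → L2Torus → O → ℝ) (μ : Measure O) (u : ℝ≥0 → O → Field L) : Prop :=
  (∀ t : ℝ≥0, Measurable[Subtype.instMeasurableSpace.prod (backward W μ t)]
    fun p : Set.Ici t × O => u p.1 p.2) ∧
  ∀ᵐ ω ∂μ, energy L (fun t => u t ω) < ∞

/-- The integrated drift `I_∞^ε(u) = ∫₀^∞ q_τ^ε u_τ dτ`. -/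
def Iinfty (m : ℝ) (u : ℝ≥0 → Field L) : Field L :=
  fun x => ∫ t, (q L m t).mulVec (u t) x ∂timeMeasure

/-- The Boué-Dupuis functional
`F(u) = 𝔼 [V (Y_∞^ε + I_∞^ε(u)) + ½ ∫₀^∞ ‖u_t‖²_{L²} dt] ∈ (-∞, ∞]` for a bounded potential `V`
(so that the expectation can be split); `F^{∞,E}` is the case `V = χ_E ∘ v₀^ε`. -/
def boueDupuis (m : ℝ) (V : Field L → ℝ) (W : ℝ≥0 → L2Torus → O → ℝ) (μ : Measure O)
    (u : ℝ≥0 → O → Field L) : EReal :=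
  ((∫ ω, V (Yinfty L m W μ ω + Iinfty L m (fun t => u t ω)) ∂μ : ℝ) : EReal) +
    ((2⁻¹ * ∫⁻ ω, energy L (fun t => u t ω) ∂μ : ℝ≥0∞) : EReal)

/-- `u` minimises the Boué-Dupuis functional in `ℍ_a`. -/
def IsMinimiser (m : ℝ) (V : Field L → ℝ) (W : ℝ≥0 → L2Torus → O → ℝ) (μ : Measure O)
    (u : ℝ≥0 → O → Field L) : Prop :=
  IsDrift L W μ u ∧ ∀ w, IsDrift L W μ w → boueDupuis L m V W μ u ≤ boueDupuis L m V W μ w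

/-- The measure proportional to `exp (-V) dν^{GFF_ε}` is a well-defined probability measure with a
density with respect to `ν^{GFF_ε}`, and both the density and the unnormalised density `exp (-V)`
have `L^p(ν^{GFF_ε})` norm at most `C`. -/
def DensityBound (m : ℝ) (V : Field L → ℝ) (p : ℝ≥0∞) (C : ℝ≥0) : Prop :=
  IsProbabilityMeasure (gibbs L m V) ∧ gibbs L m V ≪ gff L m ∧
  eLpNorm (fun φ => Real.exp (- V φ)) p (gff L m) ≤ C ∧
  eLpNorm ((gibbs L m V).rnDeriv (gff L m)) p (gff L m) ≤ C

end PPhi2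

end

/-!
The whole proof rests on one pathwise estimate, `exists_neg_hamiltonian_add_le`: for every `p > 0`
there are random variables `Z ≥ 0`, with expectations under the Gaussian free field bounded
uniformly in the mesh size, such that for all fields `φ` and `h`
`-p v₀(φ + h) ≤ Z(φ) + ¼ ε² ⟨h, (-Δ^ε + m²) h⟩`.
Expanding `v₀(φ + h)` in Wick powers of `φ`, the term `a_N ε² ∑ h^N` and the Cameron-Martin norm of
`h` must absorb the pairings of `:φⁿ:` with `h^j` for `j < N`. In such a pairing `:φⁿ:` is written
as `(t (-Δ^ε + m²) + 1) q_t :φⁿ:`, where the regularisation scale `t` is a negative power of the size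
of `h`. The mass part is harmless, because the variance of `q_t :φⁿ:` grows more slowly than any
power of `1 / t` (`mollifiedVariance_pow_le`, from the uniform `L^r` bounds on the Green function);
the gradient part has a factor `t`, which beats the powers of `h` produced by the Sobolev
inequality (`exists_pairing_le`). The moments that are needed follow from Gaussian integration by
parts (`gaussExp_chaosSq_pow_le`).

The estimate gives both parts of the proposition.

* Densities. Maurey's property `(τ)` of Gaussian measures (`gaussian_tau`), a consequence of the
  Prékopa-Leindler inequality, bounds `∫ exp (-p V)` as soon as the infimum convolution of `p V`
  with a quarter of the squared Cameron-Martin norm is bounded below on an event of probability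
  `1 / 2`; by the estimate and Markov's inequality it is (`exists_lintegral_exp_neg_le`). The cut-off
  satisfies `min (x, 0) ≤ χ_E(x) ≤ x`, so that the same bound serves for `v₀` and for `χ_E ∘ v₀`.
  Since `v₀` has mean zero, Jensen's inequality bounds the partition functions below by `1`.
* Minimisers. The field `Y_∞` has the law of the Gaussian free field
  (`IsCylindricalBrownianMotion.map_Yinfty`), because `∫₀^∞ q_t² dt = (-Δ^ε + m²)⁻¹`. Hence the
  zero drift has cost at most `0`, and so has a minimiser. The same identity bounds the
  Cameron-Martin norm of `I_∞(u)` by the energy of `u` (`ofReal_dirichlet_Iinfty_le`), and the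
  estimate with `φ = Y_∞`, `h = I_∞(u)` bounds the negative part of the expected potential by a
  constant plus a quarter of the energy, which is absorbed into the half in the functional.
-/

noncomputable section

namespace PPhi2

/-! ### The Prékopa-Leindler inequality and the property `(τ)` of Gaussian measures -/

/-- The one-dimensional Brunn-Minkowski inequality for compact sets. The translates of `K₁` by the
least point of `K₂` and of `K₂` by the greatest point of `K₁` meet in a single point. -/
theorem volume_add_volume_le_of_isCompact {K₁ K₂ S : Set ℝ} (h₁ : IsCompact K₁)
    (h₂ : IsCompact K₂) (n₁ : K₁.Nonempty) (n₂ : K₂.Nonempty)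
    (hS : ∀ x ∈ K₁, ∀ y ∈ K₂, x + y ∈ S) : volume K₁ + volume K₂ ≤ volume S := by
  obtain ⟨a, ha, ha'⟩ := h₁.exists_isGreatest n₁
  obtain ⟨b, hb, hb'⟩ := h₂.exists_isLeast n₂
  have e₁ : volume ((fun x => b + x) '' K₁) = volume K₁ := by
    rw [Set.image_add_left, measure_preimage_add]
  have e₂ : volume ((fun x => a + x) '' K₂) = volume K₂ := by
    rw [Set.image_add_left, measure_preimage_add]
  have hd : AEDisjoint volume ((fun x => b + x) '' K₁) ((fun x => a + x) '' K₂) := by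
    refine measure_mono_null (t := {a + b}) ?_ (by simp)
    rintro z ⟨⟨x, hx, rfl⟩, ⟨y, hy, hxy⟩⟩
    have h1 := ha' hx
    have h2 := hb' hy
    simp only [Set.mem_singleton_iff] at hxy ⊢
    linarith
  rw [← e₁, ← e₂, ← measure_union₀ _ hd]
  · apply measure_mono
    rintro z (⟨x, hx, rfl⟩ | ⟨x, hx, rfl⟩)
    · simpa [add_comm] using hS x hx b hb
    · exact hS a ha x hx
  · exact (h₂.image (by fun_prop)).measurableSet.nullMeasurableSet

theorem volume_add_volume_le {A B S : Set ℝ} (hA : MeasurableSet A) (hB : MeasurableSet B)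
    (nA : A.Nonempty) (nB : B.Nonempty) (hS : ∀ x ∈ A, ∀ y ∈ B, x + y ∈ S) :
    volume A + volume B ≤ volume S := by
  obtain ⟨a, ha⟩ := nA
  obtain ⟨b, hb⟩ := nB
  have key : ∀ K₁ ⊆ A, IsCompact K₁ → ∀ K₂ ⊆ B, IsCompact K₂ →
      volume K₁ + volume K₂ ≤ volume S := by
    intro K₁ s₁ c₁ K₂ s₂ c₂
    refine le_trans (add_le_add (measure_mono (Set.subset_insert a K₁))
      (measure_mono (Set.subset_insert b K₂))) ?_
    refine volume_add_volume_le_of_isCompact (c₁.insert a) (c₂.insert b) (Set.insert_nonempty _ _)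
      (Set.insert_nonempty _ _) ?_
    intro x hx y hy
    exact hS x (Set.insert_subset ha s₁ hx) y (Set.insert_subset hb s₂ hy)
  have key' : ∀ K₂ ⊆ B, IsCompact K₂ → volume A + volume K₂ ≤ volume S := by
    intro K₂ s₂ c₂
    rw [hA.measure_eq_iSup_isCompact, ENNReal.iSup_add]
    refine iSup_le fun K₁ => ?_
    by_cases h : K₁ ⊆ A
    · by_cases h' : IsCompact K₁
      · simpa [h, h'] using key K₁ h h' K₂ s₂ c₂
      · simpa [h, h'] using key ∅ (Set.empty_subset _) isCompact_empty K₂ s₂ c₂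
    · simpa [h] using key ∅ (Set.empty_subset _) isCompact_empty K₂ s₂ c₂
  rw [hB.measure_eq_iSup_isCompact, ENNReal.add_iSup]
  refine iSup_le fun K₁ => ?_
  by_cases h : K₁ ⊆ B
  · by_cases h' : IsCompact K₁
    · simpa [h, h'] using key' K₁ h h'
    · simpa [h, h'] using key' ∅ (Set.empty_subset _) isCompact_empty
  · simpa [h] using key' ∅ (Set.empty_subset _) isCompact_empty

/-- The Prékopa-Leindler inequality for functions whose suprema are both `1`, in its additive
form: the superlevel sets of `h` contain the midpoints of those of `f` and `g`. -/
theorem lintegral_add_le_of_sup_eq_one {f g h : ℝ → ℝ} (hf : Measurable f) (hg : Measurable g)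
    (hh : Measurable h) (f0 : ∀ x, 0 ≤ f x) (g0 : ∀ x, 0 ≤ g x) (h0 : ∀ x, 0 ≤ h x)
    (f1 : ∀ x, f x ≤ 1) (g1 : ∀ x, g x ≤ 1) (fs : ∀ t < 1, ∃ x, t < f x)
    (gs : ∀ t < 1, ∃ x, t < g x) (H : ∀ x y, f x * g y ≤ h ((x + y) / 2) ^ 2) :
    (∫⁻ x, ENNReal.ofReal (f x)) + ∫⁻ x, ENNReal.ofReal (g x) ≤
      2 * ∫⁻ x, ENNReal.ofReal (h x) := by
  rw [lintegral_eq_lintegral_meas_lt _ (ae_of_all _ f0) hf.aemeasurable,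
    lintegral_eq_lintegral_meas_lt _ (ae_of_all _ g0) hg.aemeasurable,
    lintegral_eq_lintegral_meas_lt _ (ae_of_all _ h0) hh.aemeasurable,
    ← lintegral_const_mul' _ _ (by simp), ← lintegral_add_left']
  swap
  · refine (Antitone.measurable ?_).aemeasurable
    intro s t hst
    exact measure_mono fun x hx => lt_of_le_of_lt hst hx
  refine setLIntegral_mono' measurableSet_Ioi fun t ht => ?_
  have ht : 0 < t := ht
  by_cases ht1 : t < 1
  · have hm := volume_add_volume_le (S := (fun x => 2 * x) '' {x | t < h x})
      (measurableSet_lt measurable_const hf) (measurableSet_lt measurable_const hg)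
      (fs t ht1) (gs t ht1) (by
        intro x hx y hy
        refine ⟨(x + y) / 2, ?_, by ring⟩
        have hx : t < f x := hx
        have hy : t < g y := hy
        have h2 := (mul_lt_mul'' hx hy ht.le ht.le).trans_le (H x y)
        simp only [Set.mem_ofPred_eq]
        nlinarith [h0 ((x + y) / 2)])
    refine hm.trans (le_of_eq ?_)
    have := Measure.addHaar_smul (volume : Measure ℝ) 2 {x | t < h x}
    simp only [Module.finrank_self, pow_one, abs_two, ENNReal.ofReal_ofNat] at this
    exact this
  · have e1 : {x | t < f x} = ∅ := by
      ext x; simp; linarith [f1 x]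
    have e2 : {x | t < g x} = ∅ := by
      ext x; simp; linarith [g1 x]
    simp [e1, e2]

/-- The Prékopa-Leindler inequality in dimension one, at the parameter `1 / 2`, for bounded
functions. -/
theorem lintegral_mul_lintegral_le_one {f g h : ℝ → ℝ} (hf : Measurable f) (hg : Measurable g)
    (hh : Measurable h) (f0 : ∀ x, 0 ≤ f x) (g0 : ∀ x, 0 ≤ g x) (h0 : ∀ x, 0 ≤ h x)
    (fb : BddAbove (Set.range f)) (gb : BddAbove (Set.range g))
    (H : ∀ x y, f x * g y ≤ h ((x + y) / 2) ^ 2) (h1 : ∫⁻ x, ENNReal.ofReal (h x) ≤ 1) :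
    (∫⁻ x, ENNReal.ofReal (f x)) * ∫⁻ x, ENNReal.ofReal (g x) ≤ 1 := by
  set s := ⨆ x, f x with hs
  set t := ⨆ x, g x with ht
  have fs : ∀ x, f x ≤ s := le_ciSup fb
  have gt : ∀ x, g x ≤ t := le_ciSup gb
  rcases (Real.iSup_nonneg f0).eq_or_lt with hs0 | hs0
  · have : ∀ x, f x = 0 := fun x => le_antisymm (by rw [hs0]; exact fs x) (f0 x)
    simp [this]
  rcases (Real.iSup_nonneg g0).eq_or_lt with ht0 | ht0
  · have : ∀ x, g x = 0 := fun x => le_antisymm (by rw [ht0]; exact gt x) (g0 x)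
    simp [this]
  rw [← hs] at hs0
  rw [← ht] at ht0
  set r := √(s * t) with hr
  have hr0 : 0 < r := Real.sqrt_pos.2 (mul_pos hs0 ht0)
  have hrr : r ^ 2 = s * t := Real.sq_sqrt (mul_pos hs0 ht0).le
  have key := lintegral_add_le_of_sup_eq_one (f := fun x => s⁻¹ * f x) (g := fun x => t⁻¹ * g x)
    (h := fun x => r⁻¹ * h x) (hf.const_mul _) (hg.const_mul _) (hh.const_mul _)
    (fun x => mul_nonneg (inv_pos.2 hs0).le (f0 x)) (fun x => mul_nonneg (inv_pos.2 ht0).le (g0 x))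
    (fun x => mul_nonneg (inv_pos.2 hr0).le (h0 x))
    (fun x => by rw [inv_mul_le_iff₀ hs0]; simpa using fs x)
    (fun x => by rw [inv_mul_le_iff₀ ht0]; simpa using gt x)
    (fun u hu => by
      obtain ⟨x, hx⟩ := exists_lt_of_lt_ciSup (f := f) (b := s * u) (by rw [← hs]; nlinarith)
      exact ⟨x, by rwa [lt_inv_mul_iff₀ hs0]⟩)
    (fun u hu => by
      obtain ⟨x, hx⟩ := exists_lt_of_lt_ciSup (f := g) (b := t * u) (by rw [← ht]; nlinarith)
      exact ⟨x, by rwa [lt_inv_mul_iff₀ ht0]⟩)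
    (fun x y => by
      have := H x y
      rw [mul_pow, inv_pow, hrr, mul_inv]
      calc s⁻¹ * f x * (t⁻¹ * g y) = s⁻¹ * t⁻¹ * (f x * g y) := by ring
        _ ≤ _ := by gcongr)
  simp only [ENNReal.ofReal_mul (inv_pos.2 hs0).le, ENNReal.ofReal_mul (inv_pos.2 ht0).le,
    ENNReal.ofReal_mul (inv_pos.2 hr0).le] at key
  rw [lintegral_const_mul' _ _ (by simp), lintegral_const_mul' _ _ (by simp),
    lintegral_const_mul' _ _ (by simp)] at key
  set a := ∫⁻ x, ENNReal.ofReal (f x) with ha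
  set b := ∫⁻ x, ENNReal.ofReal (g x) with hb
  have key2 : ENNReal.ofReal s⁻¹ * a + ENNReal.ofReal t⁻¹ * b ≤ ENNReal.ofReal (2 * r⁻¹) := by
    refine key.trans ?_
    rw [ENNReal.ofReal_mul (by norm_num)]
    calc _ ≤ 2 * (ENNReal.ofReal r⁻¹ * 1) := by gcongr
      _ = _ := by simp
  have afin : a ≠ ∞ := by
    intro h
    rw [h, ENNReal.mul_top (by simpa using hs0), top_add, top_le_iff] at key2
    exact ENNReal.ofReal_ne_top key2
  have bfin : b ≠ ∞ := by
    intro h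
    rw [h, ENNReal.mul_top (by simpa using ht0), add_top, top_le_iff] at key2
    exact ENNReal.ofReal_ne_top key2
  rw [← ENNReal.ofReal_toReal afin, ← ENNReal.ofReal_toReal bfin] at key2 ⊢
  rw [← ENNReal.ofReal_mul (inv_pos.2 hs0).le, ← ENNReal.ofReal_mul (inv_pos.2 ht0).le,
    ← ENNReal.ofReal_add (by positivity) (by positivity),
    ENNReal.ofReal_le_ofReal_iff (by positivity)] at key2
  rw [← ENNReal.ofReal_mul (by positivity), ← ENNReal.ofReal_one]
  apply ENNReal.ofReal_le_ofReal
  set a' := a.toReal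
  set b' := b.toReal
  have p1 : 0 ≤ s⁻¹ * a' := by positivity
  have p2 : 0 ≤ t⁻¹ * b' := by positivity
  -- arithmetic-geometric mean inequality for `a / s` and `b / t`
  have h3 : 4 * ((s⁻¹ * a') * (t⁻¹ * b')) ≤ (2 * r⁻¹) ^ 2 := by
    calc _ ≤ (s⁻¹ * a' + t⁻¹ * b') ^ 2 := by nlinarith [sq_nonneg (s⁻¹ * a' - t⁻¹ * b')]
      _ ≤ _ := by gcongr
  rw [mul_pow, inv_pow, hrr] at h3
  have h4 : 4 * ((s⁻¹ * a') * (t⁻¹ * b')) = 4 * ((s * t)⁻¹ * (a' * b')) := by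
    rw [mul_inv]; ring
  rw [h4] at h3
  have : (s * t)⁻¹ * (a' * b') ≤ (s * t)⁻¹ * 1 := by linarith
  exact le_of_mul_le_mul_left this (by positivity)

theorem gaussian_tau_one {f g : ℝ → ℝ≥0∞} (hf : Measurable f) (hg : Measurable g)
    (H : ∀ x y, g x * f y ≤ ENNReal.ofReal (Real.exp ((x - y) ^ 2 / 4))) :
    (∫⁻ x, g x ∂gaussianReal 0 1) * ∫⁻ x, f x ∂gaussianReal 0 1 ≤ 1 := by
  have htr : ∀ u : ℝ → ℝ≥0∞, Measurable u →
      (∫⁻ x, u x ∂gaussianReal 0 1) = ⨆ n : ℕ, ∫⁻ x, min (u x) n ∂gaussianReal 0 1 := by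
    intro u hu
    rw [← lintegral_iSup (fun n => hu.min measurable_const)]
    · refine lintegral_congr fun x => ?_
      refine le_antisymm ?_ (iSup_le fun n => min_le_left _ _)
      have : ⨆ n : ℕ, min (u x) (n : ℝ≥0∞) = min (u x) (⨆ n : ℕ, (n : ℝ≥0∞)) :=
        (inf_iSup_eq (u x) _).symm
      rw [this, ENNReal.iSup_natCast]; simp
    · intro n k hnk x
      exact min_le_min_left _ (by exact_mod_cast hnk)
  have pdfle : ∀ x, gaussianPDFReal 0 1 x ≤ (√(2 * Real.pi * (1 : ℝ≥0)))⁻¹ := by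
    intro x
    rw [gaussianPDFReal_def]
    have : Real.exp (-(x - 0) ^ 2 / (2 * (1 : ℝ≥0))) ≤ 1 := by
      rw [Real.exp_le_one_iff, neg_div]
      simp only [Left.neg_nonpos_iff]
      positivity
    exact mul_le_of_le_one_right (by positivity) this
  have conv : ∀ u : ℝ → ℝ≥0∞, Measurable u → ∀ n : ℕ,
      (∫⁻ x, min (u x) n ∂gaussianReal 0 1) =
        ∫⁻ x, ENNReal.ofReal ((min (u x) n).toReal * gaussianPDFReal 0 1 x) := by
    intro u hu n
    rw [gaussianReal_of_var_ne_zero _ one_ne_zero,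
      lintegral_withDensity_eq_lintegral_mul _ (measurable_gaussianPDF _ _)
        (hu.min measurable_const)]
    refine lintegral_congr fun x => ?_
    have hfin : min (u x) (n : ℝ≥0∞) ≠ ∞ := ne_top_of_le_ne_top (by simp) (min_le_right _ _)
    rw [ENNReal.ofReal_mul (by positivity), ENNReal.ofReal_toReal hfin, Pi.mul_apply, mul_comm,
      gaussianPDF_def]
  have bdd : ∀ u : ℝ → ℝ≥0∞, ∀ n : ℕ,
      BddAbove (Set.range fun x => (min (u x) n).toReal * gaussianPDFReal 0 1 x) := by
    intro u n
    refine ⟨n * (√(2 * Real.pi * (1 : ℝ≥0)))⁻¹, ?_⟩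
    rintro _ ⟨x, rfl⟩
    have : (min (u x) (n : ℝ≥0∞)).toReal ≤ n := by
      have := ENNReal.toReal_mono (b := (n : ℝ≥0∞)) (by simp) (min_le_right (u x) _)
      simpa using this
    exact mul_le_mul this (pdfle x) (gaussianPDFReal_nonneg _ _ _) (by positivity)
  rw [htr f hf, htr g hg, ENNReal.iSup_mul]
  refine iSup_le fun n => ?_
  rw [ENNReal.mul_iSup]
  refine iSup_le fun k => ?_
  rw [conv g hg, conv f hf]
  refine lintegral_mul_lintegral_le_one (h := gaussianPDFReal 0 1)
    ((hg.min measurable_const).ennreal_toReal.mul (measurable_gaussianPDFReal _ _))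
    ((hf.min measurable_const).ennreal_toReal.mul (measurable_gaussianPDFReal _ _))
    (measurable_gaussianPDFReal _ _)
    (fun x => mul_nonneg (by positivity) (gaussianPDFReal_nonneg _ _ _))
    (fun x => mul_nonneg (by positivity) (gaussianPDFReal_nonneg _ _ _))
    (gaussianPDFReal_nonneg _ _) (bdd g n) (bdd f k) ?_
    (lintegral_gaussianPDFReal_eq_one 0 one_ne_zero).le
  intro x y
  have h1 : (min (g x) (n : ℝ≥0∞)).toReal * (min (f y) (k : ℝ≥0∞)).toReal ≤
      Real.exp ((x - y) ^ 2 / 4) := by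
    rw [← ENNReal.toReal_mul]
    refine ENNReal.toReal_le_of_le_ofReal (Real.exp_pos _).le ?_
    exact (mul_le_mul' (min_le_left _ _) (min_le_left _ _)).trans (H x y)
  calc _ = ((min (g x) (n : ℝ≥0∞)).toReal * (min (f y) (k : ℝ≥0∞)).toReal) *
        (gaussianPDFReal 0 1 x * gaussianPDFReal 0 1 y) := by ring
    _ ≤ Real.exp ((x - y) ^ 2 / 4) * (gaussianPDFReal 0 1 x * gaussianPDFReal 0 1 y) :=
        mul_le_mul_of_nonneg_right h1
          (mul_nonneg (gaussianPDFReal_nonneg _ _ _) (gaussianPDFReal_nonneg _ _ _))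
    _ = _ := by
        simp only [gaussianPDFReal_def]
        -- `(x - y)² / 4 - x² / 2 - y² / 2 = - ((x + y) / 2)²`
        have : Real.exp ((x - y) ^ 2 / 4) * (Real.exp (-(x - 0) ^ 2 / (2 * (1 : ℝ≥0))) *
            Real.exp (-(y - 0) ^ 2 / (2 * (1 : ℝ≥0)))) =
            Real.exp (-((x + y) / 2 - 0) ^ 2 / (2 * (1 : ℝ≥0))) ^ 2 := by
          rw [← Real.exp_add, ← Real.exp_add, ← Real.exp_nat_mul]
          congr 1
          push_cast
          ring
        rw [mul_pow, ← this]
        ring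

theorem gaussian_tau_fin (n : ℕ) {f g : (Fin n → ℝ) → ℝ≥0∞} (hf : Measurable f)
    (hg : Measurable g)
    (H : ∀ x y, g x * f y ≤ ENNReal.ofReal (Real.exp ((∑ i, (x i - y i) ^ 2) / 4))) :
    (∫⁻ x, g x ∂Measure.pi fun _ => gaussianReal 0 1) *
      ∫⁻ x, f x ∂(Measure.pi fun _ => gaussianReal 0 1) ≤ 1 := by
  induction n with
  | zero =>
    have := H default default
    simp only [Measure.pi_of_empty _ default]
    rw [lintegral_dirac, lintegral_dirac]
    simpa using this
  | succ n ih =>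
    have e := (measurePreserving_piFinSuccAbove (fun _ : Fin (n + 1) => gaussianReal 0 1) 0).symm
    have split : ∀ u : (Fin (n + 1) → ℝ) → ℝ≥0∞, Measurable u →
        (∫⁻ x, u x ∂Measure.pi fun _ => gaussianReal 0 1) =
          ∫⁻ a, ∫⁻ b, u (Fin.cons a b) ∂(Measure.pi fun _ => gaussianReal 0 1)
            ∂gaussianReal 0 1 := by
      intro u hu
      rw [← e.lintegral_comp hu, lintegral_prod (fun a => u ((MeasurableEquiv.piFinSuccAbove
        (fun _ => ℝ) 0).symm a)) (hu.comp e.measurable).aemeasurable]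
      simp [MeasurableEquiv.piFinSuccAbove, Fin.insertNthEquiv]
    have meas : ∀ u : (Fin (n + 1) → ℝ) → ℝ≥0∞, Measurable u →
        Measurable fun p : ℝ × (Fin n → ℝ) => u (Fin.cons p.1 p.2) := by
      intro u hu
      have := hu.comp e.measurable
      simpa [MeasurableEquiv.piFinSuccAbove, Fin.insertNthEquiv, Function.comp_def] using this
    rw [split f hf, split g hg]
    refine gaussian_tau_one (meas f hf).lintegral_prod_right' (meas g hg).lintegral_prod_right' ?_
    intro x y
    -- divide by the exponential of the first coordinate and use the induction hypothesis
    set c := Real.exp ((x - y) ^ 2 / 4) with hc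
    have hc0 : 0 < c := Real.exp_pos _
    have := ih (f := fun b => f (Fin.cons y b))
      (g := fun b => ENNReal.ofReal c⁻¹ * g (Fin.cons x b))
      ((meas f hf).comp measurable_prodMk_left)
      (((meas g hg).comp measurable_prodMk_left).const_mul _) (by
        intro a b
        calc _ = ENNReal.ofReal c⁻¹ * (g (Fin.cons x a) * f (Fin.cons y b)) := by ring
          _ ≤ ENNReal.ofReal c⁻¹ * ENNReal.ofReal (Real.exp
              ((∑ i, ((Fin.cons x a : Fin (n + 1) → ℝ) i -
                (Fin.cons y b : Fin (n + 1) → ℝ) i) ^ 2) / 4)) := by gcongr; exact H _ _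
          _ = _ := by
            rw [← ENNReal.ofReal_mul (by positivity), Fin.sum_univ_succ]
            simp only [Fin.cons_zero, Fin.cons_succ]
            rw [add_div, Real.exp_add, ← hc]
            congr 1
            field_simp)
    rw [lintegral_const_mul' _ _ (by simp), mul_assoc] at this
    have h2 := mul_le_mul_right this (ENNReal.ofReal c)
    rwa [← mul_assoc, ← ENNReal.ofReal_mul hc0.le, mul_inv_cancel₀ hc0.ne', ENNReal.ofReal_one,
      one_mul, mul_one] at h2

/-- Maurey's property `(τ)` of the standard Gaussian measure, for the quadratic cost. -/
theorem gaussian_tau {ι : Type*} [Fintype ι] {f g : (ι → ℝ) → ℝ≥0∞} (hf : Measurable f)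
    (hg : Measurable g)
    (H : ∀ x y, g x * f y ≤ ENNReal.ofReal (Real.exp ((∑ i, (x i - y i) ^ 2) / 4))) :
    (∫⁻ x, g x ∂Measure.pi fun _ => gaussianReal 0 1) *
      ∫⁻ x, f x ∂(Measure.pi fun _ => gaussianReal 0 1) ≤ 1 := by
  have e := measurePreserving_piCongrLeft (fun _ : ι => gaussianReal 0 1) (Fintype.equivFin ι).symm
  rw [← e.lintegral_comp hf, ← e.lintegral_comp hg]
  refine gaussian_tau_fin _ (hf.comp e.measurable) (hg.comp e.measurable) fun x y => ?_
  refine (H _ _).trans (le_of_eq ?_)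
  congr 3
  rw [← (Fintype.equivFin ι).symm.sum_comp]
  simp [MeasurableEquiv.piCongrLeft, Equiv.piCongrLeft_apply_apply]

/-! ### Gaussian integration by parts for polynomials -/

theorem integrable_pow_gaussianReal (n : ℕ) :
    Integrable (fun x : ℝ => x ^ n) (gaussianReal 0 1) := by
  have := (memLp_id_gaussianReal (μ := 0) (v := 1) n).integrable_norm_pow'
  refine this.mono' (by fun_prop) (ae_of_all _ fun x => ?_)
  simp

theorem integral_mul_pow_gaussianReal (n : ℕ) :
    ∫ x : ℝ, x ^ (n + 1) ∂gaussianReal 0 1 = n * ∫ x : ℝ, x ^ (n - 1) ∂gaussianReal 0 1 := by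
  have hint : ∀ k : ℕ, Integrable fun x : ℝ => gaussianPDFReal 0 1 x * x ^ k := by
    intro k
    have := integrable_pow_gaussianReal k
    rw [gaussianReal_of_var_ne_zero _ one_ne_zero,
      integrable_withDensity_iff_integrable_smul₀' (measurable_gaussianPDF _ _).aemeasurable
        (ae_of_all _ fun x => gaussianPDF_lt_top)] at this
    simpa [toReal_gaussianPDF] using this
  have hder : ∀ x : ℝ, HasDerivAt (fun x : ℝ => gaussianPDFReal 0 1 x * x ^ n)
      (n * (gaussianPDFReal 0 1 x * x ^ (n - 1)) - gaussianPDFReal 0 1 x * x ^ (n + 1)) x := by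
    intro x
    have h1 : HasDerivAt (fun x : ℝ => gaussianPDFReal 0 1 x) (- x * gaussianPDFReal 0 1 x) x := by
      simp only [gaussianPDFReal_def]
      have : HasDerivAt (fun x : ℝ => -(x - 0) ^ 2 / (2 * (1 : ℝ≥0))) (-x) x := by
        refine HasDerivAt.congr_deriv
          ((((hasDerivAt_id x).sub_const 0).pow 2).neg.div_const (2 * ((1 : ℝ≥0) : ℝ))) ?_
        simp
        ring
      refine (this.exp.const_mul (√(2 * Real.pi * (1 : ℝ≥0)))⁻¹).congr_deriv ?_
      ring
    refine (h1.mul (hasDerivAt_pow n x)).congr_deriv ?_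
    ring
  have h0 := integral_eq_zero_of_hasDerivAt_of_integrable hder
    (((hint (n - 1)).const_mul _).sub (hint (n + 1))) (hint n)
  rw [integral_sub ((hint (n - 1)).const_mul _) (hint (n + 1)), integral_const_mul] at h0
  simp only [integral_gaussianReal_eq_integral_smul one_ne_zero, smul_eq_mul]
  linarith

variable {ι : Type} [Fintype ι]

theorem integrable_eval_gaussian (p : MvPolynomial ι ℝ) :
    Integrable (fun ξ : ι → ℝ => MvPolynomial.eval ξ p)
      (Measure.pi fun _ => gaussianReal 0 1) := by
  induction p using MvPolynomial.induction_on' with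
  | monomial s c =>
    simp only [MvPolynomial.eval_monomial]
    refine Integrable.const_mul ?_ c
    have := Integrable.fintype_prod (μ := fun _ : ι => gaussianReal 0 1)
      (f := fun (i : ι) (x : ℝ) => x ^ s i) (fun i => integrable_pow_gaussianReal (s i))
    refine this.congr (ae_of_all _ fun ξ => ?_)
    simp [Finsupp.prod_fintype]
  | add p q hp hq =>
    refine (hp.add hq).congr (ae_of_all _ fun ξ => ?_)
    simp

/-- The expectation of a polynomial in independent standard Gaussian variables. -/
def gaussExp : MvPolynomial ι ℝ →ₗ[ℝ] ℝ where
  toFun p := ∫ ξ, MvPolynomial.eval ξ p ∂Measure.pi fun _ => gaussianReal 0 1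
  map_add' p q := by
    simp only [map_add]
    exact integral_add (integrable_eval_gaussian p) (integrable_eval_gaussian q)
  map_smul' c p := by
    simp only [MvPolynomial.smul_eval, RingHom.id_apply, smul_eq_mul]
    exact integral_const_mul _ _

theorem gaussExp_apply (p : MvPolynomial ι ℝ) :
    gaussExp p = ∫ ξ, MvPolynomial.eval ξ p ∂Measure.pi fun _ => gaussianReal 0 1 := rfl

theorem gaussExp_mono {p q : MvPolynomial ι ℝ}
    (h : ∀ ξ, MvPolynomial.eval ξ p ≤ MvPolynomial.eval ξ q) : gaussExp p ≤ gaussExp q :=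
  integral_mono (integrable_eval_gaussian p) (integrable_eval_gaussian q) h

theorem gaussExp_monomial (s : ι →₀ ℕ) (c : ℝ) :
    gaussExp (MvPolynomial.monomial s c) = c * ∏ i, ∫ x : ℝ, x ^ s i ∂gaussianReal 0 1 := by
  rw [gaussExp_apply]
  simp only [MvPolynomial.eval_monomial]
  rw [integral_const_mul, ← integral_fintype_prod_eq_prod]
  congr 1
  refine integral_congr_ae (ae_of_all _ fun ξ => ?_)
  simp [Finsupp.prod_fintype]

theorem gaussExp_X_mul (a : ι) (p : MvPolynomial ι ℝ) :
    gaussExp (MvPolynomial.X a * p) = gaussExp (MvPolynomial.pderiv a p) := by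
  classical
  induction p using MvPolynomial.induction_on' with
  | monomial s c =>
    set u : ι →₀ ℕ := Finsupp.single a 1
    have hX : (MvPolynomial.X a : MvPolynomial ι ℝ) = MvPolynomial.monomial u 1 := rfl
    rw [MvPolynomial.pderiv_monomial, gaussExp_monomial, hX, MvPolynomial.monomial_mul,
      gaussExp_monomial, ← Finset.mul_prod_erase _ _ (Finset.mem_univ a),
      ← Finset.mul_prod_erase _ _ (Finset.mem_univ a)]
    have h1 : ∏ i ∈ Finset.univ.erase a, ∫ x : ℝ, x ^ ((u + s) i) ∂gaussianReal 0 1 =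
        ∏ i ∈ Finset.univ.erase a, ∫ x : ℝ, x ^ ((s - u) i) ∂gaussianReal 0 1 := by
      refine Finset.prod_congr rfl fun i hi => ?_
      have hi : i ≠ a := Finset.ne_of_mem_erase hi
      have : u i = 0 := Finsupp.single_eq_of_ne hi
      simp [this]
    have h2 := integral_mul_pow_gaussianReal (s a)
    have e0 : u a = 1 := Finsupp.single_eq_same
    have e1 : (u + s) a = s a + 1 := by simp [e0, add_comm]
    have e2 : (s - u) a = s a - 1 := by simp [e0]
    rw [h1, e1, e2, h2]
    ring
  | add p q hp hq => simp only [mul_add, map_add, hp, hq]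

/-! ### Wick polynomials and their moments -/

/-- The Wick power `:xⁿ:` of a Gaussian variable of variance `c`, by the three-term recursion of
the Hermite polynomials. It makes sense in every commutative ring. -/
def wick {R : Type*} [CommRing R] (c x : R) : ℕ → R
  | 0 => 1
  | 1 => x
  | n + 2 => x * wick c x (n + 1) - (n + 1) * c * wick c x n

theorem wick_succ {R : Type*} [CommRing R] (c x : R) (n : ℕ) :
    wick c x (n + 1) = x * wick c x n - n * c * wick c x (n - 1) := by
  cases n with
  | zero => simp [wick]
  | succ n => simp [wick]

theorem map_wick {R S : Type*} [CommRing R] [CommRing S] (f : R →+* S) (c x : R) (n : ℕ) :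
    f (wick c x n) = wick (f c) (f x) n := by
  induction n using Nat.twoStepInduction with
  | zero => simp [wick]
  | one => simp [wick]
  | more n h1 h2 => simp [wick, h1, h2]

theorem derivation_wick {R A : Type*} [CommRing R] [CommRing A] [Algebra R A]
    (D : Derivation R A A) (c x : A) (hc : D c = 0) (n : ℕ) :
    D (wick c x n) = n * D x * wick c x (n - 1) := by
  induction n using Nat.twoStepInduction with
  | zero => simp [wick]
  | one => simp [wick]
  | more n h1 h2 =>
    have h3 := wick_succ c x n
    simp only [wick, map_sub, Derivation.leibniz, h1, h2, hc, smul_eq_mul,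
      Nat.add_sub_cancel, show n + 2 - 1 = n + 1 by lia, map_add,
      Derivation.map_natCast, Derivation.map_one_eq_zero]
    push_cast
    rw [h3]
    ring

variable {κ : Type}

/-- The linear form `∑ₐ B y a ξₐ` in the Gaussian variables. -/
def linForm (B : κ → ι → ℝ) (y : κ) : MvPolynomial ι ℝ :=
  ∑ a, MvPolynomial.C (B y a) * MvPolynomial.X a

/-- The Wick power `:φⁿ(y):` of the Gaussian field `φ = B ξ`, as a polynomial in `ξ`. -/
def wickPoly (B : κ → ι → ℝ) (n : ℕ) (y : κ) : MvPolynomial ι ℝ :=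
  wick (MvPolynomial.C (∑ a, B y a ^ 2)) (linForm B y) n

theorem pderiv_linForm (B : κ → ι → ℝ) (y : κ) (a : ι) :
    MvPolynomial.pderiv a (linForm B y) = MvPolynomial.C (B y a) := by
  classical
  simp [linForm, MvPolynomial.pderiv_X, Pi.single_apply]

theorem pderiv_wickPoly (B : κ → ι → ℝ) (n : ℕ) (y : κ) (a : ι) :
    MvPolynomial.pderiv a (wickPoly B n y) =
      (n : MvPolynomial ι ℝ) * MvPolynomial.C (B y a) * wickPoly B (n - 1) y := by
  rw [wickPoly, derivation_wick _ _ _ (MvPolynomial.pderiv_C), pderiv_linForm]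
  rfl

theorem eval_wickPoly (B : κ → ι → ℝ) (n : ℕ) (y : κ) (ξ : ι → ℝ) :
    MvPolynomial.eval ξ (wickPoly B n y) = wick (∑ a, B y a ^ 2) (∑ a, B y a * ξ a) n := by
  rw [wickPoly, map_wick]
  simp [linForm]

theorem gaussExp_linForm_mul (B : κ → ι → ℝ) (y : κ) (p : MvPolynomial ι ℝ) :
    gaussExp (linForm B y * p) = ∑ a, B y a * gaussExp (MvPolynomial.pderiv a p) := by
  rw [linForm, Finset.sum_mul, map_sum]
  refine Finset.sum_congr rfl fun a _ => ?_
  rw [mul_assoc, ← MvPolynomial.smul_eq_C_mul, map_smul, gaussExp_X_mul, smul_eq_mul]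

theorem gaussExp_C_mul (c : ℝ) (p : MvPolynomial ι ℝ) :
    gaussExp (MvPolynomial.C c * p) = c * gaussExp p := by
  rw [← MvPolynomial.smul_eq_C_mul, map_smul, smul_eq_mul]

/-- Integration by parts for Wick powers. -/
theorem gaussExp_wickPoly_mul (B : κ → ι → ℝ) (n : ℕ) (y : κ) (p : MvPolynomial ι ℝ) :
    gaussExp (wickPoly B (n + 1) y * p) =
      ∑ a, B y a * gaussExp (wickPoly B n y * MvPolynomial.pderiv a p) := by
  have e : wickPoly B (n + 1) y * p = linForm B y * (wickPoly B n y * p) -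
      MvPolynomial.C (n * ∑ a, B y a ^ 2) * (wickPoly B (n - 1) y * p) := by
    rw [wickPoly, wick_succ, ← wickPoly, ← wickPoly]
    simp only [map_mul, map_natCast]
    ring
  rw [e, map_sub, gaussExp_linForm_mul, gaussExp_C_mul, mul_assoc, Finset.sum_mul, Finset.mul_sum,
    ← Finset.sum_sub_distrib]
  refine Finset.sum_congr rfl fun a _ => ?_
  have e2 : MvPolynomial.pderiv a (wickPoly B n y * p) =
      MvPolynomial.C (n * B y a) * (wickPoly B (n - 1) y * p) +
        wickPoly B n y * MvPolynomial.pderiv a p := by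
    rw [Derivation.leibniz, pderiv_wickPoly]
    simp only [map_mul, map_natCast, smul_eq_mul]
    ring
  rw [e2, map_add, gaussExp_C_mul]
  ring

theorem gaussExp_wickPoly (B : κ → ι → ℝ) {n : ℕ} (hn : n ≠ 0) (y : κ) :
    gaussExp (wickPoly B n y) = 0 := by
  obtain ⟨k, rfl⟩ := Nat.exists_eq_succ_of_ne_zero hn
  have := gaussExp_wickPoly_mul B k y 1
  simpa using this

theorem integral_wick_eq_zero (B : κ → ι → ℝ) {n : ℕ} (hn : n ≠ 0) (y : κ) :
    ∫ ξ, wick (∑ a, B y a ^ 2) (∑ a, B y a * ξ a) n ∂(Measure.pi fun _ => gaussianReal 0 1) = 0 := by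
  have := gaussExp_wickPoly B hn y
  rw [gaussExp_apply] at this
  simpa [eval_wickPoly] using this

theorem integrable_wick (B : κ → ι → ℝ) (n : ℕ) (y : κ) :
    Integrable (fun ξ => wick (∑ a, B y a ^ 2) (∑ a, B y a * ξ a) n)
      (Measure.pi fun _ => gaussianReal 0 1) := by
  have := integrable_eval_gaussian (wickPoly B n y)
  simpa [eval_wickPoly] using this

variable [Fintype κ]

/-- The element `∑ K(y) :φⁿ(y):` of the `n`-th Wiener chaos. -/
def chaos (B : κ → ι → ℝ) (n : ℕ) (K : κ → ℝ) : MvPolynomial ι ℝ :=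
  ∑ y, MvPolynomial.C (K y) * wickPoly B n y

theorem pderiv_chaos (B : κ → ι → ℝ) (n : ℕ) (K : κ → ℝ) (a : ι) :
    MvPolynomial.pderiv a (chaos B (n + 1) K) =
      MvPolynomial.C (n + 1 : ℝ) * chaos B n fun y => K y * B y a := by
  simp only [chaos, map_sum, Finset.mul_sum]
  refine Finset.sum_congr rfl fun y _ => ?_
  rw [Derivation.leibniz, pderiv_wickPoly, MvPolynomial.pderiv_C]
  simp only [map_mul, map_add, map_natCast, map_one, smul_eq_mul, Nat.add_sub_cancel]
  push_cast
  ring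

theorem gaussExp_chaos_mul (B : κ → ι → ℝ) (n : ℕ) (K : κ → ℝ) (p : MvPolynomial ι ℝ) :
    gaussExp (chaos B (n + 1) K * p) =
      ∑ a, gaussExp (chaos B n (fun y => K y * B y a) * MvPolynomial.pderiv a p) := by
  simp only [chaos, Finset.sum_mul, map_sum]
  rw [Finset.sum_comm]
  refine Finset.sum_congr rfl fun y _ => ?_
  rw [mul_assoc, gaussExp_C_mul, gaussExp_wickPoly_mul, Finset.mul_sum]
  refine Finset.sum_congr rfl fun a _ => ?_
  rw [mul_assoc, gaussExp_C_mul]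
  ring

/-- The square `∑ₐ Xₐ²` of a vector of elements of the `n`-th chaos. -/
def chaosSq {α : Type} [Fintype α] (B : κ → ι → ℝ) (n : ℕ) (K : α → κ → ℝ) : MvPolynomial ι ℝ :=
  ∑ i, chaos B n (K i) ^ 2

theorem eval_chaosSq_nonneg {α : Type} [Fintype α] (B : κ → ι → ℝ) (n : ℕ) (K : α → κ → ℝ)
    (ξ : ι → ℝ) : 0 ≤ MvPolynomial.eval ξ (chaosSq B n K) := by
  simp only [chaosSq, map_sum, map_pow]
  positivity

theorem mul_pow_le_half_add {a b c : ℝ} (ha : 0 ≤ a) (hb : 0 ≤ b) (hc : 0 ≤ c) (k : ℕ) :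
    c * (b * a ^ k) ≤ a ^ (k + 1) / 2 + (2 * c) ^ (k + 1) * b ^ (k + 1) / 2 := by
  rcases le_total (c * b) (a / 2) with h | h
  · have : c * (b * a ^ k) ≤ a ^ (k + 1) / 2 := by
      calc c * (b * a ^ k) = (c * b) * a ^ k := by ring
        _ ≤ (a / 2) * a ^ k := by gcongr
        _ = _ := by ring
    have : 0 ≤ (2 * c) ^ (k + 1) * b ^ (k + 1) / 2 := by positivity
    linarith
  · have : c * (b * a ^ k) ≤ (2 * c) ^ (k + 1) * b ^ (k + 1) / 2 := by
      calc c * (b * a ^ k) = (c * b) * a ^ k := by ring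
        _ ≤ (c * b) * (2 * (c * b)) ^ k := by gcongr; linarith
        _ = _ := by rw [← mul_pow, pow_succ]; ring
    have : 0 ≤ a ^ (k + 1) / 2 := by positivity
    linarith

/-- The moments of a vector in the `(n + 1)`-st chaos are controlled by those of its gradient:
integrate one factor by parts, and absorb by Young's inequality. -/
theorem gaussExp_chaosSq_pow_succ_le {α : Type} [Fintype α] (B : κ → ι → ℝ) (n k : ℕ)
    (K : α → κ → ℝ) :
    gaussExp (chaosSq B (n + 1) K ^ (k + 1)) ≤
      (2 * ((n + 1) * (2 * k + 1))) ^ (k + 1) *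
        gaussExp (chaosSq B n (fun (p : α × ι) y => K p.1 y * B y p.2) ^ (k + 1)) := by
  set Q := chaosSq B (n + 1) K with hQ
  set R := chaosSq B n (fun (p : α × ι) y => K p.1 y * B y p.2) with hR
  set X : α → MvPolynomial ι ℝ := fun i => chaos B (n + 1) (K i) with hX
  set Y : α → ι → MvPolynomial ι ℝ := fun i a => chaos B n fun y => K i y * B y a with hY
  have hQX : Q = ∑ i, X i ^ 2 := rfl
  have hRY : R = ∑ i, ∑ a, Y i a ^ 2 := by
    rw [hR, chaosSq, Fintype.sum_prod_type]
  have dX : ∀ i a, MvPolynomial.pderiv a (X i) = MvPolynomial.C (n + 1 : ℝ) * Y i a :=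
    fun i a => pderiv_chaos B n (K i) a
  have dQ : ∀ a, MvPolynomial.pderiv a Q =
      MvPolynomial.C (2 * (n + 1) : ℝ) * ∑ i, X i * Y i a := by
    intro a
    rw [hQX, map_sum, Finset.mul_sum]
    refine Finset.sum_congr rfl fun i _ => ?_
    rw [Derivation.leibniz_pow, dX]
    simp only [nsmul_eq_mul, smul_eq_mul, map_mul, map_ofNat]
    push_cast
    ring
  have step : gaussExp (Q ^ (k + 1)) = gaussExp (MvPolynomial.C (n + 1 : ℝ) * (R * Q ^ k) +
      MvPolynomial.C (2 * (n + 1) * k : ℝ) *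
        (Q ^ (k - 1) * ∑ a, (∑ i, X i * Y i a) ^ 2)) := by
    have e1 : Q ^ (k + 1) = ∑ i, X i * (X i * Q ^ k) := by
      rw [pow_succ', hQX, Finset.sum_mul]
      exact Finset.sum_congr rfl fun i _ => by ring
    have e2 : ∀ i, gaussExp (X i * (X i * Q ^ k)) =
        ∑ a, gaussExp (Y i a * MvPolynomial.pderiv a (X i * Q ^ k)) :=
      fun i => gaussExp_chaos_mul B n (K i) _
    have e3 : ∀ i a, Y i a * MvPolynomial.pderiv a (X i * Q ^ k) =
        MvPolynomial.C (n + 1 : ℝ) * Q ^ k * Y i a ^ 2 +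
          MvPolynomial.C (2 * (n + 1) * k : ℝ) * Q ^ (k - 1) *
            ((X i * Y i a) * ∑ j, X j * Y j a) := by
      intro i a
      rw [Derivation.leibniz, Derivation.leibniz_pow, dX, dQ]
      simp only [nsmul_eq_mul, smul_eq_mul, map_mul, map_natCast]
      ring
    rw [e1, map_sum, Finset.sum_congr rfl fun i _ => e2 i]
    simp only [← map_sum]
    congr 1
    simp only [e3, Finset.sum_add_distrib, ← Finset.mul_sum, ← hRY]
    rw [Finset.sum_comm (s := Finset.univ) (t := Finset.univ)
      (f := fun i a => X i * Y i a * ∑ j, X j * Y j a)]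
    simp only [← Finset.sum_mul, sq]
    ring
  have bound : ∀ ξ, MvPolynomial.eval ξ (MvPolynomial.C (n + 1 : ℝ) * (R * Q ^ k) +
      MvPolynomial.C (2 * (n + 1) * k : ℝ) * (Q ^ (k - 1) * ∑ a, (∑ i, X i * Y i a) ^ 2)) ≤
      MvPolynomial.eval ξ (MvPolynomial.C (1 / 2 : ℝ) * Q ^ (k + 1) +
        MvPolynomial.C ((2 * ((n + 1) * (2 * k + 1))) ^ (k + 1) / 2 : ℝ) * R ^ (k + 1)) := by
    intro ξ
    simp only [map_add, map_mul, MvPolynomial.eval_C, map_pow, map_sum]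
    set q := MvPolynomial.eval ξ Q with hq
    set r := MvPolynomial.eval ξ R with hr
    have q0 : 0 ≤ q := eval_chaosSq_nonneg _ _ _ _
    have r0 : 0 ≤ r := eval_chaosSq_nonneg _ _ _ _
    have cs : ∑ a, (∑ i, MvPolynomial.eval ξ (X i) * MvPolynomial.eval ξ (Y i a)) ^ 2 ≤ q * r := by
      rw [hq, hr, hQX, hRY, Finset.sum_comm]
      simp only [map_sum, map_pow]
      rw [Finset.mul_sum]
      exact Finset.sum_le_sum fun a _ => Finset.sum_mul_sq_le_sq_mul_sq _ _ _
    have h2 : (2 * (n + 1) * k : ℝ) * (q ^ (k - 1) *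
        ∑ a, (∑ i, MvPolynomial.eval ξ (X i) * MvPolynomial.eval ξ (Y i a)) ^ 2) ≤
        (2 * (n + 1) * k : ℝ) * (r * q ^ k) := by
      rcases Nat.eq_zero_or_pos k with rfl | hk
      · simp
      · refine mul_le_mul_of_nonneg_left ?_ (by positivity)
        calc _ ≤ q ^ (k - 1) * (q * r) := mul_le_mul_of_nonneg_left cs (by positivity)
          _ = r * q ^ (k - 1 + 1) := by ring
          _ = r * q ^ k := by rw [Nat.sub_add_cancel hk]
    have h3 := mul_pow_le_half_add (a := q) (b := r) (c := (n + 1) * (2 * k + 1)) q0 r0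
      (by positivity) k
    calc _ ≤ (n + 1 : ℝ) * (r * q ^ k) + (2 * (n + 1) * k : ℝ) * (r * q ^ k) :=
          add_le_add le_rfl h2
      _ = ((n + 1) * (2 * k + 1)) * (r * q ^ k) := by ring
      _ ≤ _ := h3
      _ = _ := by ring
  have := gaussExp_mono bound
  rw [← step, map_add, gaussExp_C_mul, gaussExp_C_mul] at this
  linarith

/-- The constant in the moment bound for the `n`-th chaos. -/
def chaosConst (k : ℕ) : ℕ → ℝ
  | 0 => 1
  | n + 1 => (2 * ((n + 1) * (2 * k + 1))) ^ (k + 1) * chaosConst k n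

theorem gaussExp_chaosSq_pow_le (B : κ → ι → ℝ) (n k : ℕ) :
    ∀ {α : Type} [Fintype α] (K : α → κ → ℝ), gaussExp (chaosSq B n K ^ (k + 1)) ≤
      chaosConst k n * (∑ i, ∑ y, ∑ z, K i y * K i z * (∑ a, B y a * B z a) ^ n) ^ (k + 1) := by
  induction n with
  | zero =>
    intro α _ K
    have : chaosSq B 0 K = MvPolynomial.C (∑ i, ∑ y, ∑ z, K i y * K i z) := by
      simp [chaosSq, chaos, wickPoly, wick, sq, Finset.sum_mul_sum]
    rw [this, ← map_pow, gaussExp_apply]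
    simp [chaosConst]
  | succ n ih =>
    intro α _ K
    refine (gaussExp_chaosSq_pow_succ_le B n k K).trans ?_
    rw [chaosConst, mul_assoc]
    refine mul_le_mul_of_nonneg_left ((ih _).trans (le_of_eq ?_)) (by positivity)
    congr 2
    rw [Fintype.sum_prod_type]
    refine Finset.sum_congr rfl fun i _ => ?_
    rw [Finset.sum_comm]
    refine Finset.sum_congr rfl fun y _ => ?_
    rw [Finset.sum_comm]
    refine Finset.sum_congr rfl fun z _ => ?_
    rw [pow_succ', Finset.sum_mul, Finset.mul_sum]
    exact Finset.sum_congr rfl fun a _ => by ring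

/-- Moment bound for the `n`-th chaos of the Gaussian field `φ = B ξ` of covariance `B Bᵀ`. -/
theorem integral_chaos_pow_le (B : κ → ι → ℝ) (n k : ℕ) (K : κ → ℝ) :
    ∫ ξ, (∑ y, K y * wick (∑ a, B y a ^ 2) (∑ a, B y a * ξ a) n) ^ (2 * (k + 1))
        ∂(Measure.pi fun _ => gaussianReal 0 1) ≤
      chaosConst k n * (∑ y, ∑ z, K y * K z * (∑ a, B y a * B z a) ^ n) ^ (k + 1) := by
  have := gaussExp_chaosSq_pow_le B n k (fun (_ : Unit) => K)
  simp only [Finset.univ_unique, Finset.sum_singleton] at this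
  refine le_trans (le_of_eq ?_) this
  rw [gaussExp_apply]
  simp [chaosSq, chaos, eval_wickPoly, ← pow_mul]

theorem integrable_chaos_pow (B : κ → ι → ℝ) (n k : ℕ) (K : κ → ℝ) :
    Integrable (fun ξ => (∑ y, K y * wick (∑ a, B y a ^ 2) (∑ a, B y a * ξ a) n) ^ k)
      (Measure.pi fun _ => gaussianReal 0 1) := by
  have := integrable_eval_gaussian (chaos B n K ^ k)
  simpa [chaos, eval_wickPoly] using this

/-- The binomial formula for Wick powers: they form an Appell sequence. -/
theorem wick_add (c x h : ℝ) (n : ℕ) :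
    wick c (x + h) n = ∑ j ∈ Finset.range (n + 1), n.choose j * wick c x (n - j) * h ^ j := by
  set w : ℕ → Polynomial ℝ := fun n => wick (Polynomial.C c) Polynomial.X n with hw
  have heval : ∀ n z, (w n).eval z = wick c z n := by
    intro n z
    have := map_wick (Polynomial.evalRingHom z) (Polynomial.C c) Polynomial.X n
    simpa [hw] using this
  have hdeg : (w n).natDegree ≤ n := by
    induction n using Nat.twoStepInduction with
    | zero => simp [hw, wick]
    | one => simp [hw, wick]
    | more n h1 h2 =>
      have e : w (n + 2) = Polynomial.X * w (n + 1) - Polynomial.C ((n + 1) * c) * w n := by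
        simp [hw, wick]
      rw [e]
      refine (Polynomial.natDegree_sub_le _ _).trans (max_le ?_ ?_)
      · refine Polynomial.natDegree_mul_le.trans ?_
        rw [Polynomial.natDegree_X]
        lia
      · exact (Polynomial.natDegree_C_mul_le _ _).trans (h1.trans (by lia))
  have hder : ∀ j, Polynomial.derivative^[j] (w n) = (n.descFactorial j : Polynomial ℝ) * w (n - j) := by
    intro j
    induction j with
    | zero => simp
    | succ j ih =>
      have := derivation_wick (Polynomial.derivative' (R := ℝ)) (Polynomial.C c) Polynomial.X
        (Polynomial.derivative_C) (n - j)
      rw [Function.iterate_succ_apply', ih, Polynomial.derivative_mul,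
        Polynomial.derivative_natCast, zero_mul, zero_add]
      rw [show Polynomial.derivative (w (n - j)) = ((n - j : ℕ) : Polynomial ℝ) * w (n - j - 1) by
        simpa using this, Nat.descFactorial_succ, Nat.sub_sub]
      push_cast
      ring
  have hhasse : ∀ j, (Polynomial.hasseDeriv j (w n)).eval x = n.choose j * wick c x (n - j) := by
    intro j
    have h1 := congrFun (Polynomial.factorial_smul_hasseDeriv (R := ℝ) j) (w n)
    rw [hder j] at h1
    have h2 := congrArg (Polynomial.eval x) h1
    simp only [nsmul_eq_mul, Polynomial.eval_mul, Polynomial.eval_natCast,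
      heval, Nat.descFactorial_eq_factorial_mul_choose] at h2
    push_cast at h2
    have h3 : (j.factorial : ℝ) ≠ 0 := by positivity
    rw [mul_assoc] at h2
    simpa [h3] using h2
  calc wick c (x + h) n = (Polynomial.taylor x (w n)).eval h := by
        rw [Polynomial.taylor_eval, heval, add_comm]
    _ = _ := by
        rw [Polynomial.eval_eq_sum_range' (n := n + 1)
          (by rw [Polynomial.natDegree_taylor]; lia)]
        refine Finset.sum_congr rfl fun j _ => ?_
        rw [Polynomial.taylor_coeff, hhasse]

theorem hermite_eq_wick (n : ℕ) (x : ℝ) :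
    Polynomial.aeval x (Polynomial.hermite n) = wick 1 x n := by
  have h : Polynomial.hermite n = wick 1 Polynomial.X n := by
    induction n with
    | zero => simp [wick]
    | succ n ih =>
      have := derivation_wick (Polynomial.derivative' (R := ℤ)) 1 Polynomial.X
        (Derivation.map_one_eq_zero _) n
      rw [Polynomial.hermite_succ, ih, wick_succ,
        show Polynomial.derivative (wick 1 (Polynomial.X : Polynomial ℤ) n) =
          (n : Polynomial ℤ) * wick 1 Polynomial.X (n - 1) by simpa using this, mul_one]
  rw [h]
  have := map_wick (Polynomial.aeval (R := ℤ) x : Polynomial ℤ →ₐ[ℤ] ℝ).toRingHom 1 Polynomial.X n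
  simpa using this

theorem wick_eq_sqrt_pow_mul_hermite {c : ℝ} (hc : 0 < c) (x : ℝ) (n : ℕ) :
    √c ^ n * Polynomial.aeval (x / √c) (Polynomial.hermite n) = wick c x n := by
  have h0 : √c ≠ 0 := (Real.sqrt_pos.2 hc).ne'
  rw [hermite_eq_wick]
  induction n using Nat.twoStepInduction with
  | zero => simp [wick]
  | one => simp [wick]; field_simp
  | more n h1 h2 =>
    have e : x / √c * √c = x := by field_simp
    have e2 : √c ^ 2 = c := Real.sq_sqrt hc.le
    simp only [wick, ← h1, ← h2]
    linear_combination √c ^ (n + 1) * wick 1 (x / √c) (n + 1) * e -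
      (n + 1) * √c ^ n * wick 1 (x / √c) n * e2

/-! ### Lattice operators and their Green functions -/

section lattice

variable (L : ℕ) [NeZero L]

/-- The operator `b - a Δ^ε`; for `a ≥ 0`, `b > 0` it is positive definite and satisfies the
maximum principle. Both `-Δ^ε + m²` and `t (-Δ^ε + m²) + 1` are of this form. -/
def ellipticOp (a b : ℝ) : Matrix (Lattice L) (Lattice L) ℝ :=
  b • (1 : Matrix (Lattice L) (Lattice L) ℝ) - a • LinearMap.toMatrix' (laplacian L)

/-- The forward difference of a lattice field, not divided by the mesh size. -/
def fwd {L : ℕ} (i : Fin 2) (f : Field L) (x : Lattice L) : ℝ := f (x + Pi.single i 1) - f x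

/-- The Dirichlet form `ε² ⟨h, (-Δ^ε + m²) h⟩`, the squared Cameron-Martin norm of the Gaussian
free field. The gradient term has no power of `ε`, since `d = 2`. -/
def dirichlet (m : ℝ) (h : Field L) : ℝ :=
  (1 / (L : ℝ)) ^ 2 * (m ^ 2 * ∑ x, h x ^ 2) + ∑ x, ∑ i, fwd i h x ^ 2

variable {L}

theorem natCast_L_pos : 0 < (L : ℝ) := Nat.cast_pos.2 (NeZero.pos L)

theorem massiveLaplacian_eq (m : ℝ) : massiveLaplacian L m = ellipticOp L 1 (m ^ 2) := by
  simp [massiveLaplacian, ellipticOp]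

theorem q_eq (m : ℝ) (t : ℝ≥0) : q L m t = (ellipticOp L t (t * m ^ 2 + 1))⁻¹ := by
  rw [q, massiveLaplacian_eq]
  congr 1
  simp only [ellipticOp]
  module

theorem ellipticOp_mulVec (a b : ℝ) (f : Field L) (x : Lattice L) :
    (ellipticOp L a b).mulVec f x = b * f x - a * laplacian L f x := by
  rw [ellipticOp, Matrix.sub_mulVec, Matrix.smul_mulVec, Matrix.smul_mulVec, Matrix.one_mulVec,
    LinearMap.toMatrix'_mulVec]
  simp

/-- Summation by parts. -/
theorem sum_mul_laplacian (f g : Field L) :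
    ∑ x, f x * laplacian L g x = - ((L : ℝ) ^ 2 * ∑ x, ∑ i, fwd i f x * fwd i g x) := by
  have key : ∀ i : Fin 2, ∑ x, f x * ((g (x + Pi.single i 1) - g x) +
      (g (x - Pi.single i 1) - g x)) = - ∑ x, fwd i f x * fwd i g x := by
    intro i
    have h1 := Equiv.sum_comp (Equiv.addRight (Pi.single i 1 : Lattice L))
      (fun x => f x * (g (x - Pi.single i 1) - g x))
    simp only [Equiv.coe_addRight, add_sub_cancel_right] at h1
    simp only [mul_add, Finset.sum_add_distrib]
    rw [← h1, ← Finset.sum_add_distrib, ← Finset.sum_neg_distrib]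
    refine Finset.sum_congr rfl fun x _ => ?_
    simp only [fwd]
    ring
  calc ∑ x, f x * laplacian L g x = (L : ℝ) ^ 2 * ∑ i : Fin 2, ∑ x, f x *
        ((g (x + Pi.single i 1) - g x) + (g (x - Pi.single i 1) - g x)) := by
        rw [Finset.sum_comm, Finset.mul_sum]
        refine Finset.sum_congr rfl fun x _ => ?_
        simp only [laplacian, LinearMap.coe_mk, AddHom.coe_mk]
        rw [← Finset.mul_sum]
        ring
    _ = _ := by
        rw [Finset.sum_congr rfl fun i _ => key i, Finset.sum_neg_distrib, Finset.sum_comm]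
        ring

theorem dotProduct_ellipticOp (a b : ℝ) (f g : Field L) :
    f ⬝ᵥ (ellipticOp L a b).mulVec g =
      b * (∑ x, f x * g x) + a * ((L : ℝ) ^ 2 * ∑ x, ∑ i, fwd i f x * fwd i g x) := by
  have := sum_mul_laplacian f g
  simp only [dotProduct, ellipticOp_mulVec, mul_sub, Finset.sum_sub_distrib]
  have e1 : ∑ x, f x * (b * g x) = b * ∑ x, f x * g x := by
    rw [Finset.mul_sum]; exact Finset.sum_congr rfl fun x _ => by ring
  have e2 : ∑ x, f x * (a * laplacian L g x) = a * ∑ x, f x * laplacian L g x := by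
    rw [Finset.mul_sum]; exact Finset.sum_congr rfl fun x _ => by ring
  rw [e1, e2, this]
  ring

theorem dirichlet_eq (m : ℝ) (h : Field L) :
    dirichlet L m h = (1 / (L : ℝ)) ^ 2 * (h ⬝ᵥ (massiveLaplacian L m).mulVec h) := by
  have hL := (natCast_L_pos (L := L)).ne'
  rw [massiveLaplacian_eq, dotProduct_ellipticOp, dirichlet]
  simp only [← sq]
  field_simp

theorem dirichlet_nonneg (m : ℝ) (h : Field L) : 0 ≤ dirichlet L m h := by
  unfold dirichlet; positivity

theorem isSymm_ellipticOp (a b : ℝ) : (ellipticOp L a b).IsSymm := by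
  ext x y
  have h := fun x y : Lattice L => dotProduct_ellipticOp a b (Pi.single x 1 : Field L) (Pi.single y 1)
  have e : ∀ x y : Lattice L, (Pi.single x 1 : Field L) ⬝ᵥ (ellipticOp L a b).mulVec (Pi.single y 1) =
      ellipticOp L a b x y := by
    intro x y; simp
  rw [Matrix.transpose_apply, ← e, ← e, h, h]
  simp only [mul_comm]

theorem posDef_ellipticOp {a b : ℝ} (ha : 0 ≤ a) (hb : 0 < b) : (ellipticOp L a b).PosDef := by
  rw [Matrix.posDef_iff_dotProduct_mulVec]
  refine ⟨by rw [Matrix.IsHermitian, Matrix.conjTranspose_eq_transpose_of_trivial];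
             exact isSymm_ellipticOp a b, fun {f} hf => ?_⟩
  rw [star_trivial, dotProduct_ellipticOp]
  simp only [← sq]
  obtain ⟨x, hx⟩ : ∃ x, f x ≠ 0 := Function.ne_iff.1 hf
  have h1 : 0 < ∑ x, f x ^ 2 :=
    Finset.sum_pos' (fun x _ => sq_nonneg _) ⟨x, Finset.mem_univ _, by positivity⟩
  have : 0 ≤ a * ((L : ℝ) ^ 2 * ∑ x, ∑ i, fwd i f x ^ 2) := by positivity
  nlinarith

theorem ellipticOp_mul_inv {a b : ℝ} (ha : 0 ≤ a) (hb : 0 < b) :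
    ellipticOp L a b * (ellipticOp L a b)⁻¹ = 1 :=
  Matrix.mul_nonsing_inv _ ((Matrix.isUnit_iff_isUnit_det _).1 (posDef_ellipticOp ha hb).isUnit)

theorem ellipticOp_inv_mul {a b : ℝ} (ha : 0 ≤ a) (hb : 0 < b) :
    (ellipticOp L a b)⁻¹ * ellipticOp L a b = 1 :=
  Matrix.nonsing_inv_mul _ ((Matrix.isUnit_iff_isUnit_det _).1 (posDef_ellipticOp ha hb).isUnit)

theorem ellipticOp_inv_symm (a b : ℝ) (x y : Lattice L) :
    (ellipticOp L a b)⁻¹ x y = (ellipticOp L a b)⁻¹ y x := by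
  have : ((ellipticOp L a b)⁻¹).IsSymm := by
    rw [Matrix.IsSymm, Matrix.transpose_nonsing_inv, isSymm_ellipticOp]
  exact this.apply y x

/-- The maximum principle: at a minimum the Laplacian is nonnegative. -/
theorem nonneg_of_ellipticOp_mulVec_nonneg {a b : ℝ} (ha : 0 ≤ a) (hb : 0 < b) {f : Field L}
    (hf : ∀ x, 0 ≤ (ellipticOp L a b).mulVec f x) (x : Lattice L) : 0 ≤ f x := by
  obtain ⟨z, -, hz⟩ := Finset.exists_min_image Finset.univ f ⟨x, Finset.mem_univ x⟩
  refine le_trans ?_ (hz x (Finset.mem_univ x))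
  have h1 := hf z
  rw [ellipticOp_mulVec] at h1
  have h2 : 0 ≤ laplacian L f z := by
    simp only [laplacian, LinearMap.coe_mk, AddHom.coe_mk]
    refine mul_nonneg (by positivity) (Finset.sum_nonneg fun i _ => ?_)
    linarith [hz (z + Pi.single i 1) (Finset.mem_univ _), hz (z - Pi.single i 1) (Finset.mem_univ _)]
  have h3 : 0 ≤ b * f z := by nlinarith
  exact nonneg_of_mul_nonneg_right h3 hb

theorem ellipticOp_inv_nonneg {a b : ℝ} (ha : 0 ≤ a) (hb : 0 < b) (x y : Lattice L) :
    0 ≤ (ellipticOp L a b)⁻¹ x y := by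
  have := nonneg_of_ellipticOp_mulVec_nonneg ha hb (f := fun z => (ellipticOp L a b)⁻¹ z y)
    (fun z => by
      have h : (ellipticOp L a b).mulVec (fun z => (ellipticOp L a b)⁻¹ z y) z =
        (ellipticOp L a b * (ellipticOp L a b)⁻¹) z y := rfl
      rw [h, ellipticOp_mul_inv ha hb, Matrix.one_apply]
      split_ifs <;> norm_num)
  exact this x

theorem sum_ellipticOp_inv {a b : ℝ} (ha : 0 ≤ a) (hb : 0 < b) (x : Lattice L) :
    ∑ y, (ellipticOp L a b)⁻¹ x y = b⁻¹ := by
  have h1 : (ellipticOp L a b).mulVec (fun _ => b⁻¹) = fun _ => 1 := by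
    funext y
    rw [ellipticOp_mulVec]
    simp [laplacian, hb.ne']
  have h2 := congrArg (fun v => (ellipticOp L a b)⁻¹.mulVec v x) h1
  simp only [Matrix.mulVec_mulVec, ellipticOp_inv_mul ha hb, Matrix.one_mulVec] at h2
  rw [h2]
  simp [Matrix.mulVec, dotProduct]

theorem ellipticOp_add_add (a b : ℝ) (x y z : Lattice L) :
    ellipticOp L a b (x + z) (y + z) = ellipticOp L a b x y := by
  have e : ∀ x y : Lattice L, ellipticOp L a b x y =
      (ellipticOp L a b).mulVec (Pi.single y 1) x := by intro x y; simp
  rw [e, e, ellipticOp_mulVec, ellipticOp_mulVec]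
  have h1 : ∀ w : Lattice L, (Pi.single (y + z) 1 : Field L) (w + z) =
      (Pi.single y 1 : Field L) w := by
    intro w; simp [Pi.single_apply]
  have h2 : laplacian L (Pi.single (y + z) 1) (x + z) = laplacian L (Pi.single y 1) x := by
    simp only [laplacian, LinearMap.coe_mk, AddHom.coe_mk]
    congr 1
    refine Finset.sum_congr rfl fun i _ => ?_
    rw [add_right_comm x z, add_sub_right_comm x z, h1, h1, h1]
  rw [h1, h2]

theorem ellipticOp_inv_add_add (a b : ℝ) (x y z : Lattice L) :
    (ellipticOp L a b)⁻¹ (x + z) (y + z) = (ellipticOp L a b)⁻¹ x y := by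
  have h : ((ellipticOp L a b).submatrix (Equiv.addRight z) (Equiv.addRight z)) =
      ellipticOp L a b := by
    ext x y
    simp [ellipticOp_add_add]
  have := congrArg (fun M : Matrix (Lattice L) (Lattice L) ℝ => M⁻¹ x y) h
  simp only [Matrix.inv_submatrix_equiv, Matrix.submatrix_apply] at this
  exact this

end lattice

section green

variable {L : ℕ} [NeZero L] {m : ℝ}

theorem gffCovariance_eq (m : ℝ) (x y : Lattice L) :
    gffCovariance L m x y = (L : ℝ) ^ 2 * (ellipticOp L 1 (m ^ 2))⁻¹ x y := by
  rw [gffCovariance, massiveLaplacian_eq, Matrix.smul_apply, smul_eq_mul]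

theorem gffCovariance_nonneg (hm : 0 < m ^ 2) (x y : Lattice L) : 0 ≤ gffCovariance L m x y := by
  rw [gffCovariance_eq]
  exact mul_nonneg (by positivity) (ellipticOp_inv_nonneg zero_le_one hm x y)

theorem q_pos_aux (hm : 0 < m ^ 2) (t : ℝ≥0) : 0 < (t : ℝ) * m ^ 2 + 1 := by positivity

theorem q_nonneg (hm : 0 < m ^ 2) (t : ℝ≥0) (x y : Lattice L) : 0 ≤ q L m t x y := by
  rw [q_eq]; exact ellipticOp_inv_nonneg t.coe_nonneg (q_pos_aux hm t) x y

theorem sum_q (hm : 0 < m ^ 2) (t : ℝ≥0) (x : Lattice L) :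
    ∑ y, q L m t x y = ((t : ℝ) * m ^ 2 + 1)⁻¹ := by
  rw [q_eq]; exact sum_ellipticOp_inv t.coe_nonneg (q_pos_aux hm t) x

/-- The resolvent identity gives `t q_t ≤ (-Δ^ε + m²)⁻¹` for the kernels. -/
theorem mul_q_le_gffCovariance (hm : 0 < m ^ 2) (t : ℝ≥0) (x y : Lattice L) :
    t * ((L : ℝ) ^ 2 * q L m t x y) ≤ gffCovariance L m x y := by
  set A := ellipticOp L 1 (m ^ 2) with hA
  have e1 : ellipticOp L t (t * m ^ 2 + 1) = (t : ℝ) • A + 1 := by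
    simp only [hA, ellipticOp]; module
  have h1 : A⁻¹ = (t : ℝ) • q L m t + A⁻¹ * q L m t := by
    calc A⁻¹ = A⁻¹ * (((t : ℝ) • A + 1) * q L m t) := by
          rw [← e1, q_eq, ellipticOp_mul_inv t.coe_nonneg (q_pos_aux hm t), Matrix.mul_one]
      _ = (t : ℝ) • (A⁻¹ * A * q L m t) + A⁻¹ * q L m t := by
          rw [Matrix.add_mul, Matrix.mul_add, Matrix.one_mul, Matrix.smul_mul, Matrix.mul_smul,
            Matrix.mul_assoc]
      _ = _ := by rw [ellipticOp_inv_mul zero_le_one hm, Matrix.one_mul]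
  have h2 : 0 ≤ (A⁻¹ * q L m t) x y := by
    rw [Matrix.mul_apply]
    exact Finset.sum_nonneg fun z _ =>
      mul_nonneg (ellipticOp_inv_nonneg zero_le_one hm x z) (q_nonneg hm t z y)
  rw [gffCovariance_eq, ← hA, h1, Matrix.add_apply, Matrix.smul_apply, smul_eq_mul]
  have : 0 ≤ (L : ℝ) ^ 2 * (A⁻¹ * q L m t) x y := by positivity
  linarith

theorem q_symm (m : ℝ) (t : ℝ≥0) (x y : Lattice L) : q L m t x y = q L m t y x := by
  rw [q_eq, ellipticOp_inv_symm]

theorem gffCovariance_symm (m : ℝ) (x y : Lattice L) :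
    gffCovariance L m x y = gffCovariance L m y x := by
  rw [gffCovariance_eq, gffCovariance_eq, ellipticOp_inv_symm]

theorem q_add_add (m : ℝ) (t : ℝ≥0) (x y z : Lattice L) :
    q L m t (x + z) (y + z) = q L m t x y := by
  rw [q_eq, ellipticOp_inv_add_add]

theorem gffCovariance_add_add (m : ℝ) (x y z : Lattice L) :
    gffCovariance L m (x + z) (y + z) = gffCovariance L m x y := by
  rw [gffCovariance_eq, gffCovariance_eq, ellipticOp_inv_add_add]

/-! ### The discrete Sobolev inequality -/

theorem abs_le_average_add_variation (u : ZMod L → ℝ) (x : ZMod L) :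
    |u x| ≤ 1 / (L : ℝ) * ∑ s, |u s| + ∑ s, |u (s + 1) - u s| := by
  have hL := natCast_L_pos (L := L)
  have path : ∀ k : ℕ, k ≤ L → |u (x + k) - u x| ≤ ∑ s, |u (s + 1) - u s| := by
    intro k hk
    have h1 : u (x + k) - u x = ∑ i ∈ Finset.range k, (u (x + i + 1) - u (x + i)) := by
      have := Finset.sum_range_sub (fun i : ℕ => u (x + i)) k
      simp only [Nat.cast_add, Nat.cast_one, Nat.cast_zero, add_zero, ← add_assoc] at this
      exact this.symm
    rw [h1]
    refine (Finset.abs_sum_le_sum_abs _ _).trans ?_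
    have hinj : Set.InjOn (fun i : ℕ => x + (i : ZMod L)) (Finset.range k) := by
      intro i hi j hj hij
      have h2 : (i : ZMod L) = j := add_left_cancel hij
      rw [ZMod.natCast_eq_natCast_iff] at h2
      simp only [Finset.coe_range, Set.mem_Iio] at hi hj
      exact Nat.ModEq.eq_of_lt_of_lt h2 (hi.trans_le hk) (hj.trans_le hk)
    rw [← Finset.sum_image (f := fun s => |u (s + 1) - u s|) hinj]
    exact Finset.sum_le_sum_of_subset_of_nonneg (Finset.subset_univ _) fun _ _ _ => abs_nonneg _
  have h2 : ∀ y, |u x| ≤ |u y| + ∑ s, |u (s + 1) - u s| := by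
    intro y
    have := path (y - x).val (ZMod.val_lt _).le
    rw [ZMod.natCast_zmod_val, add_sub_cancel] at this
    have h3 := abs_sub_abs_le_abs_sub (u x) (u y)
    rw [abs_sub_comm] at h3
    linarith
  have h3 := Finset.sum_le_sum fun y (_ : y ∈ Finset.univ) => h2 y
  rw [Finset.sum_add_distrib, Finset.sum_const, Finset.sum_const, Finset.card_univ, ZMod.card,
    nsmul_eq_mul, nsmul_eq_mul] at h3
  rw [one_div, ← mul_le_mul_iff_right₀ hL, mul_add, ← mul_assoc, mul_inv_cancel₀ hL.ne', one_mul]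
  exact h3

/-- The discrete embedding `W^{1,1} ⊂ L²` in dimension two. -/
theorem sum_sq_le_sq_sum_abs (f : Field L) :
    (1 / (L : ℝ)) ^ 2 * ∑ x, f x ^ 2 ≤
      ((1 / (L : ℝ)) ^ 2 * ∑ x, |f x| + 1 / (L : ℝ) * ∑ x, ∑ i, |fwd i f x|) ^ 2 := by
  have hL := natCast_L_pos (L := L)
  set e := (finTwoArrowEquiv (ZMod L)).symm with he
  have hsum : ∀ g : Lattice L → ℝ, ∑ x, g x = ∑ a, ∑ b, g (e (a, b)) := by
    intro g
    rw [← e.sum_comp, Fintype.sum_prod_type]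
  have e0 : ∀ a b : ZMod L, e (a, b) + Pi.single 0 1 = e (a + 1, b) := by
    intro a b; ext i; fin_cases i <;> simp [he, finTwoArrowEquiv]
  have e1 : ∀ a b : ZMod L, e (a, b) + Pi.single 1 1 = e (a, b + 1) := by
    intro a b; ext i; fin_cases i <;> simp [he, finTwoArrowEquiv]
  set P : ZMod L → ℝ := fun b => 1 / (L : ℝ) * ∑ s, |f (e (s, b))| +
    ∑ s, |f (e (s + 1, b)) - f (e (s, b))| with hP
  set R : ZMod L → ℝ := fun a => 1 / (L : ℝ) * ∑ s, |f (e (a, s))| +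
    ∑ s, |f (e (a, s + 1)) - f (e (a, s))| with hR
  have P0 : ∀ b, 0 ≤ P b := fun b => by positivity
  have R0 : ∀ a, 0 ≤ R a := fun a => by positivity
  have hPR : ∀ a b, f (e (a, b)) ^ 2 ≤ R a * P b := by
    intro a b
    have h1 := abs_le_average_add_variation (fun s => f (e (s, b))) a
    have h2 := abs_le_average_add_variation (fun s => f (e (a, s))) b
    rw [← sq_abs, sq]
    exact mul_le_mul h2 h1 (abs_nonneg _) (R0 a)
  have hle : ∑ x, f x ^ 2 ≤ (∑ a, R a) * ∑ b, P b := by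
    rw [hsum, Finset.sum_mul_sum]
    exact Finset.sum_le_sum fun a _ => Finset.sum_le_sum fun b _ => hPR a b
  set F := (1 / (L : ℝ)) ^ 2 * ∑ x, |f x| with hF
  have hPs : 1 / (L : ℝ) * ∑ b, P b ≤ F + 1 / (L : ℝ) * ∑ x, ∑ i, |fwd i f x| := by
    have h1 : ∑ b, ∑ s, |f (e (s, b))| = ∑ x, |f x| := by rw [hsum, Finset.sum_comm]
    have h2 : ∑ b, ∑ s, |f (e (s + 1, b)) - f (e (s, b))| ≤ ∑ x, ∑ i, |fwd i f x| := by
      rw [hsum, Finset.sum_comm]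
      refine Finset.sum_le_sum fun a _ => Finset.sum_le_sum fun b _ => ?_
      rw [Fin.sum_univ_two, fwd, fwd, e0, e1]
      exact le_add_of_nonneg_right (abs_nonneg _)
    rw [hP, Finset.sum_add_distrib, ← Finset.mul_sum, h1, mul_add, ← mul_assoc, ← sq, ← hF]
    gcongr
  have hRs : 1 / (L : ℝ) * ∑ b, R b ≤ F + 1 / (L : ℝ) * ∑ x, ∑ i, |fwd i f x| := by
    have h1 : ∑ b, ∑ s, |f (e (b, s))| = ∑ x, |f x| := by rw [hsum]
    have h2 : ∑ b, ∑ s, |f (e (b, s + 1)) - f (e (b, s))| ≤ ∑ x, ∑ i, |fwd i f x| := by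
      rw [hsum]
      refine Finset.sum_le_sum fun a _ => Finset.sum_le_sum fun b _ => ?_
      rw [Fin.sum_univ_two, fwd, fwd, e0, e1]
      exact le_add_of_nonneg_left (abs_nonneg _)
    rw [hR, Finset.sum_add_distrib, ← Finset.mul_sum, h1, mul_add, ← mul_assoc, ← sq, ← hF]
    gcongr
  calc (1 / (L : ℝ)) ^ 2 * ∑ x, f x ^ 2 ≤ (1 / (L : ℝ)) ^ 2 * ((∑ a, R a) * ∑ b, P b) := by gcongr
    _ = (1 / (L : ℝ) * ∑ b, R b) * (1 / (L : ℝ) * ∑ b, P b) := by ring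
    _ ≤ _ := by
      rw [sq (F + _)]
      exact mul_le_mul hRs hPs
        (mul_nonneg (by positivity) (Finset.sum_nonneg fun b _ => P0 b)) (by positivity)

/-- The constant of the discrete Sobolev inequality. -/
def sobolevConst (m : ℝ) : ℕ → ℝ
  | 0 => 1
  | k + 1 => 2 * (1 / m ^ 2 + 8 * (k + 1) ^ 2) * sobolevConst m k

theorem sobolevConst_nonneg (m : ℝ) (k : ℕ) : 0 ≤ sobolevConst m k := by
  induction k with
  | zero => simp [sobolevConst]
  | succ k ih => rw [sobolevConst]; positivity

theorem abs_fwd_pow_le {L : ℕ} (h : Field L) (k : ℕ) (i : Fin 2) (x : Lattice L) :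
    |fwd i (fun y => h y ^ (k + 1)) x| ≤
      (k + 1) * (|fwd i h x| * (|h (x + Pi.single i 1)| ^ k + |h x| ^ k)) := by
  have := abs_pow_sub_pow_le (h (x + Pi.single i 1)) (h x) (k + 1)
  simp only [Nat.add_sub_cancel] at this
  refine this.trans ?_
  have h2 : max |h (x + Pi.single i 1)| |h x| ^ k ≤
      |h (x + Pi.single i 1)| ^ k + |h x| ^ k := by
    rcases max_choice |h (x + Pi.single i 1)| |h x| with e | e <;> rw [e]
    · exact le_add_of_nonneg_right (by positivity)
    · exact le_add_of_nonneg_left (by positivity)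
  calc _ ≤ |h (x + Pi.single i 1) - h x| * ((k + 1 : ℕ) : ℝ) *
        (|h (x + Pi.single i 1)| ^ k + |h x| ^ k) := by gcongr
    _ = _ := by rw [fwd]; push_cast; ring

theorem sum_shift (f : Field L) (i : Fin 2) :
    ∑ x : Lattice L, f (x + Pi.single i 1) = ∑ x, f x :=
  Equiv.sum_comp (Equiv.addRight (Pi.single i 1 : Lattice L)) f

/-- The discrete Sobolev embedding `H¹ ⊂ L^{2k}`, uniformly in the mesh size. The induction
applies the embedding `W^{1,1} ⊂ L²` to powers of the field. -/
theorem sobolev (hm : 0 < m ^ 2) (k : ℕ) (h : Field L) :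
    (1 / (L : ℝ)) ^ 2 * ∑ x, h x ^ (2 * k) ≤ sobolevConst m k * dirichlet L m h ^ k := by
  have hL := natCast_L_pos (L := L)
  induction k with
  | zero =>
    simp [sobolevConst, Fintype.card_pi, ZMod.card]
  | succ k ih =>
    set D := dirichlet L m h with hD
    set M := (1 / (L : ℝ)) ^ 2 * ∑ x, h x ^ (2 * k) with hM
    have D0 : 0 ≤ D := dirichlet_nonneg m h
    have M0 : 0 ≤ M := by
      have : ∀ x, 0 ≤ h x ^ (2 * k) := fun x => by rw [pow_mul]; positivity
      rw [hM]
      exact mul_nonneg (by positivity) (Finset.sum_nonneg fun x _ => this x)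
    have h1 := sum_sq_le_sq_sum_abs (fun x => h x ^ (k + 1))
    have hgrad : ∑ x, ∑ i, fwd i h x ^ 2 ≤ D := by
      rw [hD, dirichlet]
      exact le_add_of_nonneg_left (by positivity)
    have hmass : (1 / (L : ℝ)) ^ 2 * ∑ x, h x ^ 2 ≤ 1 / m ^ 2 * D := by
      have : (1 / (L : ℝ)) ^ 2 * (m ^ 2 * ∑ x, h x ^ 2) ≤ D := by
        rw [hD, dirichlet]
        exact le_add_of_nonneg_right (by positivity)
      rw [one_div (m ^ 2), ← div_eq_inv_mul, le_div_iff₀ hm]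
      linarith
    have hA : ((1 / (L : ℝ)) ^ 2 * ∑ x, |h x ^ (k + 1)|) ^ 2 ≤ 1 / m ^ 2 * D * M := by
      calc _ = (1 / (L : ℝ)) ^ 4 * (∑ x, |h x| * |h x| ^ k) ^ 2 := by
            rw [mul_pow, ← pow_mul]
            congr 2
            exact Finset.sum_congr rfl fun x _ => by rw [abs_pow, pow_succ']
        _ ≤ (1 / (L : ℝ)) ^ 4 * ((∑ x, |h x| ^ 2) * ∑ x, (|h x| ^ k) ^ 2) := by
            gcongr
            exact Finset.sum_mul_sq_le_sq_mul_sq _ _ _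
        _ = ((1 / (L : ℝ)) ^ 2 * ∑ x, h x ^ 2) * M := by
            have e : ∀ x, (|h x| ^ k) ^ 2 = h x ^ (2 * k) := by
              intro x
              rw [← pow_mul, mul_comm k 2, pow_mul, sq_abs, ← pow_mul]
            simp only [sq_abs, e, hM]
            ring
        _ ≤ _ := by gcongr
    have hB : (1 / (L : ℝ) * ∑ x, ∑ i, |fwd i (fun y => h y ^ (k + 1)) x|) ^ 2 ≤
        8 * (k + 1) ^ 2 * D * M := by
      have e0 : ∀ x : ℝ, (|x| ^ k) ^ 2 = x ^ (2 * k) := by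
        intro x
        rw [← pow_mul, mul_comm k 2, pow_mul, sq_abs, ← pow_mul]
      have h3 : ∑ x, ∑ i, (|h (x + Pi.single i 1)| ^ k + |h x| ^ k) ^ 2 ≤
          8 * ∑ x, h x ^ (2 * k) := by
        calc _ ≤ ∑ x, ∑ i : Fin 2, (2 * h (x + Pi.single i 1) ^ (2 * k) + 2 * h x ^ (2 * k)) := by
              refine Finset.sum_le_sum fun x _ => Finset.sum_le_sum fun i _ => ?_
              rw [← e0, ← e0]
              nlinarith [sq_nonneg (|h (x + Pi.single i 1)| ^ k - |h x| ^ k)]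
          _ = _ := by
              rw [Finset.sum_comm]
              simp only [Finset.sum_add_distrib, ← Finset.mul_sum]
              simp only [sum_shift (fun y => h y ^ (2 * k))]
              simp
              ring
      have h4 : ∑ x, ∑ i, |fwd i (fun y => h y ^ (k + 1)) x| ≤
          (k + 1) * ∑ x, ∑ i, |fwd i h x| * (|h (x + Pi.single i 1)| ^ k + |h x| ^ k) := by
        rw [Finset.mul_sum]
        refine Finset.sum_le_sum fun x _ => ?_
        rw [Finset.mul_sum]
        exact Finset.sum_le_sum fun i _ => abs_fwd_pow_le h k i x
      have h5 : (∑ x, ∑ i, |fwd i h x| * (|h (x + Pi.single i 1)| ^ k + |h x| ^ k)) ^ 2 ≤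
          (∑ x, ∑ i, fwd i h x ^ 2) *
            ∑ x, ∑ i, (|h (x + Pi.single i 1)| ^ k + |h x| ^ k) ^ 2 := by
        have := Finset.sum_mul_sq_le_sq_mul_sq (Finset.univ : Finset (Lattice L × Fin 2))
          (fun p => |fwd p.2 h p.1|) (fun p => |h (p.1 + Pi.single p.2 1)| ^ k + |h p.1| ^ k)
        simpa only [Fintype.sum_prod_type, sq_abs] using this
      calc _ ≤ (1 / (L : ℝ) * ((k + 1) *
            ∑ x, ∑ i, |fwd i h x| * (|h (x + Pi.single i 1)| ^ k + |h x| ^ k))) ^ 2 := by gcongr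
        _ = (1 / (L : ℝ)) ^ 2 * (k + 1) ^ 2 *
            (∑ x, ∑ i, |fwd i h x| * (|h (x + Pi.single i 1)| ^ k + |h x| ^ k)) ^ 2 := by ring
        _ ≤ (1 / (L : ℝ)) ^ 2 * (k + 1) ^ 2 * (D * (8 * ∑ x, h x ^ (2 * k))) := by
            gcongr
            exact h5.trans (mul_le_mul hgrad h3 (by positivity) D0)
        _ = _ := by rw [hM]; ring
    calc (1 / (L : ℝ)) ^ 2 * ∑ x, h x ^ (2 * (k + 1)) =
          (1 / (L : ℝ)) ^ 2 * ∑ x, (h x ^ (k + 1)) ^ 2 := by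
          congr 1
          exact Finset.sum_congr rfl fun x _ => by ring
      _ ≤ _ := h1
      _ ≤ 2 * (((1 / (L : ℝ)) ^ 2 * ∑ x, |h x ^ (k + 1)|) ^ 2 +
          (1 / (L : ℝ) * ∑ x, ∑ i, |fwd i (fun y => h y ^ (k + 1)) x|) ^ 2) := add_sq_le
      _ ≤ 2 * (1 / m ^ 2 * D * M + 8 * (k + 1) ^ 2 * D * M) := by gcongr
      _ = 2 * (1 / m ^ 2 + 8 * (k + 1) ^ 2) * D * M := by ring
      _ ≤ 2 * (1 / m ^ 2 + 8 * (k + 1) ^ 2) * D * (sobolevConst m k * D ^ k) := by gcongr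
      _ = _ := by rw [sobolevConst]; ring

/-! ### Integrability of the Green function -/

theorem sq_sub_le_of_one_le {g h : ℝ} (hg : 1 ≤ g) (hh : 1 ≤ h) :
    (g - h) ^ 2 ≤ (-(g⁻¹ ^ 2) - -(h⁻¹ ^ 2)) * (g ^ 4 - h ^ 4) := by
  have g0 : 0 < g := by linarith
  have h0 : 0 < h := by linarith
  have e : (-(g⁻¹ ^ 2) - -(h⁻¹ ^ 2)) * (g ^ 4 - h ^ 4) =
      (g - h) ^ 2 * ((g + h) ^ 2 * (g ^ 2 + h ^ 2) / (g ^ 2 * h ^ 2)) := by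
    field_simp
    ring
  rw [e]
  refine le_mul_of_one_le_right (sq_nonneg _) ?_
  rw [one_le_div (by positivity)]
  have : h ^ 2 ≤ (g + h) ^ 2 := by nlinarith
  nlinarith [sq_nonneg g, sq_nonneg h, mul_le_mul this (by nlinarith : g ^ 2 ≤ g ^ 2 + h ^ 2) (by positivity) (by positivity)]

/-- The Green function of the massive Laplacian is bounded in every `L^r`, uniformly in the mesh
size. Testing its equation `(-Δ^ε + m²) F = δ` against the bounded function `-(1 + F)^{-1/2}` shows
that `(1 + F)^{1/4}` is bounded in `H¹`. -/
theorem sum_gffCovariance_pow_le (hm : 0 < m ^ 2) (r : ℕ) (x : Lattice L) :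
    (1 / (L : ℝ)) ^ 2 * ∑ y, gffCovariance L m x y ^ r ≤
      sobolevConst m (2 * r) * (m ^ 2 + 2) ^ (2 * r) := by
  have hL := natCast_L_pos (L := L)
  set F : Field L := fun y => gffCovariance L m x y with hF
  have F0 : ∀ y, 0 ≤ F y := fun y => gffCovariance_nonneg hm x y
  set G : Field L := fun y => √√(1 + F y) with hG
  have G1 : ∀ y, 1 ≤ G y := fun y => by
    rw [hG]; simp only [Real.one_le_sqrt]; linarith [F0 y]
  have G4 : ∀ y, G y ^ 4 = 1 + F y := by
    intro y
    have : G y ^ 4 = (G y ^ 2) ^ 2 := by ring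
    rw [this, hG]
    simp only
    rw [Real.sq_sqrt (Real.sqrt_nonneg _), Real.sq_sqrt (by linarith [F0 y])]
  set ψ : Field L := fun y => -((G y)⁻¹ ^ 2) with hψ
  have hsumF : m ^ 2 * ∑ y, F y = (L : ℝ) ^ 2 := by
    simp only [hF, gffCovariance_eq, ← Finset.mul_sum, sum_ellipticOp_inv zero_le_one hm x]
    rw [mul_left_comm, mul_inv_cancel₀ hm.ne', mul_one]
  have hAF : ∀ y, (ellipticOp L 1 (m ^ 2)).mulVec F y = if y = x then (L : ℝ) ^ 2 else 0 := by
    intro y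
    have e : F = fun z => (L : ℝ) ^ 2 * (ellipticOp L 1 (m ^ 2))⁻¹ z x := by
      funext z; rw [hF]; simp only; rw [gffCovariance_symm, gffCovariance_eq]
    have h1 : (ellipticOp L 1 (m ^ 2)).mulVec (fun z => (ellipticOp L 1 (m ^ 2))⁻¹ z x) y =
        (ellipticOp L 1 (m ^ 2) * (ellipticOp L 1 (m ^ 2))⁻¹) y x := rfl
    have h2 : F = (L : ℝ) ^ 2 • fun z => (ellipticOp L 1 (m ^ 2))⁻¹ z x := by
      rw [e]; rfl
    rw [h2, Matrix.mulVec_smul, Pi.smul_apply, h1, ellipticOp_mul_inv zero_le_one hm,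
      Matrix.one_apply]
    simp
  have htest := dotProduct_ellipticOp 1 (m ^ 2) ψ F
  have hl : ψ ⬝ᵥ (ellipticOp L 1 (m ^ 2)).mulVec F ≤ 0 := by
    rw [dotProduct]
    refine Finset.sum_nonpos fun y _ => ?_
    rw [hAF]
    have : ψ y ≤ 0 := by simp only [hψ, Left.neg_nonpos_iff]; positivity
    split_ifs
    · exact mul_nonpos_of_nonpos_of_nonneg this (by positivity)
    · simp
  have hψF : - (∑ y, F y) ≤ ∑ y, ψ y * F y := by
    rw [← Finset.sum_neg_distrib]
    refine Finset.sum_le_sum fun y _ => ?_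
    have : (G y)⁻¹ ^ 2 ≤ 1 := pow_le_one₀ (by positivity [G1 y]) (inv_le_one_of_one_le₀ (G1 y))
    simp only [hψ]
    nlinarith [F0 y]
  have hgrad0 : (L : ℝ) ^ 2 * ∑ y, ∑ i, fwd i ψ y * fwd i F y ≤ (L : ℝ) ^ 2 * 1 := by
    nlinarith
  have hgrad1 := le_of_mul_le_mul_left hgrad0 (by positivity)
  have hgrad : ∑ y, ∑ i, fwd i G y ^ 2 ≤ 1 := by
    refine le_trans (Finset.sum_le_sum fun y _ => Finset.sum_le_sum fun i _ => ?_) hgrad1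
    have := sq_sub_le_of_one_le (G1 (y + Pi.single i 1)) (G1 y)
    rw [G4, G4] at this
    simp only [fwd, hψ]
    linarith
  have hmass : (1 / (L : ℝ)) ^ 2 * (m ^ 2 * ∑ y, G y ^ 2) ≤ m ^ 2 + 1 := by
    have h1 : ∑ y, G y ^ 2 ≤ ∑ y, (1 + F y) := by
      refine Finset.sum_le_sum fun y _ => ?_
      rw [← G4]
      exact pow_le_pow_right₀ (G1 y) (by norm_num)
    have h2 : ∑ y : Lattice L, (1 + F y) = (L : ℝ) ^ 2 + ∑ y, F y := by
      simp [Finset.sum_add_distrib, Fintype.card_pi, ZMod.card]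
    calc _ ≤ (1 / (L : ℝ)) ^ 2 * (m ^ 2 * ((L : ℝ) ^ 2 + ∑ y, F y)) := by
          rw [← h2]; gcongr
      _ = (1 / (L : ℝ)) ^ 2 * (m ^ 2 * (L : ℝ) ^ 2 + m ^ 2 * ∑ y, F y) := by ring
      _ = _ := by rw [hsumF]; field_simp
  have hdir : dirichlet L m G ≤ m ^ 2 + 2 := by
    rw [dirichlet]; linarith
  calc (1 / (L : ℝ)) ^ 2 * ∑ y, gffCovariance L m x y ^ r ≤
        (1 / (L : ℝ)) ^ 2 * ∑ y, G y ^ (2 * (2 * r)) := by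
        gcongr with y
        have : G y ^ (2 * (2 * r)) = (1 + F y) ^ r := by rw [← G4, ← pow_mul]; congr 1; ring
        rw [this]
        exact pow_le_pow_left₀ (F0 y) (by linarith) r
    _ ≤ _ := sobolev hm (2 * r) G
    _ ≤ _ := by
        gcongr
        · exact sobolevConst_nonneg _ _
        · exact dirichlet_nonneg _ _

/-- The diagonal of `q_t Cⁿ`, where `Cⁿ` is the pointwise power of the covariance. It dominates
the variance of the regularised Wick powers. -/
def mollifiedVariance (L : ℕ) [NeZero L] (m : ℝ) (n : ℕ) (t : ℝ≥0) (x : Lattice L) : ℝ :=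
  ∑ y, q L m t x y * gffCovariance L m x y ^ n

theorem mollifiedVariance_nonneg (hm : 0 < m ^ 2) (n : ℕ) (t : ℝ≥0) (x : Lattice L) :
    0 ≤ mollifiedVariance L m n t x :=
  Finset.sum_nonneg fun y _ =>
    mul_nonneg (q_nonneg hm t x y) (pow_nonneg (gffCovariance_nonneg hm x y) n)

/-- The variance diverges slower than every power of `1 / t`, by Jensen's inequality for the
sub-probability kernel `q_t` and `t q_t ≤ C`. -/
theorem mollifiedVariance_pow_le (hm : 0 < m ^ 2) (n l : ℕ) (t : ℝ≥0) (x : Lattice L) :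
    t * mollifiedVariance L m n t x ^ (l + 1) ≤
      sobolevConst m (2 * (n * (l + 1) + 1)) * (m ^ 2 + 2) ^ (2 * (n * (l + 1) + 1)) := by
  have hL := natCast_L_pos (L := L)
  have jensen : mollifiedVariance L m n t x ^ (l + 1) ≤
      ∑ y, q L m t x y * gffCovariance L m x y ^ (n * (l + 1)) := by
    set b : ℝ := t * m ^ 2 + 1 with hb
    have hb1 : 1 ≤ b := by rw [hb]; simp; positivity
    have hb0 : 0 < b := by linarith
    have h := Real.pow_arith_mean_le_arith_mean_pow Finset.univ (fun y => b * q L m t x y)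
      (fun y => gffCovariance L m x y ^ n) (fun y _ => mul_nonneg hb0.le (q_nonneg hm t x y))
      (by rw [← Finset.mul_sum, sum_q hm, mul_inv_cancel₀ hb0.ne'])
      (fun y _ => pow_nonneg (gffCovariance_nonneg hm x y) n) (l + 1)
    simp only [mul_assoc, ← Finset.mul_sum, ← pow_mul] at h
    rw [← mollifiedVariance, mul_pow, pow_succ' b, mul_assoc] at h
    have h2 := le_of_mul_le_mul_left h hb0
    refine le_trans ?_ h2
    exact le_mul_of_one_le_left (pow_nonneg (mollifiedVariance_nonneg hm n t x) _)
      (one_le_pow₀ hb1)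
  refine le_trans ?_ (sum_gffCovariance_pow_le hm (n * (l + 1) + 1) x)
  calc _ ≤ t * ∑ y, q L m t x y * gffCovariance L m x y ^ (n * (l + 1)) := by gcongr
    _ = (1 / (L : ℝ)) ^ 2 * ∑ y, (t * ((L : ℝ) ^ 2 * q L m t x y)) *
          gffCovariance L m x y ^ (n * (l + 1)) := by
        rw [Finset.mul_sum, Finset.mul_sum]
        refine Finset.sum_congr rfl fun y _ => ?_
        field_simp
    _ ≤ (1 / (L : ℝ)) ^ 2 * ∑ y, gffCovariance L m x y *
          gffCovariance L m x y ^ (n * (l + 1)) := by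
        gcongr with y
        · exact pow_nonneg (gffCovariance_nonneg hm x y) _
        · exact mul_q_le_gffCovariance hm t x y
    _ = _ := by simp only [pow_succ']

end green

/-! ### The Gaussian free field and moments of regularised Wick powers -/

section field

variable {L : ℕ} [NeZero L] {m : ℝ}

theorem posDef_gffCovariance (hm : 0 < m ^ 2) : (gffCovariance L m).PosDef := by
  rw [gffCovariance, massiveLaplacian_eq]
  exact (posDef_ellipticOp zero_le_one hm).inv.smul (pow_pos natCast_L_pos 2)

open scoped MatrixOrder in
/-- The Gaussian free field is the image of independent standard Gaussian variables under the
symmetric square root of its covariance matrix. -/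
theorem exists_gff_eq_map (hm : 0 < m ^ 2) : ∃ B : Matrix (Lattice L) (Lattice L) ℝ,
    B.IsSymm ∧ B * B = gffCovariance L m ∧
    gff L m = (Measure.pi fun _ => gaussianReal 0 1).map B.mulVec := by
  refine ⟨CFC.sqrt (gffCovariance L m), ?_, ?_, ?_⟩
  · have := (CFC.sqrt_nonneg (gffCovariance L m)).isSelfAdjoint
    rw [Matrix.IsSymm, ← Matrix.conjTranspose_eq_transpose_of_trivial]
    exact this
  · exact CFC.sqrt_mul_sqrt_self _ (posDef_gffCovariance hm).posSemidef.nonneg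
  · rw [gff, multivariateGaussian, ← map_pi_eq_stdGaussian, Measure.map_map (by fun_prop)
      (by fun_prop), Measure.map_map (by fun_prop) (by fun_prop)]
    congr 1
    funext ξ x
    simp

theorem isProbabilityMeasure_gff : IsProbabilityMeasure (gff L m) := by
  rw [gff]
  exact Measure.isProbabilityMeasure_map (by fun_prop)

theorem gffVariance_eq (hm : 0 < m ^ 2) (x : Lattice L) :
    gffVariance L m x = gffCovariance L m x x := by
  rw [gffVariance, gff, variance_map (measurable_pi_apply x).aemeasurable (by fun_prop)]
  exact variance_eval_multivariateGaussian (posDef_gffCovariance hm).posSemidef x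

theorem wickPow_eq (hm : 0 < m ^ 2) (n : ℕ) (φ : Field L) (x : Lattice L) :
    wickPow L m n φ x = wick (gffCovariance L m x x) (φ x) n := by
  rw [wickPow, gffVariance_eq hm]
  exact wick_eq_sqrt_pow_mul_hermite (posDef_gffCovariance hm).diag_pos _ _

theorem continuous_wick {X : Type*} [TopologicalSpace X] (c : ℝ) {f : X → ℝ} (hf : Continuous f)
    (n : ℕ) : Continuous fun x => wick c (f x) n := by
  induction n using Nat.twoStepInduction with
  | zero => exact continuous_const
  | one => exact hf
  | more n h1 h2 => exact (hf.mul h2).sub (continuous_const.mul h1)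

theorem continuous_wickPow (hm : 0 < m ^ 2) (n : ℕ) (x : Lattice L) :
    Continuous fun φ : Field L => wickPow L m n φ x := by
  simp only [wickPow_eq hm]
  exact continuous_wick _ (continuous_apply x) n

theorem integral_wickPow (hm : 0 < m ^ 2) {n : ℕ} (hn : n ≠ 0) (x : Lattice L) :
    Integrable (fun φ => wickPow L m n φ x) (gff L m) ∧ ∫ φ, wickPow L m n φ x ∂gff L m = 0 := by
  obtain ⟨B, hs, hB, hgff⟩ := exists_gff_eq_map (L := L) hm
  have hvar : gffCovariance L m x x = ∑ a, B x a ^ 2 := by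
    rw [← hB, Matrix.mul_apply]
    exact Finset.sum_congr rfl fun a _ => by rw [hs.apply, sq]
  have hmeas : Measurable B.mulVec := by fun_prop
  rw [hgff, integrable_map_measure (continuous_wickPow hm n x).aestronglyMeasurable
    hmeas.aemeasurable, integral_map hmeas.aemeasurable
    (continuous_wickPow hm n x).aestronglyMeasurable]
  simp only [wickPow_eq hm, hvar, Function.comp_def, Matrix.mulVec, dotProduct]
  exact ⟨integrable_wick B n x, integral_wick_eq_zero B hn x⟩

/-- Moments of `∑ K(y) :φⁿ(y):` under the Gaussian free field. -/
theorem integral_sum_wickPow_pow_le (hm : 0 < m ^ 2) (n k : ℕ) (K : Field L) :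
    Integrable (fun φ => (∑ y, K y * wickPow L m n φ y) ^ (2 * (k + 1))) (gff L m) ∧
    ∫ φ, (∑ y, K y * wickPow L m n φ y) ^ (2 * (k + 1)) ∂gff L m ≤
      chaosConst k n * (∑ y, ∑ z, K y * K z * gffCovariance L m y z ^ n) ^ (k + 1) := by
  obtain ⟨B, hs, hB, hgff⟩ := exists_gff_eq_map (L := L) hm
  have hcov : ∀ x y, gffCovariance L m x y = ∑ a, B x a * B y a := by
    intro x y
    rw [← hB, Matrix.mul_apply]
    exact Finset.sum_congr rfl fun a _ => by rw [hs.apply y a]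
  have hmeas : Measurable B.mulVec := by fun_prop
  have hc : Continuous fun φ => (∑ y, K y * wickPow L m n φ y) ^ (2 * (k + 1)) :=
    (continuous_finsetSum _ fun y _ => continuous_const.mul (continuous_wickPow hm n y)).pow _
  rw [hgff, integrable_map_measure hc.aestronglyMeasurable hmeas.aemeasurable,
    integral_map hmeas.aemeasurable hc.aestronglyMeasurable]
  simp only [wickPow_eq hm, hcov, ← sq, Function.comp_def, Matrix.mulVec, dotProduct]
  exact ⟨integrable_chaos_pow B n (2 * (k + 1)) K, integral_chaos_pow_le B n k K⟩

theorem chaosConst_pos (k n : ℕ) : 0 < chaosConst k n := by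
  induction n with
  | zero => simp [chaosConst]
  | succ n ih => rw [chaosConst]; positivity

/-- The covariance of `:φⁿ:` is positive semidefinite, being proportional to `Cⁿ`. -/
theorem sum_sum_gffCovariance_pow_nonneg (hm : 0 < m ^ 2) (n : ℕ) (K : Field L) :
    0 ≤ ∑ y, ∑ z, K y * K z * gffCovariance L m y z ^ n := by
  have h := (integral_sum_wickPow_pow_le hm n 0 K).2
  have h0 : 0 ≤ ∫ φ, (∑ y, K y * wickPow L m n φ y) ^ (2 * (0 + 1)) ∂gff L m :=
    integral_nonneg fun φ => by rw [pow_mul]; positivity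
  rw [zero_add, pow_one] at h
  exact nonneg_of_mul_nonneg_right (h0.trans h) (chaosConst_pos 0 n)

/-- The regularisation `q_t :φⁿ:` of a Wick power. -/
def mollifiedWick (L : ℕ) [NeZero L] (m : ℝ) (n : ℕ) (t : ℝ≥0) (φ : Field L) : Field L :=
  (q L m t).mulVec (wickPow L m n φ)

/-- The variances of `q_t :φⁿ:` and of its gradient add up to the diagonal of `q_t Cⁿ`, because
`(t (-Δ^ε + m²) + 1) q_t Cⁿ q_t = Cⁿ q_t` and all kernels are translation invariant. -/
theorem variance_add_gradient_eq (hm : 0 < m ^ 2) (n : ℕ) (t : ℝ≥0) (x : Lattice L) :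
    (t * m ^ 2 + 1) * (∑ y, ∑ z, q L m t x y * q L m t x z * gffCovariance L m y z ^ n) +
      t * ((L : ℝ) ^ 2 * ∑ i, ∑ y, ∑ z, (q L m t (x + Pi.single i 1) y - q L m t x y) *
        (q L m t (x + Pi.single i 1) z - q L m t x z) * gffCovariance L m y z ^ n) =
      mollifiedVariance L m n t x := by
  set Γ : Matrix (Lattice L) (Lattice L) ℝ := Matrix.of fun y z => gffCovariance L m y z ^ n with hΓ
  set R := q L m t * Γ * q L m t with hR
  have hRa : ∀ a b, R a b = ∑ y, ∑ z, q L m t a y * q L m t b z * gffCovariance L m y z ^ n := by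
    intro a b
    rw [hR, Matrix.mul_assoc, Matrix.mul_apply]
    refine Finset.sum_congr rfl fun y _ => ?_
    rw [Matrix.mul_apply, Finset.mul_sum]
    refine Finset.sum_congr rfl fun z _ => ?_
    rw [q_symm m t z b, hΓ, Matrix.of_apply]
    ring
  have hRt : ∀ a b z, R (a + z) (b + z) = R a b := by
    intro a b z
    have h1 : (q L m t).submatrix (Equiv.addRight z) (Equiv.addRight z) = q L m t := by
      ext x y; simp [q_add_add]
    have h2 : Γ.submatrix (Equiv.addRight z) (Equiv.addRight z) = Γ := by
      ext x y; simp [hΓ, gffCovariance_add_add]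
    have h3 : R.submatrix (Equiv.addRight z) (Equiv.addRight z) = R := by
      rw [hR, ← Matrix.submatrix_mul_equiv _ _ _ (Equiv.addRight z),
        ← Matrix.submatrix_mul_equiv _ _ _ (Equiv.addRight z), h1, h2]
    exact congrFun (congrFun h3 a) b
  have hop : ellipticOp L t (t * m ^ 2 + 1) * R = Γ * q L m t := by
    rw [hR, ← Matrix.mul_assoc, ← Matrix.mul_assoc, q_eq,
      ellipticOp_mul_inv t.coe_nonneg (q_pos_aux hm t), Matrix.one_mul]
  have hdiag := congrFun (congrFun hop x) x
  have e1 : (ellipticOp L t (t * m ^ 2 + 1) * R) x x =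
      (ellipticOp L t (t * m ^ 2 + 1)).mulVec (fun z => R z x) x := rfl
  rw [e1, ellipticOp_mulVec] at hdiag
  have e2 : (Γ * q L m t) x x = mollifiedVariance L m n t x := by
    rw [Matrix.mul_apply, mollifiedVariance]
    refine Finset.sum_congr rfl fun y _ => ?_
    rw [q_symm m t y x, hΓ, Matrix.of_apply, mul_comm]
  have e3 : ∀ i : Fin 2, ∑ y, ∑ z, (q L m t (x + Pi.single i 1) y - q L m t x y) *
        (q L m t (x + Pi.single i 1) z - q L m t x z) * gffCovariance L m y z ^ n =
      -((R (x + Pi.single i 1) x - R x x) + (R (x - Pi.single i 1) x - R x x)) := by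
    intro i
    have h4 : R (x - Pi.single i 1) x = R x (x + Pi.single i 1) := by
      have := hRt (x - Pi.single i 1) x (Pi.single i 1)
      rw [sub_add_cancel] at this
      exact this.symm
    have h5 : R (x + Pi.single i 1) (x + Pi.single i 1) = R x x := hRt _ _ _
    have h6 : ∑ y, ∑ z, (q L m t (x + Pi.single i 1) y - q L m t x y) *
        (q L m t (x + Pi.single i 1) z - q L m t x z) * gffCovariance L m y z ^ n =
        R (x + Pi.single i 1) (x + Pi.single i 1) - R (x + Pi.single i 1) x -
          R x (x + Pi.single i 1) + R x x := by
      simp only [hRa, ← Finset.sum_sub_distrib, ← Finset.sum_add_distrib]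
      exact Finset.sum_congr rfl fun y _ => Finset.sum_congr rfl fun z _ => by ring
    rw [h6, h4, h5]
    ring
  rw [← e2, ← hdiag, ← hRa, Finset.sum_congr rfl fun i _ => e3 i, Finset.sum_neg_distrib]
  simp only [laplacian, LinearMap.coe_mk, AddHom.coe_mk]
  ring

theorem integral_mollifiedWick_pow_le (hm : 0 < m ^ 2) (n k : ℕ) (t : ℝ≥0) (x : Lattice L) :
    Integrable (fun φ => mollifiedWick L m n t φ x ^ (2 * (k + 1))) (gff L m) ∧
    ∫ φ, mollifiedWick L m n t φ x ^ (2 * (k + 1)) ∂gff L m ≤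
      chaosConst k n * mollifiedVariance L m n t x ^ (k + 1) := by
  have h := integral_sum_wickPow_pow_le hm n k (fun y => q L m t x y)
  refine ⟨h.1, h.2.trans ?_⟩
  have h0 := sum_sum_gffCovariance_pow_nonneg hm n (fun y => q L m t x y)
  refine mul_le_mul_of_nonneg_left (pow_le_pow_left₀ h0 ?_ _) (chaosConst_pos k n).le
  have h1 := variance_add_gradient_eq hm n t x
  have h2 : 0 ≤ (t : ℝ) * ((L : ℝ) ^ 2 * ∑ i, ∑ y, ∑ z,
      (q L m t (x + Pi.single i 1) y - q L m t x y) *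
        (q L m t (x + Pi.single i 1) z - q L m t x z) * gffCovariance L m y z ^ n) :=
    mul_nonneg t.coe_nonneg (mul_nonneg (by positivity) (Finset.sum_nonneg fun i _ =>
      sum_sum_gffCovariance_pow_nonneg hm n
        (fun y => q L m t (x + Pi.single i 1) y - q L m t x y)))
  have h3 : 0 ≤ (t : ℝ) * m ^ 2 := by positivity
  nlinarith

theorem integral_fwd_mollifiedWick_pow_le (hm : 0 < m ^ 2) (n k : ℕ) (t : ℝ≥0) (i : Fin 2)
    (x : Lattice L) :
    Integrable (fun φ => ((L : ℝ) * fwd i (mollifiedWick L m n t φ) x) ^ (2 * (k + 1))) (gff L m) ∧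
    t ^ (k + 1) *
      ∫ φ, ((L : ℝ) * fwd i (mollifiedWick L m n t φ) x) ^ (2 * (k + 1)) ∂gff L m ≤
      chaosConst k n * mollifiedVariance L m n t x ^ (k + 1) := by
  have e : ∀ φ, (L : ℝ) * fwd i (mollifiedWick L m n t φ) x = ∑ y,
      ((L : ℝ) * (q L m t (x + Pi.single i 1) y - q L m t x y)) * wickPow L m n φ y := by
    intro φ
    simp only [fwd, mollifiedWick, Matrix.mulVec, dotProduct]
    rw [← Finset.sum_sub_distrib, Finset.mul_sum]
    exact Finset.sum_congr rfl fun y _ => by ring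
  simp only [e]
  have h := integral_sum_wickPow_pow_le hm n k
    (fun y => (L : ℝ) * (q L m t (x + Pi.single i 1) y - q L m t x y))
  refine ⟨h.1, ?_⟩
  have hpos : ∀ j : Fin 2, 0 ≤ ∑ y, ∑ z, (q L m t (x + Pi.single j 1) y - q L m t x y) *
        (q L m t (x + Pi.single j 1) z - q L m t x z) * gffCovariance L m y z ^ n := fun j =>
    sum_sum_gffCovariance_pow_nonneg hm n (fun y => q L m t (x + Pi.single j 1) y - q L m t x y)
  have h0 := sum_sum_gffCovariance_pow_nonneg hm n (fun y => q L m t x y)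
  have h1 := variance_add_gradient_eq hm n t x
  have h2 := Finset.single_le_sum (f := fun j => ∑ y, ∑ z,
    (q L m t (x + Pi.single j 1) y - q L m t x y) *
        (q L m t (x + Pi.single j 1) z - q L m t x z) * gffCovariance L m y z ^ n)
    (fun j _ => hpos j) (Finset.mem_univ i)
  have h3 : ∑ y, ∑ z, ((L : ℝ) * (q L m t (x + Pi.single i 1) y - q L m t x y)) *
      ((L : ℝ) * (q L m t (x + Pi.single i 1) z - q L m t x z)) * gffCovariance L m y z ^ n =
      (L : ℝ) ^ 2 * ∑ y, ∑ z, (q L m t (x + Pi.single i 1) y - q L m t x y) *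
        (q L m t (x + Pi.single i 1) z - q L m t x z) * gffCovariance L m y z ^ n := by
    simp only [Finset.mul_sum]
    exact Finset.sum_congr rfl fun y _ => Finset.sum_congr rfl fun z _ => by ring
  rw [h3] at h
  calc _ ≤ (t : ℝ) ^ (k + 1) * (chaosConst k n * ((L : ℝ) ^ 2 * ∑ y, ∑ z,
        (q L m t (x + Pi.single i 1) y - q L m t x y) *
        (q L m t (x + Pi.single i 1) z - q L m t x z) * gffCovariance L m y z ^ n) ^ (k + 1)) := by
        gcongr; exact h.2
    _ = chaosConst k n * (t * ((L : ℝ) ^ 2 * ∑ y, ∑ z,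
        (q L m t (x + Pi.single i 1) y - q L m t x y) *
        (q L m t (x + Pi.single i 1) z - q L m t x z) * gffCovariance L m y z ^ n)) ^ (k + 1) := by
        rw [mul_pow (t : ℝ)]; ring
    _ ≤ _ := by
        refine mul_le_mul_of_nonneg_left (pow_le_pow_left₀ ?_ ?_ _) (chaosConst_pos k n).le
        · exact mul_nonneg t.coe_nonneg (mul_nonneg (by positivity) (hpos i))
        · rw [← h1]
          refine le_trans ?_ (le_add_of_nonneg_left (mul_nonneg (by positivity) h0))
          gcongr

end field

/-! ### Pathwise lower bound for the shifted Hamiltonian -/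

section pathwise

/-- The regularisation scales `t_i = (i + 1)^{-8N}`. -/
def scale (N i : ℕ) : ℝ≥0 := (((i : ℝ≥0) + 1) ^ (8 * N))⁻¹

theorem scale_coe (N i : ℕ) : (scale N i : ℝ) = (((i : ℝ) + 1) ^ (8 * N))⁻¹ := by
  simp [scale]

theorem scale_pos (N i : ℕ) : 0 < (scale N i : ℝ) := by rw [scale_coe]; positivity

theorem scale_le_one (N i : ℕ) : (scale N i : ℝ) ≤ 1 := by
  rw [scale_coe]
  exact inv_le_one_of_one_le₀ (one_le_pow₀ (by linarith [(Nat.cast_nonneg i : (0 : ℝ) ≤ i)]))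

/-- The size of the distribution `w` at the `i`-th scale: powers of the `L^{2N}` norm of its
regularisation and of the `L⁴` norm of the gradient of the regularisation, with weights that make
the expectations summable when `w` is a Wick power. -/
def noiseTerm (L : ℕ) [NeZero L] (m : ℝ) (N : ℕ) (w : Field L) (i : ℕ) : ℝ :=
  (((i : ℝ) + 1) ^ 4)⁻¹ *
      ((1 / (L : ℝ)) ^ 2 * ∑ x, (q L m (scale N i)).mulVec w x ^ (2 * N)) +
    (scale N i : ℝ) ^ 3 * ((1 / (L : ℝ)) ^ 2 *
      ∑ x, ∑ j, ((L : ℝ) * fwd j ((q L m (scale N i)).mulVec w) x) ^ 4)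

/-- The size of `w` as a distribution of negative regularity, summed over all scales. -/
def noise (L : ℕ) [NeZero L] (m : ℝ) (N : ℕ) (w : Field L) : ℝ≥0∞ :=
  ∑' i, ENNReal.ofReal (noiseTerm L m N w i)

variable {L : ℕ} [NeZero L] {m : ℝ}

theorem noiseTerm_left_nonneg (m : ℝ) (N : ℕ) (w : Field L) (i : ℕ) :
    0 ≤ (((i : ℝ) + 1) ^ 4)⁻¹ *
      ((1 / (L : ℝ)) ^ 2 * ∑ x, (q L m (scale N i)).mulVec w x ^ (2 * N)) := by
  refine mul_nonneg (by positivity) (mul_nonneg (by positivity) (Finset.sum_nonneg fun x _ => ?_))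
  rw [pow_mul]; positivity

theorem noiseTerm_right_nonneg (m : ℝ) (N : ℕ) (w : Field L) (i : ℕ) :
    0 ≤ (scale N i : ℝ) ^ 3 * ((1 / (L : ℝ)) ^ 2 *
      ∑ x, ∑ j, ((L : ℝ) * fwd j ((q L m (scale N i)).mulVec w) x) ^ 4) := by
  positivity

theorem sum_const_lattice (c : ℝ) : (1 / (L : ℝ)) ^ 2 * ∑ _x : Lattice L, c = c := by
  have hL := (natCast_L_pos (L := L)).ne'
  simp only [Finset.sum_const, Finset.card_univ, Fintype.card_pi, ZMod.card, Finset.prod_const,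
    Fintype.card_fin, nsmul_eq_mul, Nat.cast_pow]
  field_simp

theorem mollifiedVariance_scale_pow_le (hm : 0 < m ^ 2) {N : ℕ} (hN : 0 < N) (n i : ℕ)
    (x : Lattice L) :
    mollifiedVariance L m n (scale N i) x ^ N ≤
      (1 + sobolevConst m (2 * (n * (4 * N * N) + 1)) *
        (m ^ 2 + 2) ^ (2 * (n * (4 * N * N) + 1))) * ((i : ℝ) + 1) ^ 2 := by
  obtain ⟨l, hl⟩ : ∃ l, 4 * N * N = l + 1 := ⟨4 * N * N - 1, by
    have : 0 < 4 * N * N := by positivity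
    lia⟩
  have h := mollifiedVariance_pow_le hm n l (scale N i) x
  rw [← hl] at h
  set c := sobolevConst m (2 * (n * (4 * N * N) + 1)) *
        (m ^ 2 + 2) ^ (2 * (n * (4 * N * N) + 1)) with hc
  have c0 : 0 ≤ c := mul_nonneg (sobolevConst_nonneg _ _) (by positivity)
  set M := mollifiedVariance L m n (scale N i) x
  have M0 : 0 ≤ M := mollifiedVariance_nonneg hm n _ x
  rw [scale_coe, inv_mul_le_iff₀ (by positivity)] at h
  refine le_of_pow_le_pow_left₀ (n := 4 * N) (by positivity) (by positivity) ?_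
  calc (M ^ N) ^ (4 * N) = M ^ (4 * N * N) := by rw [← pow_mul]; congr 1; ring
    _ ≤ ((i : ℝ) + 1) ^ (8 * N) * c := h
    _ ≤ ((i : ℝ) + 1) ^ (8 * N) * (1 + c) ^ (4 * N) := by
        gcongr
        calc c ≤ 1 + c := by linarith
          _ = (1 + c) ^ 1 := by ring
          _ ≤ (1 + c) ^ (4 * N) := pow_le_pow_right₀ (by linarith) (by lia)
    _ = _ := by rw [mul_pow, ← pow_mul]; ring

theorem continuous_mollifiedWick (hm : 0 < m ^ 2) (n : ℕ) (t : ℝ≥0) (x : Lattice L) :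
    Continuous fun φ => mollifiedWick L m n t φ x := by
  simp only [mollifiedWick, Matrix.mulVec, dotProduct]
  exact continuous_finsetSum _ fun y _ => continuous_const.mul (continuous_wickPow hm n y)

theorem measurable_noise (hm : 0 < m ^ 2) (N n : ℕ) :
    Measurable fun φ : Field L => noise L m N (wickPow L m n φ) := by
  refine Measurable.tsum fun i => ENNReal.measurable_ofReal.comp ?_
  have h := fun x => continuous_mollifiedWick (L := L) hm n (scale N i) x
  refine Continuous.measurable ?_
  refine (continuous_const.mul (continuous_const.mul (continuous_finsetSum _ fun x _ =>
    (h x).pow _))).add (continuous_const.mul (continuous_const.mul (continuous_finsetSum _ fun x _ =>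
    continuous_finsetSum _ fun j _ => (continuous_const.mul ((h _).sub (h _))).pow _)))

theorem integral_noiseTerm_le (hm : 0 < m ^ 2) {N : ℕ} (hN : 2 ≤ N) (n i : ℕ) :
    Integrable (fun φ : Field L => noiseTerm L m N (wickPow L m n φ) i) (gff L m) ∧
    ∫ φ, noiseTerm L m N (wickPow L m n φ) i ∂gff L m ≤
      (chaosConst (N - 1) n + 4 * chaosConst 1 n) *
        (1 + sobolevConst m (2 * (n * (4 * N * N) + 1)) *
          (m ^ 2 + 2) ^ (2 * (n * (4 * N * N) + 1))) * (1 / ((i : ℝ) + 1) ^ 2) := by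
  set c := 1 + sobolevConst m (2 * (n * (4 * N * N) + 1)) *
        (m ^ 2 + 2) ^ (2 * (n * (4 * N * N) + 1)) with hc
  have c1 : 1 ≤ c := by
    have := mul_nonneg (sobolevConst_nonneg m (2 * (n * (4 * N * N) + 1)))
      (by positivity : 0 ≤ (m ^ 2 + 2) ^ (2 * (n * (4 * N * N) + 1)))
    linarith
  set t := scale N i with ht
  have t0 : 0 < (t : ℝ) := scale_pos N i
  set s : ℝ := (i : ℝ) + 1 with hs
  have s1 : 1 ≤ s := by rw [hs]; linarith [(Nat.cast_nonneg i : (0 : ℝ) ≤ i)]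
  have s0 : 0 < s := by linarith
  have hM : ∀ x : Lattice L, mollifiedVariance L m n t x ^ N ≤ c * s ^ 2 := fun x =>
    mollifiedVariance_scale_pow_le hm (by lia) n i x
  have hM2 : ∀ x : Lattice L, mollifiedVariance L m n t x ^ 2 ≤ 2 * (c * s ^ 2) := by
    intro x
    have M0 := mollifiedVariance_nonneg hm n t x
    have h1 : 1 ≤ c * s ^ 2 := by
      calc (1 : ℝ) = 1 * 1 := by ring
        _ ≤ c * s ^ 2 := mul_le_mul c1 (one_le_pow₀ s1) zero_le_one (by linarith)
    rcases le_total (mollifiedVariance L m n t x) 1 with h | h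
    · have : mollifiedVariance L m n t x ^ 2 ≤ 1 := pow_le_one₀ M0 h
      linarith
    · have := (pow_le_pow_right₀ h hN).trans (hM x)
      linarith
  have hts : (t : ℝ) ≤ (s ^ 4)⁻¹ := by
    rw [ht, scale_coe]
    exact inv_anti₀ (by positivity) (pow_le_pow_right₀ s1 (by lia))
  have hA := fun x : Lattice L => integral_mollifiedWick_pow_le hm n (N - 1) t x
  have hB := fun (x : Lattice L) (j : Fin 2) => integral_fwd_mollifiedWick_pow_le hm n 1 t j x
  simp only [Nat.sub_add_cancel (show 1 ≤ N by lia)] at hA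
  simp only [Nat.reduceAdd, Nat.reduceMul] at hB
  have iA : Integrable (fun φ : Field L => (1 / (L : ℝ)) ^ 2 *
      ∑ x, mollifiedWick L m n t φ x ^ (2 * N)) (gff L m) :=
    (integrable_finsetSum _ fun x _ => (hA x).1).const_mul _
  have iB : Integrable (fun φ : Field L => (1 / (L : ℝ)) ^ 2 *
      ∑ x, ∑ j, ((L : ℝ) * fwd j (mollifiedWick L m n t φ) x) ^ 4) (gff L m) :=
    (integrable_finsetSum _ fun x _ => integrable_finsetSum _ fun j _ => (hB x j).1).const_mul _
  have eA : ∫ φ : Field L, (1 / (L : ℝ)) ^ 2 *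
      ∑ x, mollifiedWick L m n t φ x ^ (2 * N) ∂gff L m ≤
      chaosConst (N - 1) n * (c * s ^ 2) := by
    rw [integral_const_mul, integral_finsetSum _ fun x _ => (hA x).1]
    refine le_trans ?_ (sum_const_lattice (L := L) _).le
    gcongr with x
    exact (hA x).2.trans (mul_le_mul_of_nonneg_left (hM x) (chaosConst_pos _ _).le)
  have eB : (t : ℝ) ^ 3 * ∫ φ : Field L, (1 / (L : ℝ)) ^ 2 *
      ∑ x, ∑ j, ((L : ℝ) * fwd j (mollifiedWick L m n t φ) x) ^ 4 ∂gff L m ≤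
      (s ^ 4)⁻¹ * (4 * chaosConst 1 n * (c * s ^ 2)) := by
    have h1 : (t : ℝ) ^ 2 * ∫ φ : Field L, (1 / (L : ℝ)) ^ 2 *
        ∑ x, ∑ j, ((L : ℝ) * fwd j (mollifiedWick L m n t φ) x) ^ 4 ∂gff L m ≤
        4 * chaosConst 1 n * (c * s ^ 2) := by
      rw [integral_const_mul, integral_finsetSum _ fun x _ =>
        integrable_finsetSum _ fun j _ => (hB x j).1]
      simp only [integral_finsetSum _ fun j _ => (hB _ j).1]
      rw [mul_left_comm, Finset.mul_sum]
      refine le_trans ?_ (sum_const_lattice (L := L) _).le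
      refine mul_le_mul_of_nonneg_left (Finset.sum_le_sum fun x _ => ?_) (by positivity)
      rw [Finset.mul_sum]
      refine (Finset.sum_le_sum fun j _ => (hB x j).2).trans ?_
      have := mul_le_mul_of_nonneg_left (hM2 x) (chaosConst_pos 1 n).le
      simp
      linarith
    have h2 : 0 ≤ 4 * chaosConst 1 n * (c * s ^ 2) := by
      have := chaosConst_pos 1 n
      positivity
    calc _ = (t : ℝ) * ((t : ℝ) ^ 2 * ∫ φ : Field L, (1 / (L : ℝ)) ^ 2 *
        ∑ x, ∑ j, ((L : ℝ) * fwd j (mollifiedWick L m n t φ) x) ^ 4 ∂gff L m) := by ring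
      _ ≤ (t : ℝ) * (4 * chaosConst 1 n * (c * s ^ 2)) := by gcongr
      _ ≤ _ := by gcongr
  refine ⟨(iA.const_mul _).add (iB.const_mul _), ?_⟩
  have e : ∫ φ : Field L, noiseTerm L m N (wickPow L m n φ) i ∂gff L m =
      (s ^ 4)⁻¹ * (∫ φ : Field L, (1 / (L : ℝ)) ^ 2 *
        ∑ x, mollifiedWick L m n t φ x ^ (2 * N) ∂gff L m) +
      (t : ℝ) ^ 3 * ∫ φ : Field L, (1 / (L : ℝ)) ^ 2 *
        ∑ x, ∑ j, ((L : ℝ) * fwd j (mollifiedWick L m n t φ) x) ^ 4 ∂gff L m := by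
    rw [← integral_const_mul (s ^ 4)⁻¹, ← integral_const_mul ((t : ℝ) ^ 3),
      ← integral_add (iA.const_mul _) (iB.const_mul _)]
    rfl
  rw [e]
  calc _ ≤ (s ^ 4)⁻¹ * (chaosConst (N - 1) n * (c * s ^ 2)) +
        (s ^ 4)⁻¹ * (4 * chaosConst 1 n * (c * s ^ 2)) := by gcongr
    _ = _ := by field_simp

theorem exists_lintegral_noise_le (hm : 0 < m ^ 2) {N : ℕ} (hN : 2 ≤ N) (n : ℕ) :
    ∃ C : ℝ≥0, ∀ (L : ℕ) [NeZero L],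
      ∫⁻ φ : Field L, noise L m N (wickPow L m n φ) ∂gff L m ≤ C := by
  set K := (chaosConst (N - 1) n + 4 * chaosConst 1 n) *
        (1 + sobolevConst m (2 * (n * (4 * N * N) + 1)) *
          (m ^ 2 + 2) ^ (2 * (n * (4 * N * N) + 1))) with hK
  have hsum : Summable fun i : ℕ => K * (1 / ((i : ℝ) + 1) ^ 2) := by
    refine Summable.mul_left _ ?_
    have := (summable_nat_add_iff 1).2 (Real.summable_one_div_nat_pow.2 one_lt_two)
    simpa using this
  have K0 : 0 ≤ K := by
    have h1 := chaosConst_pos (N - 1) n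
    have h2 := chaosConst_pos 1 n
    have h3 := sobolevConst_nonneg m (2 * (n * (4 * N * N) + 1))
    positivity
  refine ⟨(∑' i : ℕ, K * (1 / ((i : ℝ) + 1) ^ 2)).toNNReal, fun L _ => ?_⟩
  have hmeas : ∀ i, AEMeasurable (fun φ : Field L =>
      ENNReal.ofReal (noiseTerm L m N (wickPow L m n φ) i)) (gff L m) := fun i =>
    (integral_noiseTerm_le hm hN n i).1.aestronglyMeasurable.aemeasurable.ennreal_ofReal
  simp only [noise]
  rw [lintegral_tsum hmeas, ← ENNReal.ofReal, ENNReal.ofReal_tsum_of_nonneg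
    (fun i => by positivity) hsum]
  refine ENNReal.tsum_le_tsum fun i => ?_
  have h := integral_noiseTerm_le (L := L) hm hN n i
  rw [← ofReal_integral_eq_lintegral_ofReal h.1
    (ae_of_all _ fun φ => add_nonneg (noiseTerm_left_nonneg m N _ i) (noiseTerm_right_nonneg m N _ i))]
  exact ENNReal.ofReal_le_ofReal h.2

/-- Summation by parts against the regularisation `v = q_t w` of `w`. -/
theorem sum_mul_eq_mollified (hm : 0 < m ^ 2) (t : ℝ≥0) (w g : Field L) :
    (1 / (L : ℝ)) ^ 2 * ∑ x, w x * g x =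
      (t * m ^ 2 + 1) * ((1 / (L : ℝ)) ^ 2 * ∑ x, g x * (q L m t).mulVec w x) +
        t * ∑ x, ∑ i, fwd i g x * fwd i ((q L m t).mulVec w) x := by
  have hL := (natCast_L_pos (L := L)).ne'
  have h := dotProduct_ellipticOp t (t * m ^ 2 + 1) g ((q L m t).mulVec w)
  rw [Matrix.mulVec_mulVec, q_eq, ellipticOp_mul_inv t.coe_nonneg (q_pos_aux hm t),
    Matrix.one_mulVec, ← q_eq] at h
  have e : ∑ x, w x * g x = g ⬝ᵥ w := by
    rw [dotProduct]; exact Finset.sum_congr rfl fun x _ => mul_comm _ _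
  rw [e, h]
  field_simp

theorem abs_mul_abs_pow_le {η : ℝ} (hη : 0 < η) {j N : ℕ} (hj : j < N) (v h : ℝ) :
    |v| * |h| ^ j ≤ η * |h| ^ N + (1 + (η⁻¹) ^ (N - 1)) * (1 + |v| ^ N) := by
  have hN : N ≠ 0 := by lia
  have v1 : |v| ≤ 1 + |v| ^ N := by
    rcases le_total |v| 1 with h1 | h1
    · have : 0 ≤ |v| ^ N := by positivity
      linarith
    · have := le_self_pow₀ h1 hN
      linarith
  have hK : 0 ≤ (η⁻¹) ^ (N - 1) := by positivity
  have hv : 0 ≤ |v| ^ N := by positivity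
  have hh : 0 ≤ η * |h| ^ N := by positivity
  rcases le_total |h| 1 with h1 | h1
  · have h2 : |v| * |h| ^ j ≤ |v| * 1 := by gcongr; exact pow_le_one₀ (abs_nonneg _) h1
    nlinarith
  · have h2 : |v| * |h| ^ j ≤ |v| * |h| ^ (N - 1) :=
      mul_le_mul_of_nonneg_left (pow_le_pow_right₀ h1 (by lia)) (abs_nonneg _)
    have eN : ∀ a : ℝ, a * a ^ (N - 1) = a ^ N := fun a => by
      rw [← pow_succ', Nat.sub_add_cancel (by lia)]
    rcases le_total |v| (η * |h|) with h3 | h3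
    · have : |v| * |h| ^ (N - 1) ≤ η * |h| ^ N := by
        calc _ ≤ η * |h| * |h| ^ (N - 1) := by gcongr
          _ = _ := by rw [mul_assoc, eN]
      nlinarith
    · have h4 : |h| ≤ η⁻¹ * |v| := by rwa [le_inv_mul_iff₀ hη]
      have : |v| * |h| ^ (N - 1) ≤ (η⁻¹) ^ (N - 1) * |v| ^ N := by
        calc _ ≤ |v| * (η⁻¹ * |v|) ^ (N - 1) := by gcongr
          _ = _ := by rw [mul_pow, ← eN |v|]; ring
      nlinarith

/-- The mass part of the pairing of `w` with `h^j`. -/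
theorem exists_mass_pairing_le {N j : ℕ} (hN : Even N) (hj : j < N) {δ : ℝ} (hδ : 0 < δ) :
    ∃ K : ℝ, 0 ≤ K ∧ ∀ (L : ℕ) [NeZero L] (v h : Field L) (s ζ S : ℝ), 0 ≤ S → 0 ≤ ζ →
      s ^ 2 ≤ 4 * √S → 0 < s →
      (s ^ 4)⁻¹ * ((1 / (L : ℝ)) ^ 2 * ∑ x, v x ^ (2 * N)) ≤ ζ →
      |(1 / (L : ℝ)) ^ 2 * ∑ x, h x ^ j * v x| ≤
        δ * ((1 / (L : ℝ)) ^ 2 * ∑ x, h x ^ N) + δ * S + K * (1 + ζ) := by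
  set K := 1 + (δ⁻¹) ^ (N - 1) with hK
  have K1 : 0 ≤ K := by positivity
  refine ⟨K + 4 * K ^ 2 * δ⁻¹, by positivity, fun L _ v h s ζ S hS hζ hs hs0 hU => ?_⟩
  have hN' : ∀ a : ℝ, |a| ^ N = a ^ N := fun a => hN.pow_abs a
  set U := (1 / (L : ℝ)) ^ 2 * ∑ x, v x ^ N with hUdef
  have U0 : 0 ≤ U := mul_nonneg (by positivity) (Finset.sum_nonneg fun x _ => hN.pow_nonneg _)
  have h1 : |(1 / (L : ℝ)) ^ 2 * ∑ x, h x ^ j * v x| ≤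
      δ * ((1 / (L : ℝ)) ^ 2 * ∑ x, h x ^ N) + K * (1 + U) := by
    rw [abs_mul, abs_of_nonneg (by positivity : 0 ≤ (1 / (L : ℝ)) ^ 2)]
    calc _ ≤ (1 / (L : ℝ)) ^ 2 * ∑ x, (δ * h x ^ N + K * (1 + v x ^ N)) := by
          gcongr
          refine (Finset.abs_sum_le_sum_abs _ _).trans (Finset.sum_le_sum fun x _ => ?_)
          have := abs_mul_abs_pow_le hδ hj (v x) (h x)
          rwa [hN', hN', mul_comm, ← abs_pow, ← abs_mul] at this
      _ = _ := by
          rw [Finset.sum_add_distrib, ← Finset.mul_sum, ← Finset.mul_sum, Finset.sum_add_distrib,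
            mul_add, mul_left_comm, mul_left_comm _ K, mul_add, sum_const_lattice]
  have h2 : U ^ 2 ≤ 16 * S * ζ := by
    have hcs : U ^ 2 ≤ (1 / (L : ℝ)) ^ 2 * ∑ x, v x ^ (2 * N) := by
      have := Finset.sum_mul_sq_le_sq_mul_sq Finset.univ (fun _ : Lattice L => (1 : ℝ))
        (fun x => v x ^ N)
      simp only [one_mul, one_pow] at this
      have h3 := sum_const_lattice (L := L) 1
      have e : ∀ x, (v x ^ N) ^ 2 = v x ^ (2 * N) := fun x => by rw [← pow_mul, mul_comm]
      simp only [e] at this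
      calc U ^ 2 = (1 / (L : ℝ)) ^ 4 * (∑ x, v x ^ N) ^ 2 := by rw [hUdef]; ring
        _ ≤ (1 / (L : ℝ)) ^ 4 * ((∑ _x : Lattice L, (1 : ℝ)) * ∑ x, v x ^ (2 * N)) := by gcongr
        _ = ((1 / (L : ℝ)) ^ 2 * ∑ _x : Lattice L, (1 : ℝ)) *
            ((1 / (L : ℝ)) ^ 2 * ∑ x, v x ^ (2 * N)) := by ring
        _ = _ := by rw [h3, one_mul]
    rw [inv_mul_le_iff₀ (by positivity)] at hU
    have hs4 : s ^ 4 ≤ 16 * S := by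
      calc s ^ 4 = (s ^ 2) ^ 2 := by ring
        _ ≤ (4 * √S) ^ 2 := by gcongr
        _ = 16 * S := by rw [mul_pow, Real.sq_sqrt hS]; norm_num
    exact hcs.trans (hU.trans (by gcongr))
  -- Young's inequality for `K U ≤ 4 K √(S ζ)`
  have h3 : K * U ≤ δ * S + 4 * K ^ 2 * δ⁻¹ * ζ := by
    refine le_of_sq_le_sq ?_ (by positivity)
    have e : (δ * S) * (4 * K ^ 2 * δ⁻¹ * ζ) = 4 * K ^ 2 * S * ζ := by field_simp
    calc (K * U) ^ 2 = K ^ 2 * U ^ 2 := by ring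
      _ ≤ K ^ 2 * (16 * S * ζ) := by gcongr
      _ = 4 * ((δ * S) * (4 * K ^ 2 * δ⁻¹ * ζ)) := by rw [e]; ring
      _ ≤ _ := by nlinarith [sq_nonneg (δ * S - 4 * K ^ 2 * δ⁻¹ * ζ)]
  have : 0 ≤ K * ζ := by positivity
  have : 0 ≤ 4 * K ^ 2 * δ⁻¹ := by positivity
  linarith

/-- The gradient part of the pairing of `w` with `h^j`. -/
theorem exists_gradient_pairing_le (hm : 0 < m ^ 2) (j : ℕ) {δ : ℝ} (hδ : 0 < δ) :
    ∃ K : ℝ, 0 ≤ K ∧ ∀ (L : ℕ) [NeZero L] (v h : Field L) (t ζ : ℝ), 0 ≤ t →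
      t * dirichlet L m h ^ (2 * (j - 1)) ≤ 1 → 0 ≤ ζ →
      t ^ 3 * ((1 / (L : ℝ)) ^ 2 * ∑ x, ∑ i, ((L : ℝ) * fwd i v x) ^ 4) ≤ ζ →
      |t * ∑ x, ∑ i, fwd i (fun y => h y ^ j) x * fwd i v x| ≤
        δ * dirichlet L m h + K * (1 + ζ) := by
  rcases Nat.eq_zero_or_pos j with rfl | hj
  · refine ⟨0, le_rfl, fun L _ v h t ζ _ _ _ _ => ?_⟩
    have : 0 ≤ δ * dirichlet L m h := mul_nonneg hδ.le (dirichlet_nonneg m h)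
    simpa [fwd] using this
  obtain ⟨k, rfl⟩ : ∃ k, j = k + 1 := ⟨j - 1, by lia⟩
  simp only [Nat.add_sub_cancel]
  set Cs := sobolevConst m (2 * k) with hCs
  have Cs0 : 0 ≤ Cs := sobolevConst_nonneg _ _
  refine ⟨((k : ℝ) + 1) ^ 2 / (8 * δ) * (1 + 32 * Cs), by positivity,
    fun L _ v h t ζ ht hS hζ hV => ?_⟩
  have hL := natCast_L_pos (L := L)
  set e : ℝ := 1 / (L : ℝ) with he
  have e0 : 0 < e := by positivity
  have eL : e * L = 1 := by rw [he]; field_simp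
  set D := dirichlet L m h with hD
  have hgrad : ∑ x, ∑ i, fwd i h x ^ 2 ≤ D := by
    rw [hD, dirichlet]
    exact le_add_of_nonneg_left (by positivity)
  have hpt : ∀ x i, t * |fwd i (fun y => h y ^ (k + 1)) x * fwd i v x| ≤
      δ * fwd i h x ^ 2 + ((k : ℝ) + 1) ^ 2 / (8 * δ) * (t ^ 3 * (e ^ 2 * (L * fwd i v x) ^ 4) +
        t * (e ^ 2 * (8 * (h (x + Pi.single i 1) ^ (2 * (2 * k)) + h x ^ (2 * (2 * k)))))) := by
    intro x i
    set b := |fwd i h x| with hb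
    set a := L * |fwd i v x| with ha
    set p := |h (x + Pi.single i 1)| ^ k with hp
    set r := |h x| ^ k with hr
    have hp4 : h (x + Pi.single i 1) ^ (2 * (2 * k)) = p ^ 4 := by
      rw [hp, ← pow_mul, pow_mul (h _), ← sq_abs, ← pow_mul]; congr 1; ring
    have hr4 : h x ^ (2 * (2 * k)) = r ^ 4 := by
      rw [hr, ← pow_mul, pow_mul (h _), ← sq_abs, ← pow_mul]; congr 1; ring
    have ha4 : (L * fwd i v x) ^ 4 = a ^ 4 := by
      rw [ha, mul_pow, mul_pow]
      congr 1
      exact ((show Even 4 by decide).pow_abs _).symm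
    have hva : |fwd i v x| = e * a := by rw [ha, ← mul_assoc, eL, one_mul]
    have hb2 : fwd i h x ^ 2 = b ^ 2 := (sq_abs _).symm
    rw [hp4, hr4, ha4, hb2, abs_mul, hva]
    have h1 : t * (|fwd i (fun y => h y ^ (k + 1)) x| * (e * a)) ≤
        b * ((k + 1) * t * (e * a) * (p + r)) := by
      calc _ ≤ t * ((k + 1) * (b * (p + r)) * (e * a)) := by
            gcongr
            exact abs_fwd_pow_le h k i x
        _ = _ := by ring
    have h2 : ∀ u : ℝ, b * u ≤ δ * b ^ 2 + u ^ 2 / (4 * δ) := by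
      intro u
      have : 0 ≤ (2 * δ * b - u) ^ 2 / (4 * δ) := by positivity
      have e2 : (2 * δ * b - u) ^ 2 / (4 * δ) = δ * b ^ 2 - b * u + u ^ 2 / (4 * δ) := by
        field_simp
        ring
      linarith
    refine h1.trans ((h2 _).trans ?_)
    -- `t² a² c² ≤ (t³ a⁴ + t c⁴) / 2` for `c = p + r`, and `c⁴ ≤ 8 (p⁴ + r⁴)`
    have h3 : t ^ 2 * a ^ 2 * (p + r) ^ 2 ≤ (t ^ 3 * a ^ 4 + t * (8 * (p ^ 4 + r ^ 4))) / 2 := by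
      have h4 : (p + r) ^ 4 ≤ 8 * (p ^ 4 + r ^ 4) := by
        have := add_pow_le (by positivity : 0 ≤ p) (by positivity : 0 ≤ r) 4
        norm_num at this
        exact this
      have h5 : 0 ≤ t * (t * a ^ 2 - (p + r) ^ 2) ^ 2 := by positivity
      have h6 : t * (p + r) ^ 4 ≤ t * (8 * (p ^ 4 + r ^ 4)) := by gcongr
      nlinarith
    have e3 : ((k + 1) * t * (e * a) * (p + r)) ^ 2 / (4 * δ) =
        ((k : ℝ) + 1) ^ 2 / (4 * δ) * e ^ 2 * (t ^ 2 * a ^ 2 * (p + r) ^ 2) := by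
      field_simp
    have e4 : ((k : ℝ) + 1) ^ 2 / (8 * δ) * (t ^ 3 * (e ^ 2 * a ^ 4) +
        t * (e ^ 2 * (8 * (p ^ 4 + r ^ 4)))) = ((k : ℝ) + 1) ^ 2 / (4 * δ) * e ^ 2 *
        ((t ^ 3 * a ^ 4 + t * (8 * (p ^ 4 + r ^ 4))) / 2) := by
      field_simp
      ring
    rw [e3, e4]
    gcongr
  have hsob := sobolev hm (2 * k) h
  have hshift : ∑ x, ∑ i : Fin 2, (8 * (h (x + Pi.single i 1) ^ (2 * (2 * k)) +
      h x ^ (2 * (2 * k)))) = 32 * ∑ x, h x ^ (2 * (2 * k)) := by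
    rw [Finset.sum_comm]
    simp only [← Finset.mul_sum, Finset.sum_add_distrib]
    simp only [sum_shift (fun y => h y ^ (2 * (2 * k)))]
    simp
    ring
  calc |t * ∑ x, ∑ i, fwd i (fun y => h y ^ (k + 1)) x * fwd i v x| ≤
        ∑ x, ∑ i, t * |fwd i (fun y => h y ^ (k + 1)) x * fwd i v x| := by
        rw [abs_mul, abs_of_nonneg ht]
        simp only [← Finset.mul_sum]
        gcongr
        exact (Finset.abs_sum_le_sum_abs _ _).trans
          (Finset.sum_le_sum fun x _ => Finset.abs_sum_le_sum_abs _ _)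
    _ ≤ ∑ x, ∑ i, (δ * fwd i h x ^ 2 + ((k : ℝ) + 1) ^ 2 / (8 * δ) *
        (t ^ 3 * (e ^ 2 * (L * fwd i v x) ^ 4) +
        t * (e ^ 2 * (8 * (h (x + Pi.single i 1) ^ (2 * (2 * k)) + h x ^ (2 * (2 * k))))))) :=
        Finset.sum_le_sum fun x _ => Finset.sum_le_sum fun i _ => hpt x i
    _ = δ * (∑ x, ∑ i, fwd i h x ^ 2) + ((k : ℝ) + 1) ^ 2 / (8 * δ) *
        (t ^ 3 * (e ^ 2 * ∑ x, ∑ i, (L * fwd i v x) ^ 4) +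
          t * (e ^ 2 * (32 * ∑ x, h x ^ (2 * (2 * k))))) := by
        rw [← hshift]
        simp only [Finset.sum_add_distrib, ← Finset.mul_sum]
    _ ≤ δ * D + ((k : ℝ) + 1) ^ 2 / (8 * δ) * (ζ + 32 * Cs) := by
        have h7 : t * (e ^ 2 * (32 * ∑ x, h x ^ (2 * (2 * k)))) ≤ 32 * Cs := by
          calc t * (e ^ 2 * (32 * ∑ x, h x ^ (2 * (2 * k)))) =
                32 * (t * (e ^ 2 * ∑ x, h x ^ (2 * (2 * k)))) := by ring
            _ ≤ 32 * (t * (Cs * D ^ (2 * k))) := by gcongr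
            _ = 32 * (Cs * (t * D ^ (2 * k))) := by ring
            _ ≤ 32 * (Cs * 1) := by gcongr
            _ = 32 * Cs := by ring
        exact add_le_add (mul_le_mul_of_nonneg_left hgrad hδ.le)
          (mul_le_mul_of_nonneg_left (add_le_add hV h7) (by positivity))
    _ ≤ _ := by
        have : 0 ≤ ((k : ℝ) + 1) ^ 2 / (8 * δ) := by positivity
        have h2 : ζ + 32 * Cs ≤ (1 + 32 * Cs) * (1 + ζ) := by nlinarith [mul_nonneg Cs0 hζ]
        rw [mul_assoc]
        gcongr

/-- The pairing of a distribution with a power `h^j`, `j < N`, is controlled by the `L^N` and `H¹`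
norms of `h`. The scale `t` of the regularisation is a negative power of these norms: then the
gradient part, of order `t` times a power of them, is bounded, whereas the variance of the
regularised noise grows only by a small power of `1 / t`. -/
theorem exists_pairing_le (hm : 0 < m ^ 2) {N j : ℕ} (hN : Even N) (hj : j < N) {δ : ℝ}
    (hδ : 0 < δ) :
    ∃ K : ℝ, 0 ≤ K ∧ ∀ (L : ℕ) [NeZero L] (w h : Field L) (ζ : ℝ), 0 ≤ ζ →
      (∀ i, noiseTerm L m N w i ≤ ζ) →
      |(1 / (L : ℝ)) ^ 2 * ∑ x, w x * h x ^ j| ≤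
        δ * ((1 / (L : ℝ)) ^ 2 * ∑ x, h x ^ N + dirichlet L m h) + K * (1 + ζ) := by
  have m1 : 0 < m ^ 2 + 1 := by positivity
  set δ₁ := δ / (4 * (m ^ 2 + 1)) with hδ₁
  have hδ₁0 : 0 < δ₁ := by positivity
  obtain ⟨K₁, hK₁, H₁⟩ := exists_mass_pairing_le hN hj hδ₁0
  obtain ⟨K₂, hK₂, H₂⟩ := exists_gradient_pairing_le hm j (half_pos hδ)
  refine ⟨δ + (m ^ 2 + 1) * K₁ + K₂, by positivity, fun L _ w h ζ hζ hw => ?_⟩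
  set H := (1 / (L : ℝ)) ^ 2 * ∑ x, h x ^ N with hH
  set D := dirichlet L m h with hD
  have H0 : 0 ≤ H := mul_nonneg (by positivity) (Finset.sum_nonneg fun x _ => hN.pow_nonneg _)
  have D0 : 0 ≤ D := dirichlet_nonneg m h
  set S := 1 + H + D with hS
  have S0 : 0 ≤ S := by positivity
  -- the scale `i` is chosen such that `S ≤ (i + 1)⁴ ≤ 16 S`
  set r := √√S with hr
  have r1 : 1 ≤ r := by
    rw [hr]; simp only [Real.one_le_sqrt]; linarith
  have r4 : r ^ 4 = S := by
    calc r ^ 4 = (r ^ 2) ^ 2 := by ring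
      _ = S := by rw [hr, Real.sq_sqrt (Real.sqrt_nonneg _), Real.sq_sqrt S0]
  have r2 : r ^ 2 = √S := Real.sq_sqrt (Real.sqrt_nonneg _)
  set i := ⌊r⌋₊ with hi
  set s : ℝ := (i : ℝ) + 1 with hs
  have rs : r ≤ s := (Nat.lt_floor_add_one r).le
  have sr : s ≤ 2 * r := by
    have := Nat.floor_le (by linarith : 0 ≤ r)
    rw [hs, hi]; linarith
  have s1 : 1 ≤ s := r1.trans rs
  have s0 : 0 < s := by linarith
  set v := (q L m (scale N i)).mulVec w with hv
  have hterm := hw i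
  have hl := noiseTerm_left_nonneg m N w i
  have hr' := noiseTerm_right_nonneg m N w i
  rw [noiseTerm] at hterm
  have b₁ := H₁ L v h s ζ S S0 hζ (by rw [← r2]; nlinarith) s0 (by linarith)
  have b₂ := H₂ L v h (scale N i) ζ (scale_pos N i).le (by
    rw [scale_coe, inv_mul_le_iff₀ (by positivity), mul_one]
    calc D ^ (2 * (j - 1)) ≤ (s ^ 4) ^ (2 * (j - 1)) := by
          gcongr
          calc D ≤ S := by linarith
            _ = r ^ 4 := r4.symm
            _ ≤ s ^ 4 := by gcongr
      _ = s ^ (8 * (j - 1)) := by rw [← pow_mul]; congr 1; ring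
      _ ≤ s ^ (8 * N) := pow_le_pow_right₀ s1 (by lia)) hζ (by linarith)
  rw [sum_mul_eq_mollified hm (scale N i) w]
  have t1 : (scale N i : ℝ) * m ^ 2 + 1 ≤ m ^ 2 + 1 := by
    have := mul_le_mul_of_nonneg_right (scale_le_one N i) hm.le
    linarith
  have t0 : 0 ≤ (scale N i : ℝ) * m ^ 2 + 1 := by positivity
  refine (abs_add_le _ _).trans ?_
  rw [abs_mul, abs_of_nonneg t0]
  have c₁ : ((scale N i : ℝ) * m ^ 2 + 1) * |(1 / (L : ℝ)) ^ 2 * ∑ x, h x ^ j * v x| ≤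
      (m ^ 2 + 1) * (δ₁ * H + δ₁ * S + K₁ * (1 + ζ)) :=
    mul_le_mul t1 b₁ (abs_nonneg _) m1.le
  have e₁ : (m ^ 2 + 1) * (δ₁ * H + δ₁ * S + K₁ * (1 + ζ)) =
      δ / 4 * (H + S) + (m ^ 2 + 1) * K₁ * (1 + ζ) := by
    rw [hδ₁]; field_simp
  refine (add_le_add c₁ b₂).trans ?_
  rw [e₁, hS]
  nlinarith [mul_nonneg hδ.le H0, mul_nonneg hδ.le D0, mul_nonneg hδ.le hζ]

end pathwise

section hamiltonian

variable {L : ℕ} [NeZero L] {m : ℝ}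

/-- Expansion of the Hamiltonian at a shifted field. -/
theorem hamiltonian_add (hm : 0 < m ^ 2) {P : Polynomial ℝ} (hdeg : 0 < P.natDegree)
    (φ h : Field L) :
    hamiltonian L m P (φ + h) =
      P.leadingCoeff * ((1 / (L : ℝ)) ^ 2 * ∑ x, h x ^ P.natDegree) +
        ∑ k ∈ Finset.Icc 1 P.natDegree, ∑ j ∈ Finset.range P.natDegree,
          P.coeff k * k.choose j *
            ((1 / (L : ℝ)) ^ 2 * ∑ x, wickPow L m (k - j) φ x * h x ^ j) := by
  set N := P.natDegree with hN
  have hx : ∀ x, ∑ k ∈ Finset.Icc 1 N, P.coeff k * wickPow L m k (φ + h) x =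
      P.leadingCoeff * h x ^ N + ∑ k ∈ Finset.Icc 1 N, ∑ j ∈ Finset.range N,
        P.coeff k * k.choose j * (wickPow L m (k - j) φ x * h x ^ j) := by
    intro x
    have hk : ∀ k ∈ Finset.Icc 1 N, P.coeff k * wickPow L m k (φ + h) x =
        ∑ j ∈ Finset.range N, P.coeff k * k.choose j * (wickPow L m (k - j) φ x * h x ^ j) +
          if k = N then P.leadingCoeff * h x ^ N else 0 := by
      intro k hk
      have hkN := (Finset.mem_Icc.1 hk).2
      have h1 : wickPow L m k (φ + h) x =
          ∑ j ∈ Finset.range (N + 1), k.choose j * wickPow L m (k - j) φ x * h x ^ j := by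
        simp only [wickPow_eq hm, Pi.add_apply]
        rw [wick_add]
        refine Finset.sum_subset (Finset.range_mono (by lia)) fun j _ hj => ?_
        rw [Nat.choose_eq_zero_of_lt (by simpa using hj)]
        simp
      rw [h1, Finset.sum_range_succ, mul_add, Finset.mul_sum]
      congr 1
      · exact Finset.sum_congr rfl fun j _ => by ring
      · split_ifs with h2
        · rw [h2, Nat.choose_self, Nat.sub_self, wickPow_eq hm, wick, hN, Polynomial.leadingCoeff]
          simp
        · rw [Nat.choose_eq_zero_of_lt (lt_of_le_of_ne hkN h2)]
          simp
    rw [Finset.sum_congr rfl hk, Finset.sum_add_distrib, Finset.sum_ite_eq',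
      if_pos (Finset.mem_Icc.2 ⟨hdeg, le_rfl⟩), add_comm]
  rw [hamiltonian, ← hN, Finset.sum_congr rfl fun x _ => hx x, Finset.sum_add_distrib, mul_add,
    ← Finset.mul_sum]
  congr 1
  · ring
  · rw [Finset.sum_comm, Finset.mul_sum]
    refine Finset.sum_congr rfl fun k _ => ?_
    rw [Finset.sum_comm, Finset.mul_sum]
    refine Finset.sum_congr rfl fun j _ => ?_
    rw [← Finset.mul_sum]
    ring

/-- The key estimate: uniformly in the mesh size, the negative part of the Hamiltonian at a
shifted field is bounded by a small multiple of the Cameron-Martin norm of the shift and a random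
variable of bounded expectation. -/
theorem exists_neg_hamiltonian_add_le (hm : 0 < m ^ 2) {P : Polynomial ℝ}
    (hdeg : 0 < P.natDegree) (heven : Even P.natDegree) (hlead : 0 < P.leadingCoeff)
    {p : ℝ} (hp : 0 < p) :
    ∃ C : ℝ≥0, ∀ (L : ℕ) [NeZero L], ∃ Z : Field L → ℝ≥0∞, Measurable Z ∧
      ∫⁻ φ, Z φ ∂gff L m ≤ C ∧ ∀ φ h : Field L,
        ENNReal.ofReal (-(p * hamiltonian L m P (φ + h))) ≤
          Z φ + ENNReal.ofReal (dirichlet L m h / 4) := by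
  set N := P.natDegree with hN
  have hN2 : 2 ≤ N := by
    obtain ⟨k, hk⟩ := heven
    lia
  set A := ∑ k ∈ Finset.Icc 1 N, ∑ j ∈ Finset.range N, |P.coeff k * k.choose j| with hA
  have A0 : 0 ≤ A := Finset.sum_nonneg fun k _ => Finset.sum_nonneg fun j _ => abs_nonneg _
  set δ := min (p * P.leadingCoeff) (1 / 4) / (p * (A + 1)) with hδ
  have hmin : 0 < min (p * P.leadingCoeff) (1 / 4) := lt_min (by positivity) (by norm_num)
  have hδ0 : 0 < δ := by positivity
  have hδA : p * A * δ ≤ min (p * P.leadingCoeff) (1 / 4) := by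
    rw [hδ, mul_div_assoc', div_le_iff₀ (by positivity)]
    nlinarith [mul_pos hp hmin]
  have hex : ∀ j, ∃ K : ℝ, 0 ≤ K ∧ (j < N → ∀ (L : ℕ) [NeZero L] (w h : Field L) (ζ : ℝ), 0 ≤ ζ →
      (∀ i, noiseTerm L m N w i ≤ ζ) →
      |(1 / (L : ℝ)) ^ 2 * ∑ x, w x * h x ^ j| ≤
        δ * ((1 / (L : ℝ)) ^ 2 * ∑ x, h x ^ N + dirichlet L m h) + K * (1 + ζ)) := by
    intro j
    by_cases hj : j < N
    · obtain ⟨K, hK, H⟩ := exists_pairing_le hm heven hj hδ0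
      exact ⟨K, hK, fun _ => H⟩
    · exact ⟨0, le_rfl, fun h => absurd h hj⟩
  choose K hK hpair using hex
  choose c hc using exists_lintegral_noise_le hm hN2
  set M := p * ∑ k ∈ Finset.Icc 1 N, ∑ j ∈ Finset.range N, |P.coeff k * k.choose j| * K j with hM
  have M0 : 0 ≤ M := mul_nonneg hp.le (Finset.sum_nonneg fun k _ => Finset.sum_nonneg fun j _ =>
    mul_nonneg (abs_nonneg _) (hK j))
  refine ⟨(M + 1).toNNReal * (1 + ∑ n ∈ Finset.range (N + 1), c n), fun L _ => ?_⟩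
  set Y : Field L → ℝ≥0∞ := fun φ =>
    ∑ n ∈ Finset.range (N + 1), noise L m N (wickPow L m n φ) with hY
  have hYm : Measurable Y := Finset.measurable_sum _ fun n _ => measurable_noise hm N n
  refine ⟨fun φ => ENNReal.ofReal (M + 1) * (1 + Y φ), (hYm.const_add 1).const_mul _, ?_, ?_⟩
  · have : IsProbabilityMeasure (gff L m) := isProbabilityMeasure_gff
    rw [lintegral_const_mul _ (hYm.const_add 1), lintegral_add_left measurable_const,
      lintegral_const, measure_univ, hY, lintegral_finsetSum _ fun n _ => measurable_noise hm N n]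
    push_cast
    rw [ENNReal.ofReal]
    gcongr with n
    · simp
    · exact hc n L
  · intro φ h
    by_cases hfin : Y φ = ∞
    · have : ENNReal.ofReal (M + 1) * (1 + Y φ) = ∞ := by
        rw [hfin, add_top, ENNReal.mul_top (by simp; linarith)]
      beta_reduce
      rw [this, top_add]
      exact le_top
    set ζ := (Y φ).toReal with hζ
    have ζ0 : 0 ≤ ζ := ENNReal.toReal_nonneg
    have hterm : ∀ n ≤ N, ∀ i, noiseTerm L m N (wickPow L m n φ) i ≤ ζ := by
      intro n hn i
      rw [hζ, ← ENNReal.ofReal_le_iff_le_toReal hfin]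
      have hle : ENNReal.ofReal (noiseTerm L m N (wickPow L m n φ) i) ≤
          noise L m N (wickPow L m n φ) :=
        ENNReal.le_tsum (f := fun i => ENNReal.ofReal (noiseTerm L m N (wickPow L m n φ) i)) i
      refine hle.trans ?_
      exact Finset.single_le_sum (f := fun n => noise L m N (wickPow L m n φ))
        (fun _ _ => zero_le) (Finset.mem_range.2 (by lia))
    set H := (1 / (L : ℝ)) ^ 2 * ∑ x, h x ^ N with hH
    set D := dirichlet L m h with hD
    have H0 : 0 ≤ H :=
      mul_nonneg (by positivity) (Finset.sum_nonneg fun x _ => heven.pow_nonneg _)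
    have D0 : 0 ≤ D := dirichlet_nonneg m h
    have hexp := hamiltonian_add hm hdeg φ h
    rw [← hN, ← hH] at hexp
    have hbd : -(A * (δ * (H + D)) + (∑ k ∈ Finset.Icc 1 N, ∑ j ∈ Finset.range N,
        |P.coeff k * k.choose j| * K j) * (1 + ζ)) ≤
        ∑ k ∈ Finset.Icc 1 N, ∑ j ∈ Finset.range N, P.coeff k * k.choose j *
          ((1 / (L : ℝ)) ^ 2 * ∑ x, wickPow L m (k - j) φ x * h x ^ j) := by
      rw [hA]
      simp only [Finset.sum_mul]
      rw [← Finset.sum_add_distrib, ← Finset.sum_neg_distrib]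
      refine Finset.sum_le_sum fun k hk => ?_
      rw [← Finset.sum_add_distrib, ← Finset.sum_neg_distrib]
      refine Finset.sum_le_sum fun j hj => ?_
      have hkN := (Finset.mem_Icc.1 hk).2
      have h1 := hpair j (Finset.mem_range.1 hj) L (wickPow L m (k - j) φ) h ζ ζ0
        (hterm (k - j) (by lia))
      have h2 := mul_le_mul_of_nonneg_left h1 (abs_nonneg (P.coeff k * (k.choose j : ℝ)))
      rw [← abs_mul] at h2
      have h3 := neg_abs_le (P.coeff k * k.choose j *
        ((1 / (L : ℝ)) ^ 2 * ∑ x, wickPow L m (k - j) φ x * h x ^ j))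
      linarith
    have hfinal : -(p * hamiltonian L m P (φ + h)) ≤ D / 4 + (M + 1) * (1 + ζ) := by
      rw [hexp]
      have h4 := mul_le_mul_of_nonneg_left hbd hp.le
      have h5 : p * A * δ * H ≤ p * P.leadingCoeff * H :=
        mul_le_mul_of_nonneg_right (hδA.trans (min_le_left _ _)) H0
      have h6 : p * A * δ * D ≤ 1 / 4 * D :=
        mul_le_mul_of_nonneg_right (hδA.trans (min_le_right _ _)) D0
      rw [hM]
      linarith
    calc _ ≤ ENNReal.ofReal (D / 4 + (M + 1) * (1 + ζ)) := ENNReal.ofReal_le_ofReal hfinal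
      _ = _ := by
        rw [add_comm, ENNReal.ofReal_add (by positivity) (by positivity),
          ENNReal.ofReal_mul (by positivity), ENNReal.ofReal_add zero_le_one ζ0, hζ,
          ENNReal.ofReal_toReal hfin, ENNReal.ofReal_one]

theorem continuous_hamiltonian (hm : 0 < m ^ 2) (P : Polynomial ℝ) :
    Continuous (hamiltonian L m P) :=
  continuous_const.mul (continuous_finsetSum _ fun x _ => continuous_finsetSum _ fun k _ =>
    continuous_const.mul (continuous_wickPow hm k x))

theorem integral_hamiltonian (hm : 0 < m ^ 2) (P : Polynomial ℝ) :
    Integrable (hamiltonian L m P) (gff L m) ∧ ∫ φ, hamiltonian L m P φ ∂gff L m = 0 := by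
  have hk : ∀ x, ∀ k ∈ Finset.Icc 1 P.natDegree,
      Integrable (fun φ => P.coeff k * wickPow L m k φ x) (gff L m) := fun x k hk =>
    ((integral_wickPow hm (Nat.one_le_iff_ne_zero.1 (Finset.mem_Icc.1 hk).1) x).1).const_mul _
  refine ⟨(integrable_finsetSum _ fun x _ => integrable_finsetSum _ fun k h =>
    hk x k h).const_mul _, ?_⟩
  simp only [hamiltonian]
  rw [integral_const_mul, integral_finsetSum _ fun x _ => integrable_finsetSum _ fun k h => hk x k h,
    Finset.sum_eq_zero, mul_zero]
  intro x _
  rw [integral_finsetSum _ fun k h => hk x k h]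
  refine Finset.sum_eq_zero fun k h => ?_
  rw [integral_const_mul, (integral_wickPow hm (Nat.one_le_iff_ne_zero.1 (Finset.mem_Icc.1 h).1) x).2, mul_zero]

/-! ### Exponential integrability -/

/-- In the coordinates `φ = B ξ` the Cameron-Martin norm is the Euclidean norm. -/
theorem dirichlet_mulVec_sqrt (hm : 0 < m ^ 2) {B : Matrix (Lattice L) (Lattice L) ℝ}
    (hs : B.IsSymm) (hB : B * B = gffCovariance L m) (ξ : Field L) :
    dirichlet L m (B.mulVec ξ) = ∑ x, ξ x ^ 2 := by
  have hL := (natCast_L_pos (L := L)).ne'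
  set A := (1 / (L : ℝ)) ^ 2 • massiveLaplacian L m with hA
  have h1 : A * (B * B) = 1 := by
    rw [hB, gffCovariance, hA, Matrix.smul_mul, Matrix.mul_smul, massiveLaplacian_eq,
      ellipticOp_mul_inv zero_le_one hm, smul_smul]
    have : (1 / (L : ℝ)) ^ 2 * (L : ℝ) ^ 2 = 1 := by field_simp
    rw [this, one_smul]
  have h2 : B * (A * B) = 1 := by
    rw [← Matrix.mul_assoc] at h1
    exact mul_eq_one_comm.1 h1
  have h3 : dirichlet L m (B.mulVec ξ) = B.mulVec ξ ⬝ᵥ A.mulVec (B.mulVec ξ) := by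
    rw [dirichlet_eq, hA, Matrix.smul_mulVec, dotProduct_smul, smul_eq_mul]
  rw [h3, Matrix.mulVec_mulVec, dotProduct_comm, Matrix.dotProduct_mulVec, ← Matrix.mulVec_transpose,
    hs, Matrix.mulVec_mulVec, h2, Matrix.one_mulVec, dotProduct]
  exact Finset.sum_congr rfl fun x _ => (sq _).symm

/-- Exponential integrability of the negative part of the Hamiltonian, uniformly in the mesh size.
By the property `(τ)` it suffices to bound the infimum convolution of the Hamiltonian with the
Cameron-Martin norm from below on a set of probability at least `1 / 2`. -/
theorem exists_lintegral_exp_neg_le (hm : 0 < m ^ 2) {P : Polynomial ℝ}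
    (hdeg : 0 < P.natDegree) (heven : Even P.natDegree) (hlead : 0 < P.leadingCoeff)
    {p : ℝ} (hp : 0 < p) :
    ∃ C : ℝ≥0, 1 ≤ C ∧ ∀ (L : ℕ) [NeZero L] (V : Field L → ℝ), Measurable V →
      (∀ φ, min (hamiltonian L m P φ) 0 ≤ V φ) →
      ∫⁻ φ, ENNReal.ofReal (Real.exp (-(p * V φ))) ∂gff L m ≤ C := by
  obtain ⟨C, hC⟩ := exists_neg_hamiltonian_add_le hm hdeg heven hlead hp
  set b : ℝ := 2 * (C + 1) with hb
  have b0 : 0 < b := by positivity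
  refine ⟨(2 * Real.exp b).toNNReal, ?_, fun L _ V hV hVle => ?_⟩
  · rw [Real.one_le_toNNReal]
    have := Real.add_one_le_exp b
    linarith
  obtain ⟨Z, hZm, hZi, hZ⟩ := hC L
  obtain ⟨B, hs, hB, hgff⟩ := exists_gff_eq_map (L := L) hm
  have hBm : Measurable B.mulVec := by fun_prop
  set γ : Measure (Field L) := Measure.pi fun _ => gaussianReal 0 1 with hγ
  set s : Set (Field L) := {ξ | Z (B.mulVec ξ) < ENNReal.ofReal b} with hsdef
  have hsm : MeasurableSet s := measurableSet_lt (hZm.comp hBm) measurable_const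
  have hfm : Measurable fun ξ => ENNReal.ofReal (Real.exp (-(p * V (B.mulVec ξ)))) :=
    ENNReal.measurable_ofReal.comp (Real.measurable_exp.comp ((hV.comp hBm).const_mul p).neg)
  have key := gaussian_tau hfm
    (g := s.indicator fun _ => ENNReal.ofReal (Real.exp (-b))) (measurable_const.indicator hsm) (by
      intro x y
      by_cases hx : x ∈ s
      · rw [Set.indicator_of_mem hx, ← ENNReal.ofReal_mul (by positivity), ← Real.exp_add]
        refine ENNReal.ofReal_le_ofReal (Real.exp_le_exp.2 ?_)
        have h1 := hZ (B.mulVec x) (B.mulVec (y - x))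
        rw [← Matrix.mulVec_add, add_sub_cancel, dirichlet_mulVec_sqrt hm hs hB] at h1
        have h2 : ∑ i, (y - x) i ^ 2 = ∑ i, (x i - y i) ^ 2 :=
          Finset.sum_congr rfl fun i _ => by rw [Pi.sub_apply]; ring
        rw [h2] at h1
        have hsq : 0 ≤ ∑ i, (x i - y i) ^ 2 := Finset.sum_nonneg fun i _ => sq_nonneg _
        have h3 : -(p * hamiltonian L m P (B.mulVec y)) ≤ b + (∑ i, (x i - y i) ^ 2) / 4 := by
          have h4 := h1.trans (add_le_add_left (le_of_lt hx) _)
          rw [← ENNReal.ofReal_add b0.le (by positivity)] at h4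
          exact (ENNReal.ofReal_le_ofReal_iff (by positivity)).1 h4
        have h5 : min (p * hamiltonian L m P (B.mulVec y)) 0 ≤ p * V (B.mulVec y) := by
          have := mul_le_mul_of_nonneg_left (hVle (B.mulVec y)) hp.le
          rwa [mul_min_of_nonneg _ _ hp.le, mul_zero] at this
        rcases min_le_iff.1 h5 with h6 | h6
        · linarith
        · have : 0 ≤ (∑ i, (x i - y i) ^ 2) / 4 := by positivity
          linarith
      · rw [Set.indicator_of_notMem hx, zero_mul]
        exact zero_le)
  rw [lintegral_indicator_const hsm] at key
  have hγp : IsProbabilityMeasure γ := by rw [hγ]; infer_instance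
  have hhalf : (1 / 2 : ℝ≥0∞) ≤ γ s := by
    have hcompl : γ sᶜ ≤ 1 / 2 := by
      have e : sᶜ = {ξ | ENNReal.ofReal b ≤ Z (B.mulVec ξ)} := by
        ext ξ; simp [hsdef]
      rw [e]
      refine (meas_ge_le_lintegral_div (hZm.comp hBm).aemeasurable (by simpa using b0)
        ENNReal.ofReal_ne_top).trans ?_
      have h1 : ∫⁻ ξ, Z (B.mulVec ξ) ∂γ ≤ C := by
        rw [hgff, lintegral_map hZm hBm] at hZi
        exact hZi
      have h2 : ENNReal.ofReal b = 2 * ((C : ℝ≥0∞) + 1) := by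
        rw [hb, ENNReal.ofReal_mul (by norm_num), ENNReal.ofReal_add C.coe_nonneg zero_le_one]
        simp
      rw [h2]
      refine ENNReal.div_le_of_le_mul ?_
      refine h1.trans ?_
      rw [one_div, ← mul_assoc, ENNReal.inv_mul_cancel (by simp) (by simp), one_mul]
      exact le_self_add
    have h3 := prob_compl_eq_one_sub hsm.compl (μ := γ)
    rw [compl_compl] at h3
    rw [h3]
    calc (1 / 2 : ℝ≥0∞) = 1 - 1 / 2 := by simp [ENNReal.one_sub_inv_two]
      _ ≤ _ := tsub_le_tsub_left hcompl 1
  rw [hgff, lintegral_map (by fun_prop) hBm]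
  have h4 : ENNReal.ofReal (Real.exp (-b)) * (1 / 2) *
      ∫⁻ ξ, ENNReal.ofReal (Real.exp (-(p * V (B.mulVec ξ)))) ∂γ ≤ 1 :=
    le_trans (by gcongr) key
  have h5 := mul_le_mul_right h4 (ENNReal.ofReal (2 * Real.exp b))
  rw [mul_one, ← mul_assoc] at h5
  have h6 : ENNReal.ofReal (2 * Real.exp b) * (ENNReal.ofReal (Real.exp (-b)) * (1 / 2)) = 1 := by
    have : (1 / 2 : ℝ≥0∞) = ENNReal.ofReal (1 / 2) := by
      rw [ENNReal.ofReal_div_of_pos (by norm_num)]; simp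
    rw [this, ← ENNReal.ofReal_mul (by positivity), ← ENNReal.ofReal_mul (by positivity),
      Real.exp_neg]
    rw [← ENNReal.ofReal_one]
    congr 1
    field_simp
  rw [h6, one_mul] at h5
  exact h5

/-- The normalised density has a smaller norm than the unnormalised one: `V` lies below `v₀`, which
has mean zero, so that `∫ exp (-V) ≥ 1`. -/
theorem exists_densityBound (hm : 0 < m ^ 2) {P : Polynomial ℝ}
    (hdeg : 0 < P.natDegree) (heven : Even P.natDegree) (hlead : 0 < P.leadingCoeff)
    {p : ℝ≥0∞} (hp : 1 ≤ p) (hp' : p ≠ ∞) :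
    ∃ C : ℝ≥0, ∀ (L : ℕ) [NeZero L] (V : Field L → ℝ), Measurable V →
      (∀ φ, min (hamiltonian L m P φ) 0 ≤ V φ) → (∀ φ, V φ ≤ hamiltonian L m P φ) →
      DensityBound L m V p C := by
  have p0 : p ≠ 0 := (zero_lt_one.trans_le hp).ne'
  have hpr : 1 ≤ p.toReal := by
    rw [← ENNReal.toReal_one]; exact ENNReal.toReal_mono hp' hp
  have hpr0 : 0 < p.toReal := by linarith
  obtain ⟨C, hC1, hC⟩ := exists_lintegral_exp_neg_le hm hdeg heven hlead hpr0
  obtain ⟨C₁, -, hC₁⟩ := exists_lintegral_exp_neg_le hm hdeg heven hlead zero_lt_one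
  refine ⟨C, fun L _ V hV hlow hup => ?_⟩
  have : IsProbabilityMeasure (gff L m) := isProbabilityMeasure_gff
  have hint : Integrable (fun φ => Real.exp (-V φ)) (gff L m) := by
    refine ⟨(Real.measurable_exp.comp hV.neg).aestronglyMeasurable, ?_⟩
    rw [hasFiniteIntegral_iff_ofReal (ae_of_all _ fun _ => (Real.exp_pos _).le)]
    have := hC₁ L V hV hlow
    simp only [one_mul] at this
    exact this.trans_lt ENNReal.coe_lt_top
  have hH := integral_hamiltonian (L := L) hm P
  have hVi : Integrable V (gff L m) := by
    refine hH.1.mono hV.aestronglyMeasurable (ae_of_all _ fun φ => ?_)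
    rw [Real.norm_eq_abs, Real.norm_eq_abs, abs_le]
    refine ⟨le_trans ?_ (hlow φ), (hup φ).trans (le_abs_self _)⟩
    exact le_min (neg_abs_le _) (neg_nonpos.2 (abs_nonneg _))
  -- Jensen's inequality
  have hone : 1 ≤ ∫ φ, Real.exp (-V φ) ∂gff L m := by
    calc (1 : ℝ) ≤ 1 - ∫ φ, V φ ∂gff L m := by
          have := integral_mono hVi hH.1 hup
          rw [hH.2] at this
          linarith
      _ = ∫ φ, (1 - V φ) ∂gff L m := by
          rw [integral_sub (integrable_const _) hVi]; simp
      _ ≤ _ := by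
          refine integral_mono ((integrable_const _).sub hVi) hint fun φ => ?_
          have := Real.add_one_le_exp (-V φ)
          simp only
          linarith
  have hnorm : eLpNorm (fun φ => Real.exp (-V φ)) p (gff L m) ≤ C := by
    rw [eLpNorm_eq_lintegral_rpow_enorm_toReal p0 hp']
    have e : ∀ φ, ‖Real.exp (-V φ)‖ₑ ^ p.toReal =
        ENNReal.ofReal (Real.exp (-(p.toReal * V φ))) := by
      intro φ
      rw [Real.enorm_eq_ofReal (Real.exp_pos _).le, ENNReal.ofReal_rpow_of_pos (Real.exp_pos _),
        ← Real.exp_mul]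
      congr 2
      ring
    simp only [e]
    calc _ ≤ (C : ℝ≥0∞) ^ (1 / p.toReal) := by gcongr; exact hC L V hV hlow
      _ ≤ (C : ℝ≥0∞) ^ (1 : ℝ) := by
          refine ENNReal.rpow_le_rpow_of_exponent_le (by exact_mod_cast hC1) ?_
          rw [div_le_one hpr0]; exact hpr
      _ = C := ENNReal.rpow_one _
  refine ⟨isProbabilityMeasure_tilted hint, tilted_absolutelyContinuous _ _, hnorm, ?_⟩
  refine le_trans (eLpNorm_mono_enorm_ae ?_) hnorm
  filter_upwards [rnDeriv_tilted_left_self (μ := gff L m) (f := fun φ => -V φ)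
    hV.neg.aemeasurable] with φ hφ
  rw [gibbs, hφ, Real.enorm_eq_ofReal (Real.exp_pos _).le, enorm_eq_self]
  exact ENNReal.ofReal_le_ofReal (div_le_self (Real.exp_pos _).le hone)

end hamiltonian

section cutoff

variable {χ : ℝ → ℝ → ℝ} {E : ℝ}

theorem IsCutoff.le_self (hχ : IsCutoff χ) (hE : 0 < E) (x : ℝ) : χ E x ≤ x := by
  rcases le_or_gt x (E / 2) with h | h
  · exact (hχ.eq_self E hE x h).le
  · have := (hχ.concave E hE).slope_anti_adjacent (Set.mem_univ (E / 2 - 1)) (Set.mem_univ x)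
      (by linarith : E / 2 - 1 < E / 2) h
    rw [hχ.eq_self E hE (E / 2) le_rfl, hχ.eq_self E hE (E / 2 - 1) (by linarith), div_le_iff₀
      (by linarith)] at this
    have e : (E / 2 - (E / 2 - 1)) / (E / 2 - (E / 2 - 1)) = 1 := div_self (by linarith)
    rw [e] at this
    linarith

/-- A concave function that is constant near `+∞` is nondecreasing. -/
theorem IsCutoff.min_zero_le (hχ : IsCutoff χ) (hE : 0 < E) (x : ℝ) : min x 0 ≤ χ E x := by
  rcases le_or_gt x (E / 2) with h | h
  · rw [hχ.eq_self E hE x h]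
    exact min_le_left _ _
  · refine (min_le_right _ _).trans ?_
    obtain ⟨R, M, hR⟩ := hχ.eventually_const E hE
    set y := max R x + 1 with hy
    have y1 : R < y := by have := le_max_left R x; linarith
    have y2 : x < y := by have := le_max_right R x; linarith
    have h1 := (hχ.concave E hE).slope_anti_adjacent (Set.mem_univ (E / 2)) (Set.mem_univ y) h y2
    have h2 := (hχ.concave E hE).slope_anti_adjacent (Set.mem_univ x) (Set.mem_univ (y + 1)) y2
      (by linarith : y < y + 1)
    rw [hR y y1, hR (y + 1) (by linarith), sub_self, zero_div] at h2
    rw [hR y y1] at h1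
    have h3 := h2.trans h1
    rw [hχ.eq_self E hE (E / 2) le_rfl, le_div_iff₀ (by linarith)] at h3
    linarith

theorem IsCutoff.continuous (hχ : IsCutoff χ) (hE : 0 < E) : Continuous (χ E) := (hχ.contDiff E hE).continuous

end cutoff

/-! ### Fourier modes on the torus and on the lattice -/

section fourier

theorem mFourier_add_apply {d : Type*} [Fintype d] (n : d → ℤ) (a b : UnitAddTorus d) :
    UnitAddTorus.mFourier n (a + b) = UnitAddTorus.mFourier n a * UnitAddTorus.mFourier n b := by
  simp only [UnitAddTorus.mFourier, ContinuousMap.coe_mk, ← Finset.prod_mul_distrib]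
  refine Finset.prod_congr rfl fun i _ => ?_
  rw [Pi.add_apply, fourier_apply, fourier_apply, fourier_apply, smul_add, AddCircle.toCircle_add,
    Circle.coe_mul]

theorem mFourier_neg_apply {d : Type*} [Fintype d] (n : d → ℤ) (a : UnitAddTorus d) :
    UnitAddTorus.mFourier n (-a) = starRingEnd ℂ (UnitAddTorus.mFourier n a) := by
  rw [← UnitAddTorus.mFourier_neg]
  simp only [UnitAddTorus.mFourier, ContinuousMap.coe_mk]
  refine Finset.prod_congr rfl fun i _ => ?_
  rw [Pi.neg_apply, Pi.neg_apply, fourier_apply, fourier_apply, smul_neg, neg_smul]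

/-- `(cos a + sin a) (cos b + sin b) = sin (a + b) + cos (a - b)`. -/
theorem re_add_im_mul_re_add_im (z w : ℂ) :
    (z.re + z.im) * (w.re + w.im) = (z * w).im + (z * starRingEnd ℂ w).re := by
  simp only [Complex.mul_im, Complex.mul_re, Complex.conj_re, Complex.conj_im]
  ring

theorem integral_fourier_unitAddCircle (n : ℤ) :
    ∫ x : UnitAddCircle, fourier n x = if n = 0 then 1 else 0 := by
  have h := orthonormal_iff_ite.1 (orthonormal_fourier (T := 1)) 0 n
  rw [ContinuousMap.inner_toLp] at h
  simp only [fourier_zero, map_one, mul_one] at h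
  rw [AddCircle.volume_eq_smul_haarAddCircle, ENNReal.ofReal_one, one_smul, h]
  simp only [eq_comm]

theorem integral_mFourier (n : Fin 2 → ℤ) :
    ∫ x : Torus, UnitAddTorus.mFourier n x = if n = 0 then 1 else 0 := by
  simp only [UnitAddTorus.mFourier, ContinuousMap.coe_mk]
  rw [MeasureTheory.integral_fintype_prod_volume_eq_prod (fun i => fourier (n i))]
  simp only [integral_fourier_unitAddCircle, Fin.prod_univ_two]
  have : n = 0 ↔ n 0 = 0 ∧ n 1 = 0 := by
    rw [funext_iff, Fin.forall_fin_two]; rfl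
  simp only [this]
  split_ifs <;> simp_all

/-- The real Fourier modes are orthonormal. -/
theorem inner_mode (n k : Fin 2 → ℤ) :
    inner ℝ (ContinuousMap.toLp 2 (volume : Measure Torus) ℝ (mode n))
      (ContinuousMap.toLp 2 volume ℝ (mode k)) = if n = k then 1 else 0 := by
  rw [ContinuousMap.inner_toLp]
  have hint : ∀ l : Fin 2 → ℤ, Integrable (fun x : Torus => UnitAddTorus.mFourier l x) volume :=
    fun l => (UnitAddTorus.mFourier l).continuous.integrable_of_hasCompactSupport
      (HasCompactSupport.of_compactSpace _)
  have e : ∀ x : Torus, mode k x * starRingEnd ℝ (mode n x) =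
      (UnitAddTorus.mFourier (k + n) x).im + (UnitAddTorus.mFourier (k - n) x).re := by
    intro x
    rw [sub_eq_add_neg, UnitAddTorus.mFourier_add, UnitAddTorus.mFourier_add,
      UnitAddTorus.mFourier_neg, ← re_add_im_mul_re_add_im]
    rfl
  simp only [e]
  have h1 := integral_im (hint (k + n))
  have h2 := integral_re (hint (k - n))
  simp only [RCLike.im_eq_complex_im, RCLike.re_eq_complex_re] at h1 h2
  refine (integral_add (hint (k + n)).im (hint (k - n)).re).trans ?_
  simp only [RCLike.im_eq_complex_im, RCLike.re_eq_complex_re]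
  rw [h1, h2, integral_mFourier, integral_mFourier]
  simp only [sub_eq_zero, eq_comm (a := k)]
  split_ifs <;> simp

variable {L : ℕ} [NeZero L]

theorem site_add (x y : Lattice L) : site (x + y) = site x + site y := by
  funext i; simp [site]

theorem site_neg (x : Lattice L) : site (-x) = -site x := by
  funext i; simp [site]

theorem toCircle_toAddCircle_pow (z : ZMod L) :
    AddCircle.toCircle (ZMod.toAddCircle z) ^ L = 1 := by
  rw [← AddCircle.toCircle_nsmul, ← map_nsmul]
  simp

/-- The orthogonality relation for the characters of `ℤ / L ℤ`. -/
theorem sum_fourier_toAddCircle (a : ℤ) (z : ZMod L) :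
    ∑ k ∈ Finset.Ico a (a + L), fourier k (ZMod.toAddCircle z) = if z = 0 then (L : ℂ) else 0 := by
  split_ifs with h
  · simp [h]
  set w : ℂ := (AddCircle.toCircle (ZMod.toAddCircle z) : ℂ) with hw
  have hw1 : w ≠ 1 := by
    intro h1
    have : AddCircle.toCircle (ZMod.toAddCircle z) = AddCircle.toCircle (0 : UnitAddCircle) := by
      rw [AddCircle.toCircle_zero]
      exact Circle.ext h1
    exact h (by simpa using AddCircle.injective_toCircle one_ne_zero this)
  have hwL : w ^ L = 1 := by
    rw [hw, ← Circle.coe_pow, toCircle_toAddCircle_pow, Circle.coe_one]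
  have e : ∑ k ∈ Finset.Ico a (a + L), fourier k (ZMod.toAddCircle z) =
      ∑ j ∈ Finset.range L, fourier a (ZMod.toAddCircle z) * w ^ j := by
    refine Finset.sum_nbij' (fun k => (k - a).toNat) (fun j => a + j) ?_ ?_ ?_ ?_ ?_
    · intro k hk; simp only [Finset.mem_Ico, Finset.mem_range] at *; lia
    · intro k hk; simp only [Finset.mem_Ico, Finset.mem_range] at *; lia
    · intro k hk; simp only [Finset.mem_Ico] at *; lia
    · intro k hk; simp
    · intro k hk
      simp only [Finset.mem_Ico] at hk
      obtain ⟨j, rfl⟩ : ∃ j : ℕ, k = a + j := ⟨(k - a).toNat, by lia⟩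
      rw [fourier_add]
      congr 1
      rw [fourier_apply, natCast_zsmul, AddCircle.toCircle_nsmul, Circle.coe_pow]
      simp [hw]
  rw [e, ← Finset.mul_sum, geom_sum_eq hw1, hwL, sub_self, zero_div, mul_zero]

theorem frequencies_eq : frequencies L =
    Fintype.piFinset fun _ => Finset.Ico (-(((L : ℤ) - 1) / 2)) (-(((L : ℤ) - 1) / 2) + L) := by
  ext n
  have := NeZero.pos L
  simp only [frequencies, Finset.mem_filter, Fintype.mem_piFinset, Finset.mem_Icc, Finset.mem_Ico]
  constructor
  · rintro ⟨-, h⟩ i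
    have := h i
    lia
  · intro h
    refine ⟨fun i => ?_, fun i => ?_⟩ <;>
    · have := h i
      lia

theorem sum_mFourier_site (z : Lattice L) :
    ∑ n ∈ frequencies L, UnitAddTorus.mFourier n (site z) = if z = 0 then (L : ℂ) ^ 2 else 0 := by
  simp only [frequencies_eq, UnitAddTorus.mFourier, ContinuousMap.coe_mk, site]
  rw [← Finset.prod_univ_sum (fun _ : Fin 2 => Finset.Ico (-(((L : ℤ) - 1) / 2))
    (-(((L : ℤ) - 1) / 2) + L)) (fun i k => fourier k (ZMod.toAddCircle (z i)))]
  simp only [sum_fourier_toAddCircle, Fin.prod_univ_two]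
  have : z = 0 ↔ z 0 = 0 ∧ z 1 = 0 := by
    rw [funext_iff, Fin.forall_fin_two]; rfl
  simp only [this]
  split_ifs <;> simp_all [sq]

/-- The real Fourier modes satisfy the completeness relation on the lattice. -/
theorem sum_mode_mul_mode (x y : Lattice L) :
    ∑ n ∈ frequencies L, mode n (site x) * mode n (site y) = if x = y then (L : ℝ) ^ 2 else 0 := by
  have e : ∀ n, mode n (site x) * mode n (site y) =
      (UnitAddTorus.mFourier n (site (x + y))).im +
        (UnitAddTorus.mFourier n (site (x - y))).re := by
    intro n
    rw [sub_eq_add_neg, site_add, site_add, mFourier_add_apply, mFourier_add_apply, site_neg,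
      mFourier_neg_apply, ← re_add_im_mul_re_add_im]
    rfl
  simp only [e]
  rw [Finset.sum_add_distrib, ← Complex.im_sum, ← Complex.re_sum, sum_mFourier_site,
    sum_mFourier_site]
  simp only [sub_eq_zero]
  have h : ((L : ℂ) ^ 2) = (((L : ℝ) ^ 2 : ℝ) : ℂ) := by push_cast; rfl
  rw [h]
  split_ifs <;> simp only [Complex.ofReal_im, Complex.ofReal_re, Complex.zero_im, Complex.zero_re,
    zero_add]

end fourier

/-! ### The Pauli-Villars resolvent as a function of time -/

section resolvent

variable {L : ℕ} [NeZero L] {m : ℝ}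

theorem massiveLaplacian_inv_mul (hm : 0 < m ^ 2) :
    (massiveLaplacian L m)⁻¹ * massiveLaplacian L m = 1 := by
  rw [massiveLaplacian_eq]; exact ellipticOp_inv_mul zero_le_one hm

theorem q_mul (hm : 0 < m ^ 2) (t : ℝ≥0) :
    q L m t * ((t : ℝ) • massiveLaplacian L m + 1) = 1 := by
  have e : (t : ℝ) • massiveLaplacian L m + 1 = ellipticOp L t (t * m ^ 2 + 1) := by
    rw [massiveLaplacian_eq]; simp only [ellipticOp]; module
  rw [q_eq, e]; exact ellipticOp_inv_mul t.coe_nonneg (q_pos_aux hm t)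

theorem mul_q (hm : 0 < m ^ 2) (t : ℝ≥0) :
    ((t : ℝ) • massiveLaplacian L m + 1) * q L m t = 1 := by
  have e : (t : ℝ) • massiveLaplacian L m + 1 = ellipticOp L t (t * m ^ 2 + 1) := by
    rw [massiveLaplacian_eq]; simp only [ellipticOp]; module
  rw [q_eq, e]; exact ellipticOp_mul_inv t.coe_nonneg (q_pos_aux hm t)

/-- The resolvent identity. -/
theorem q_sub_q (hm : 0 < m ^ 2) (s t : ℝ≥0) :
    q L m s - q L m t = ((t : ℝ) - s) • (q L m s * massiveLaplacian L m * q L m t) := by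
  set A := massiveLaplacian L m
  have h1 : q L m s = q L m s * (((t : ℝ) • A + 1) * q L m t) := by
    rw [mul_q hm, Matrix.mul_one]
  have h2 : q L m t = (q L m s * ((s : ℝ) • A + 1)) * q L m t := by
    rw [q_mul hm, Matrix.one_mul]
  refine (congrArg₂ (· - ·) h1 h2).trans ?_
  simp only [Matrix.add_mul, Matrix.mul_add, Matrix.smul_mul, Matrix.mul_smul, Matrix.one_mul,
    Matrix.mul_one, ← Matrix.mul_assoc]
  module

/-- The resolvent identity for `t ↦ t q_t`; it shows that the derivative of `t q_t` is `q_t²`. -/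
theorem smul_q_sub_smul_q (hm : 0 < m ^ 2) (s t : ℝ≥0) :
    (t : ℝ) • q L m t - (s : ℝ) • q L m s = ((t : ℝ) - s) • (q L m s * q L m t) := by
  set A := massiveLaplacian L m
  have h1 : q L m s = q L m s * (((t : ℝ) • A + 1) * q L m t) := by
    rw [mul_q hm, Matrix.mul_one]
  have h2 : q L m t = (q L m s * ((s : ℝ) • A + 1)) * q L m t := by
    rw [q_mul hm, Matrix.one_mul]
  refine (congrArg₂ (fun M N => (t : ℝ) • M - (s : ℝ) • N) h2 h1).trans ?_
  simp only [Matrix.add_mul, Matrix.mul_add, Matrix.smul_mul, Matrix.mul_smul, Matrix.one_mul,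
    Matrix.mul_one, ← Matrix.mul_assoc]
  module

theorem q_le (hm : 0 < m ^ 2) (t : ℝ≥0) (x y : Lattice L) :
    q L m t x y ≤ ((t : ℝ) * m ^ 2 + 1)⁻¹ := by
  rw [← sum_q hm t x]
  exact Finset.single_le_sum (f := fun y => q L m t x y) (fun z _ => q_nonneg hm t x z)
    (Finset.mem_univ y)

theorem q_le_one (hm : 0 < m ^ 2) (t : ℝ≥0) (x y : Lattice L) : q L m t x y ≤ 1 :=
  (q_le hm t x y).trans (inv_le_one_of_one_le₀ (by simp; positivity))

theorem abs_q_le (hm : 0 < m ^ 2) (t : ℝ≥0) (x y : Lattice L) :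
    |q L m t x y| ≤ max 2 (1 / m ^ 2) / (2 + t) := by
  rw [abs_of_nonneg (q_nonneg hm t x y)]
  refine (q_le hm t x y).trans ?_
  rw [inv_le_comm₀ (by positivity) (by positivity), inv_div, div_le_iff₀ (by positivity)]
  have h1 := le_max_left 2 (1 / m ^ 2)
  have h2 : 1 ≤ m ^ 2 * max 2 (1 / m ^ 2) := by
    have := mul_le_mul_of_nonneg_left (le_max_right 2 (1 / m ^ 2)) hm.le
    rwa [mul_one_div_cancel hm.ne'] at this
  nlinarith [mul_le_mul_of_nonneg_left h2 t.coe_nonneg]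

theorem continuous_q (hm : 0 < m ^ 2) (x y : Lattice L) : Continuous fun t => q L m t x y := by
  set A := massiveLaplacian L m with hA
  set K : ℝ := ∑ z, ∑ w, |A w z| with hK
  have hlip : ∀ s t : ℝ≥0, |q L m s x y - q L m t x y| ≤ K * |(s : ℝ) - t| := by
    intro s t
    have := congrFun (congrFun (q_sub_q hm s t) x) y
    rw [Matrix.sub_apply] at this
    rw [this, Matrix.smul_apply, smul_eq_mul, abs_mul, abs_sub_comm, mul_comm]
    refine mul_le_mul_of_nonneg_right ?_ (abs_nonneg _)
    rw [Matrix.mul_apply]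
    refine (Finset.abs_sum_le_sum_abs _ _).trans (Finset.sum_le_sum fun z _ => ?_)
    rw [abs_mul, abs_of_nonneg (q_nonneg hm t z y)]
    refine (mul_le_of_le_one_right (abs_nonneg _) (q_le_one hm t z y)).trans ?_
    rw [Matrix.mul_apply]
    refine (Finset.abs_sum_le_sum_abs _ _).trans (Finset.sum_le_sum fun w _ => ?_)
    rw [abs_mul, abs_of_nonneg (q_nonneg hm s x w)]
    exact mul_le_of_le_one_left (abs_nonneg _) (q_le_one hm s x w)
  have K0 : 0 ≤ K := by positivity
  refine (LipschitzWith.of_dist_le_mul (K := ⟨K, K0⟩) fun s t => ?_).continuous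
  rw [Real.dist_eq, NNReal.dist_eq]
  exact hlip s t

theorem tendsto_mul_q (hm : 0 < m ^ 2) (x y : Lattice L) :
    Tendsto (fun t : ℝ => t * q L m t.toNNReal x y) atTop (𝓝 ((massiveLaplacian L m)⁻¹ x y)) := by
  set G := (massiveLaplacian L m)⁻¹ with hG
  have h1 : ∀ t : ℝ≥0, (t : ℝ) • q L m t = G - G * q L m t := by
    intro t
    have h : G * (((t : ℝ) • massiveLaplacian L m + 1) * q L m t) = G := by
      rw [mul_q hm, Matrix.mul_one]
    rw [Matrix.add_mul, Matrix.mul_add, Matrix.smul_mul, Matrix.mul_smul, Matrix.one_mul,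
      ← Matrix.mul_assoc, hG, massiveLaplacian_inv_mul hm, Matrix.one_mul] at h
    exact eq_sub_of_add_eq h
  have h2 : ∀ z : Lattice L, Tendsto (fun t : ℝ => q L m t.toNNReal z y) atTop (𝓝 0) := by
    intro z
    refine squeeze_zero (fun t => q_nonneg hm _ _ _) (fun t => q_le hm _ _ _) ?_
    refine tendsto_inv_atTop_zero.comp (tendsto_atTop_add_const_right _ _ ?_)
    refine Tendsto.atTop_mul_const hm ?_
    exact tendsto_atTop_mono (fun t => Real.le_coe_toNNReal t) tendsto_id
  have h3 : Tendsto (fun t : ℝ => G x y - ∑ z, G x z * q L m t.toNNReal z y) atTop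
      (𝓝 (G x y - ∑ z, G x z * 0)) :=
    tendsto_const_nhds.sub (tendsto_finsetSum _ fun z _ => (h2 z).const_mul _)
  simp only [mul_zero, Finset.sum_const_zero, sub_zero] at h3
  refine h3.congr' ?_
  filter_upwards [eventually_ge_atTop 0] with t ht
  have := congrFun (congrFun (h1 t.toNNReal) x) y
  rw [Matrix.smul_apply, Matrix.sub_apply, Matrix.mul_apply, smul_eq_mul,
    Real.coe_toNNReal t ht] at this
  exact this.symm

theorem hasDerivAt_mul_q (hm : 0 < m ^ 2) (x y : Lattice L) {t : ℝ} (ht : 0 < t) :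
    HasDerivAt (fun t : ℝ => t * q L m t.toNNReal x y)
      ((q L m t.toNNReal * q L m t.toNNReal) x y) t := by
  rw [hasDerivAt_iff_tendsto_slope]
  have h : Tendsto (fun s : ℝ => (q L m t.toNNReal * q L m s.toNNReal) x y) (𝓝 t)
      (𝓝 ((q L m t.toNNReal * q L m t.toNNReal) x y)) := by
    simp only [Matrix.mul_apply]
    refine tendsto_finsetSum _ fun z _ => Tendsto.const_mul _ ?_
    exact ((continuous_q hm z y).comp continuous_real_toNNReal).continuousAt
  refine (h.mono_left nhdsWithin_le_nhds).congr' ?_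
  filter_upwards [self_mem_nhdsWithin, mem_nhdsWithin_of_mem_nhds (lt_mem_nhds ht)] with s hs hs0
  have hne : s - t ≠ 0 := sub_ne_zero.2 hs
  have := congrFun (congrFun (smul_q_sub_smul_q (L := L) hm t.toNNReal s.toNNReal) x) y
  simp only [Matrix.smul_apply, Matrix.sub_apply, smul_eq_mul, Real.coe_toNNReal t ht.le,
    Real.coe_toNNReal s (le_of_lt hs0)] at this
  rw [slope_def_field, this]
  field_simp

theorem integral_timeMeasure (f : ℝ≥0 → ℝ) (hf : Continuous f) :
    ∫ t, f t ∂timeMeasure = ∫ t in Set.Ioi (0 : ℝ), f t.toNNReal := by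
  rw [timeMeasure, integral_map measurable_real_toNNReal.aemeasurable hf.aestronglyMeasurable,
    integral_Ici_eq_integral_Ioi]

/-- `∫₀^∞ q_t² dt = (-Δ^ε + m²)⁻¹`. -/
theorem integral_q_mul_q (hm : 0 < m ^ 2) (x y : Lattice L) :
    Integrable (fun t => (q L m t * q L m t) x y) timeMeasure ∧
    ∫ t, (q L m t * q L m t) x y ∂timeMeasure = (massiveLaplacian L m)⁻¹ x y := by
  have hc : Continuous fun t => (q L m t * q L m t) x y := by
    simp only [Matrix.mul_apply]
    exact continuous_finsetSum _ fun z _ => (continuous_q hm x z).mul (continuous_q hm z y)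
  have h0 : ContinuousWithinAt (fun t : ℝ => t * q L m t.toNNReal x y) (Set.Ici 0) 0 :=
    (continuous_id.mul
      ((continuous_q hm x y).comp continuous_real_toNNReal)).continuousWithinAt
  have hpos : ∀ t ∈ Set.Ioi (0 : ℝ), 0 ≤ (q L m t.toNNReal * q L m t.toNNReal) x y := by
    intro t _
    rw [Matrix.mul_apply]
    exact Finset.sum_nonneg fun z _ => mul_nonneg (q_nonneg hm _ _ _) (q_nonneg hm _ _ _)
  have hd : ∀ t ∈ Set.Ioi (0 : ℝ), HasDerivAt (fun t : ℝ => t * q L m t.toNNReal x y)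
      ((q L m t.toNNReal * q L m t.toNNReal) x y) t := fun t ht => hasDerivAt_mul_q hm x y ht
  constructor
  · rw [timeMeasure, integrable_map_measure hc.aestronglyMeasurable
      measurable_real_toNNReal.aemeasurable]
    exact (integrableOn_Ici_iff_integrableOn_Ioi).2
      (integrableOn_Ioi_deriv_of_nonneg h0 hd hpos (tendsto_mul_q hm x y))
  · rw [integral_timeMeasure _ hc,
      integral_Ioi_of_hasDerivAt_of_nonneg h0 hd hpos (tendsto_mul_q hm x y), zero_mul, sub_zero]

end resolvent

/-! ### The Wiener integral as an isometry -/

section wiener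

variable {O : Type*} [MeasurableSpace O]

/-- The Riemann-Stieltjes sum `wienerSum` for an integrator `b` with values in a vector space. -/
def vectorSum {H : Type*} [AddCommGroup H] [Module ℝ H] (f : ℝ≥0 → ℝ) (b : ℝ≥0 → H) (N : ℕ) : H :=
  ∑ i ∈ Finset.range (N ^ 2), f ((i : ℝ≥0) / N) • (b (((i : ℝ≥0) + 1) / N) - b ((i : ℝ≥0) / N))

theorem inner_vectorSum {H K : Type*} [NormedAddCommGroup H] [InnerProductSpace ℝ H]
    [NormedAddCommGroup K] [InnerProductSpace ℝ K] {b b' : ℝ≥0 → H} {j : ℝ≥0 → K} {c : ℝ}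
    (h : ∀ s t, inner ℝ (b s) (b' t) = c * inner ℝ (j s) (j t)) (f g : ℝ≥0 → ℝ) (N M : ℕ) :
    inner ℝ (vectorSum f b N) (vectorSum g b' M) =
      c * inner ℝ (vectorSum f j N) (vectorSum g j M) := by
  simp only [vectorSum, sum_inner, inner_sum, real_inner_smul_left, real_inner_smul_right,
    inner_sub_left, inner_sub_right, h, Finset.mul_sum]
  refine Finset.sum_congr rfl fun i _ => Finset.sum_congr rfl fun k _ => ?_
  ring

/-- If `b` is isometric, up to a factor, to a model curve `j`, then the sums for `b` converge
whenever those for `j` do. -/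
theorem exists_tendsto_vectorSum {H K : Type*} [NormedAddCommGroup H] [InnerProductSpace ℝ H]
    [CompleteSpace H] [NormedAddCommGroup K] [InnerProductSpace ℝ K] {b : ℝ≥0 → H} {j : ℝ≥0 → K}
    {c : ℝ} (h : ∀ s t, inner ℝ (b s) (b t) = c * inner ℝ (j s) (j t)) {f : ℝ≥0 → ℝ} {F : K}
    (hF : Tendsto (vectorSum f j) atTop (𝓝 F)) : ∃ X : H, Tendsto (vectorSum f b) atTop (𝓝 X) := by
  refine cauchySeq_tendsto_of_complete ?_
  have hc := cauchySeq_iff_tendsto_dist_atTop_0.1 hF.cauchySeq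
  rw [cauchySeq_iff_tendsto_dist_atTop_0]
  have e : ∀ n : ℕ × ℕ, dist (vectorSum f b n.1) (vectorSum f b n.2) =
      √(c * dist (vectorSum f j n.1) (vectorSum f j n.2) ^ 2) := by
    intro n
    rw [← Real.sqrt_sq dist_nonneg]
    congr 1
    simp only [dist_eq_norm, ← real_inner_self_eq_norm_sq, inner_sub_left, inner_sub_right,
      inner_vectorSum h]
    ring
  simp only [e]
  have h2 := ((hc.pow 2).const_mul c).sqrt
  simpa using h2

theorem coeFn_vectorSum {μ : Measure O} {b : ℝ≥0 → Lp ℝ 2 μ} {B : ℝ≥0 → O → ℝ}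
    (h : ∀ t, b t =ᵐ[μ] B t) (f : ℝ≥0 → ℝ) (N : ℕ) :
    ⇑(vectorSum (H := Lp ℝ 2 μ) f b N) =ᵐ[μ] wienerSum f B N := by
  have h1 : ∀ i ∈ Finset.range (N ^ 2),
      ⇑(f ((i : ℝ≥0) / N) • (b (((i : ℝ≥0) + 1) / N) - b ((i : ℝ≥0) / N))) =ᵐ[μ]
        fun ω => f ((i : ℝ≥0) / N) * (B (((i : ℝ≥0) + 1) / N) ω - B ((i : ℝ≥0) / N) ω) := by
    intro i _
    filter_upwards [Lp.coeFn_smul (f ((i : ℝ≥0) / N)) (b (((i : ℝ≥0) + 1) / N) - b ((i : ℝ≥0) / N)),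
      Lp.coeFn_sub (b (((i : ℝ≥0) + 1) / N)) (b ((i : ℝ≥0) / N)), h (((i : ℝ≥0) + 1) / N),
      h ((i : ℝ≥0) / N)] with ω h1 h2 h3 h4
    rw [h1, Pi.smul_apply, h2, Pi.sub_apply, h3, h4, smul_eq_mul]
  filter_upwards [Lp.coeFn_fun_finsetSum (Finset.range (N ^ 2))
    (fun i : ℕ => f ((i : ℝ≥0) / N) • (b (((i : ℝ≥0) + 1) / N) - b ((i : ℝ≥0) / N))),
    (ae_ball_iff (Finset.range (N ^ 2)).countable_toSet).2 h1] with ω h2 h3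
  rw [vectorSum, h2, wienerSum]
  exact Finset.sum_congr rfl fun i hi => h3 i hi

/-- The Wiener integral agrees with the limit of the Riemann-Stieltjes sums in the Hilbert space
`L²(μ)`. -/
theorem wienerIntegral_ae_eq {μ : Measure O} {b : ℝ≥0 → Lp ℝ 2 μ} {B : ℝ≥0 → O → ℝ}
    (h : ∀ t, b t =ᵐ[μ] B t) {f : ℝ≥0 → ℝ} {X : Lp ℝ 2 μ}
    (hX : Tendsto (vectorSum f b) atTop (𝓝 X)) : wienerIntegral μ f B =ᵐ[μ] X := by
  set S : ℕ → Lp ℝ 2 μ := vectorSum f b with hS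
  have key : ∀ (Y : O → ℝ), (fun N => eLpNorm (fun ω => wienerSum f B N ω - Y ω) 2 μ) =
      fun N => eLpNorm (⇑(S N) - Y) 2 μ := fun Y => funext fun N => eLpNorm_congr_ae <| by
    filter_upwards [coeFn_vectorSum h f N] with ω hω
    rw [Pi.sub_apply, hS, hω]
  have hex : ∃ Y : O → ℝ, MemLp Y 2 μ ∧
      Tendsto (fun N => eLpNorm (fun ω => wienerSum f B N ω - Y ω) 2 μ) atTop (𝓝 0) := by
    refine ⟨X, Lp.memLp X, ?_⟩
    rw [key]
    exact (Lp.tendsto_Lp_iff_tendsto_eLpNorm' S X).1 hX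
  have hdef : wienerIntegral μ f B = hex.choose := dif_pos hex
  rw [hdef]
  have h1 := hex.choose_spec.1
  have h2 := hex.choose_spec.2
  generalize hex.choose = Y at h1 h2
  rw [key] at h2
  have h3 := (Lp.tendsto_Lp_iff_tendsto_eLpNorm S Y h1).2 h2
  have h4 := tendsto_nhds_unique h3 hX
  have h5 := h1.coeFn_toLp
  rw [h4] at h5
  exact h5.symm

theorem timeMeasure_Iio (t : ℝ≥0) : timeMeasure (Set.Iio t) = t := by
  rw [timeMeasure, Measure.map_apply measurable_real_toNNReal measurableSet_Iio,
    Measure.restrict_apply (measurable_real_toNNReal measurableSet_Iio)]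
  have : Real.toNNReal ⁻¹' Set.Iio t ∩ Set.Ici 0 = Set.Ico (0 : ℝ) t := by
    ext x
    simp only [Set.mem_inter_iff, Set.mem_preimage, Set.mem_Iio, Set.mem_Ici, Set.mem_Ico]
    constructor
    · rintro ⟨h1, h2⟩
      exact ⟨h2, (Real.toNNReal_lt_iff_lt_coe h2).1 h1⟩
    · rintro ⟨h1, h2⟩
      exact ⟨(Real.toNNReal_lt_iff_lt_coe h1).2 h2, h1⟩
  rw [this, Real.volume_Ico, sub_zero, ENNReal.ofReal_coe_nnreal]

/-- The curve `t ↦ 1_{[0, t)}` in `L²([0, ∞))`, the model of a Brownian motion. -/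
def indicatorCurve (t : ℝ≥0) : Lp ℝ 2 timeMeasure :=
  indicatorConstLp 2 (measurableSet_Iio (a := t)) (by rw [timeMeasure_Iio]; finiteness) 1

theorem inner_indicatorCurve (s t : ℝ≥0) :
    inner ℝ (indicatorCurve s) (indicatorCurve t) = min (s : ℝ) t := by
  rw [indicatorCurve, indicatorCurve, L2.real_inner_indicatorConstLp_one_indicatorConstLp_one
    measurableSet_Iio measurableSet_Iio (by rw [timeMeasure_Iio]; finiteness)
    (by rw [timeMeasure_Iio]; finiteness), Set.Iio_inter_Iio, Measure.real, timeMeasure_Iio]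
  exact NNReal.coe_min s t

/-- For the model Brownian motion the Riemann-Stieltjes sum is the step function with the values
of `f` at the left end points of the partition, cut off at time `N`. -/
theorem wienerSum_indicator (f : ℝ≥0 → ℝ) {N : ℕ} (hN : 0 < N) (τ : ℝ≥0) :
    wienerSum f (fun t τ => (Set.Iio t).indicator (fun _ => (1 : ℝ)) τ) N τ =
      if ⌊(τ : ℝ) * N⌋₊ < N ^ 2 then f ((⌊(τ : ℝ) * N⌋₊ : ℝ≥0) / N) else 0 := by
  have hN' : (0 : ℝ) < N := Nat.cast_pos.2 hN
  rw [wienerSum]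
  have hterm : ∀ i : ℕ, (Set.Iio (((i : ℝ≥0) + 1) / N)).indicator (fun _ => (1 : ℝ)) τ -
      (Set.Iio ((i : ℝ≥0) / N)).indicator (fun _ => (1 : ℝ)) τ =
        if i = ⌊(τ : ℝ) * N⌋₊ then 1 else 0 := by
    intro i
    have h1 : τ < ((i : ℝ≥0) + 1) / N ↔ ⌊(τ : ℝ) * N⌋₊ < i + 1 := by
      rw [Nat.floor_lt (by positivity), ← NNReal.coe_lt_coe]
      push_cast
      rw [lt_div_iff₀ hN']
    have h2 : τ < (i : ℝ≥0) / N ↔ ⌊(τ : ℝ) * N⌋₊ < i := by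
      rw [Nat.floor_lt (by positivity), ← NNReal.coe_lt_coe]
      push_cast
      rw [lt_div_iff₀ hN']
    simp only [Set.indicator_apply, Set.mem_Iio, h1, h2]
    split_ifs <;> first | lia | norm_num
  simp only [hterm]
  simp only [mul_ite, mul_one, mul_zero, Finset.sum_ite_eq', Finset.mem_range]

end wiener

section wiener

theorem lintegral_inv_one_add_sq_lt_top (C : ℝ) :
    ∫⁻ t : ℝ≥0, ENNReal.ofReal ((C / (1 + t)) ^ 2) ∂timeMeasure < ∞ := by
  have hm : Measurable fun t : ℝ≥0 => ENNReal.ofReal ((C / (1 + t)) ^ 2) := by fun_prop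
  rw [timeMeasure, lintegral_map hm measurable_real_toNNReal]
  have hI : Integrable (fun x : ℝ => C ^ 2 * (1 + ‖x‖) ^ (-(2 : ℝ))) volume :=
    (integrable_one_add_norm (by norm_num)).const_mul _
  refine lt_of_le_of_lt ?_ (hI.restrict (s := Set.Ici (0 : ℝ))).lintegral_lt_top
  refine setLIntegral_mono' measurableSet_Ici fun x hx => ENNReal.ofReal_le_ofReal (le_of_eq ?_)
  rw [Real.coe_toNNReal x hx, Real.norm_of_nonneg hx, Real.rpow_neg (by simp at hx; positivity),
    div_pow, Real.rpow_two, div_eq_mul_inv]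

variable {f : ℝ≥0 → ℝ} {C : ℝ}

theorem memLp_timeMeasure (hf : Continuous f) (hC : ∀ t, |f t| ≤ C / (2 + t)) :
    MemLp f 2 timeMeasure := by
  refine ⟨hf.aestronglyMeasurable, ?_⟩
  have C0 : 0 ≤ C := by
    have h := (abs_nonneg _).trans (hC 0)
    simp only [NNReal.coe_zero, add_zero] at h
    linarith
  rw [eLpNorm_lt_top_iff_lintegral_rpow_enorm_lt_top (by norm_num) (by norm_num)]
  refine lt_of_le_of_lt (lintegral_mono fun t => ?_) (lintegral_inv_one_add_sq_lt_top C)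
  rw [ENNReal.toReal_ofNat, ENNReal.rpow_two, Real.enorm_eq_ofReal_abs,
    ← ENNReal.ofReal_pow (abs_nonneg _)]
  refine ENNReal.ofReal_le_ofReal (pow_le_pow_left₀ (abs_nonneg _) ((hC t).trans ?_) 2)
  gcongr
  norm_num

/-- The step function approximations to a continuous, decaying function converge in
`L²([0, ∞))`. -/
theorem tendsto_vectorSum_indicatorCurve (hf : Continuous f) (hC : ∀ t, |f t| ≤ C / (2 + t)) :
    Tendsto (vectorSum f indicatorCurve) atTop (𝓝 ((memLp_timeMeasure hf hC).toLp f)) := by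
  have C0 : 0 ≤ C := by
    have h := (abs_nonneg _).trans (hC 0)
    simp only [NNReal.coe_zero, add_zero] at h
    linarith
  set J : ℝ≥0 → ℝ≥0 → ℝ := fun t τ => (Set.Iio t).indicator (fun _ => (1 : ℝ)) τ with hJ
  have hJc : ∀ t, indicatorCurve t =ᵐ[timeMeasure] J t := fun t => indicatorConstLp_coeFn
  rw [Lp.tendsto_Lp_iff_tendsto_eLpNorm]
  have e : ∀ N, eLpNorm (⇑(vectorSum f indicatorCurve N) - f) 2 timeMeasure =
      (∫⁻ τ, ENNReal.ofReal ((wienerSum f J N τ - f τ) ^ 2) ∂timeMeasure) ^ (1 / (2 : ℝ)) := by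
    intro N
    have h1 : ⇑(vectorSum f indicatorCurve N) - f =ᵐ[timeMeasure]
        fun τ => wienerSum f J N τ - f τ := by
      filter_upwards [coeFn_vectorSum hJc f N] with τ hτ
      rw [Pi.sub_apply, hτ]
    rw [eLpNorm_congr_ae h1, eLpNorm_eq_lintegral_rpow_enorm_toReal (by norm_num) (by norm_num),
      ENNReal.toReal_ofNat]
    congr 1
    refine lintegral_congr fun τ => ?_
    rw [ENNReal.rpow_two, Real.enorm_eq_ofReal_abs, ← ENNReal.ofReal_pow (abs_nonneg _), sq_abs]
  simp only [e]
  have hmeas : ∀ N, Measurable fun τ => ENNReal.ofReal ((wienerSum f J N τ - f τ) ^ 2) := by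
    intro N
    refine ENNReal.measurable_ofReal.comp (Measurable.pow_const (Measurable.sub ?_ hf.measurable) 2)
    refine Finset.measurable_sum _ fun i _ => ?_
    exact ((measurable_const.indicator measurableSet_Iio).sub
      (measurable_const.indicator measurableSet_Iio)).const_mul _
  have hbound : ∀ N, 0 < N → ∀ τ : ℝ≥0, |wienerSum f J N τ - f τ| ≤ 2 * C / (1 + τ) := by
    intro N hN τ
    have hN' : (1 : ℝ) ≤ N := by exact_mod_cast hN
    have h1 : |wienerSum f J N τ| ≤ C / (1 + τ) := by
      rw [hJ, wienerSum_indicator f hN]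
      split_ifs
      · refine (hC _).trans (div_le_div_of_nonneg_left C0 (by positivity) ?_)
        push_cast
        have h2 := Nat.lt_floor_add_one ((τ : ℝ) * N)
        have h3 : (τ : ℝ) ≤ (⌊(τ : ℝ) * N⌋₊ : ℝ) / N + 1 := by
          have h4 : (τ : ℝ) ≤ (⌊(τ : ℝ) * N⌋₊ + 1 : ℝ) / N := by
            rw [le_div_iff₀ (by linarith)]; exact h2.le
          rw [add_div] at h4
          have h5 : 1 / (N : ℝ) ≤ 1 := by rw [div_le_one (by linarith)]; exact hN'
          linarith
        linarith
      · rw [abs_zero]; positivity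
    have h2 : |f τ| ≤ C / (1 + τ) :=
      (hC τ).trans (div_le_div_of_nonneg_left C0 (by positivity) (by linarith))
    refine (abs_sub _ _).trans ?_
    rw [two_mul, add_div]
    exact add_le_add h1 h2
  have hlim : ∀ τ : ℝ≥0, Tendsto (fun N => wienerSum f J N τ) atTop (𝓝 (f τ)) := by
    intro τ
    have h1 : Tendsto (fun N : ℕ => (⌊(τ : ℝ) * N⌋₊ : ℝ≥0) / N) atTop (𝓝 τ) := by
      rw [← NNReal.tendsto_coe]
      push_cast
      exact (tendsto_nat_floor_mul_div_atTop τ.coe_nonneg).comp tendsto_natCast_atTop_atTop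
    refine ((hf.tendsto τ).comp h1).congr' ?_
    filter_upwards [eventually_gt_atTop ⌈(τ : ℝ)⌉₊] with N hN
    have hN0 : 0 < N := by lia
    have h2 : (τ : ℝ) < N := (Nat.le_ceil _).trans_lt (by exact_mod_cast hN)
    have h3 : ⌊(τ : ℝ) * N⌋₊ < N ^ 2 := by
      rw [Nat.floor_lt (by positivity)]
      push_cast
      have : (0 : ℝ) < N := by exact_mod_cast hN0
      nlinarith
    rw [hJ, wienerSum_indicator f hN0, if_pos h3]
    rfl
  have hmain : Tendsto (fun N => ∫⁻ τ, ENNReal.ofReal ((wienerSum f J (N + 1) τ - f τ) ^ 2)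
      ∂timeMeasure) atTop (𝓝 (∫⁻ _, 0 ∂timeMeasure)) := by
    refine tendsto_lintegral_of_dominated_convergence
      (fun τ => ENNReal.ofReal ((2 * C / (1 + τ)) ^ 2)) (fun N => hmeas _)
      (fun N => ae_of_all _ fun τ => ?_) (lintegral_inv_one_add_sq_lt_top _).ne
      (ae_of_all _ fun τ => ?_)
    · refine ENNReal.ofReal_le_ofReal ?_
      rw [← sq_abs]
      exact pow_le_pow_left₀ (abs_nonneg _) (hbound _ N.succ_pos τ) 2
    · have h1 := (((hlim τ).comp (tendsto_add_atTop_nat 1)).sub_const (f τ)).pow 2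
      rw [sub_self, zero_pow two_ne_zero] at h1
      have h2 := ENNReal.tendsto_ofReal h1
      rwa [ENNReal.ofReal_zero] at h2
  rw [lintegral_zero] at hmain
  have h1 := ((tendsto_add_atTop_iff_nat (f := fun N => ∫⁻ τ,
    ENNReal.ofReal ((wienerSum f J N τ - f τ) ^ 2) ∂timeMeasure) 1).1 hmain).ennrpow_const (1 / (2 : ℝ))
  rwa [ENNReal.zero_rpow_of_pos (by norm_num)] at h1

end wiener

/-! ### Closed Gaussian subspaces of `L²` -/

section gaussian

variable {O : Type*} [MeasurableSpace O] {μ : Measure O}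

theorem norm_integral_exp_sub_le [IsProbabilityMeasure μ] (g h : Lp ℝ 2 μ) :
    ‖∫ ω, Complex.exp (Complex.I * g ω) ∂μ - ∫ ω, Complex.exp (Complex.I * h ω) ∂μ‖ ≤
      ‖g - h‖ := by
  have hi : ∀ k : Lp ℝ 2 μ, Integrable (fun ω => Complex.exp (Complex.I * k ω)) μ := by
    intro k
    refine Integrable.of_bound (C := 1) ?_ (ae_of_all _ fun ω => ?_)
    · have hk := (Lp.aestronglyMeasurable k).aemeasurable
      exact AEMeasurable.aestronglyMeasurable (by fun_prop)
    · rw [Complex.norm_exp_I_mul_ofReal]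
  rw [← integral_sub (hi g) (hi h)]
  have h1 : Integrable (g - h : Lp ℝ 2 μ) μ := (Lp.memLp (g - h)).integrable (by norm_num)
  calc _ ≤ ∫ ω, ‖(g - h : Lp ℝ 2 μ) ω‖ ∂μ := by
        refine norm_integral_le_of_norm_le h1.norm ?_
        filter_upwards [Lp.coeFn_sub g h] with ω hω
        rw [hω, Pi.sub_apply]
        have e : Complex.exp (Complex.I * g ω) - Complex.exp (Complex.I * h ω) =
            Complex.exp (Complex.I * h ω) *
              (Complex.exp (Complex.I * ((g ω - h ω : ℝ) : ℂ)) - 1) := by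
          rw [mul_sub, ← Complex.exp_add, mul_one]
          congr 2
          push_cast
          ring
        rw [e, norm_mul, Complex.norm_exp_I_mul_ofReal, one_mul]
        exact Real.norm_exp_I_mul_ofReal_sub_one_le
    _ ≤ ‖g - h‖ := by
        rw [Lp.norm_def, integral_norm_eq_lintegral_enorm h1.aestronglyMeasurable,
          ← eLpNorm_one_eq_lintegral_enorm]
        exact ENNReal.toReal_mono (Lp.eLpNorm_ne_top _)
          (eLpNorm_le_eLpNorm_of_exponent_le (by norm_num) (Lp.aestronglyMeasurable _))

/-- The identity `𝔼 exp (i h) = exp (-‖h‖² / 2)`, which holds for centred Gaussian variables,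
passes to limits in `L²`. -/
theorem isClosed_setOf_gaussian [IsProbabilityMeasure μ] :
    IsClosed {h : Lp ℝ 2 μ | ∫ ω, Complex.exp (Complex.I * h ω) ∂μ =
      Complex.exp (-((‖h‖ ^ 2 / 2 : ℝ) : ℂ))} := by
  refine isClosed_eq ?_ (by fun_prop)
  refine (LipschitzWith.of_dist_le_mul (K := 1) fun g h => ?_).continuous
  rw [dist_eq_norm, dist_eq_norm, NNReal.coe_one, one_mul]
  exact norm_integral_exp_sub_le g h

theorem integral_exp_of_hasGaussianLaw {X : O → ℝ} (hX : HasGaussianLaw X μ) (h0 : ∫ ω, X ω ∂μ = 0) :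
    ∫ ω, Complex.exp (Complex.I * X ω) ∂μ =
      Complex.exp (-((∫ ω, X ω ^ 2 ∂μ) / 2 : ℝ)) := by
  have h1 := hX.charFun_map_eq 1
  rw [charFun_apply_real, integral_map hX.aemeasurable (by fun_prop)] at h1
  have h2 : ∀ ω, inner ℝ (1 : ℝ) (X ω) = X ω := fun ω => by simp
  simp only [h2, h0] at h1
  rw [variance_of_integral_eq_zero hX.aemeasurable h0] at h1
  refine Eq.trans ?_ (h1.trans ?_)
  · refine integral_congr_ae (ae_of_all _ fun ω => ?_)
    simp [mul_comm]
  · push_cast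
    congr 1
    simp

end gaussian

/-! ### The law of the Wiener integral `Y_∞` -/

section law

variable {O : Type*} [MeasurableSpace O] {μ : Measure O} {W : ℝ≥0 → L2Torus → O → ℝ}

theorem IsCylindricalBrownianMotion.memLp (hW : IsCylindricalBrownianMotion W μ) (t : ℝ≥0)
    (f : L2Torus) : MemLp (W t f) 2 μ :=
  (hW.gaussian.hasGaussianLaw_eval (t, f)).memLp_two

/-- The random variable `W_t(f)` as an element of the Hilbert space `L²(μ)`. -/
def IsCylindricalBrownianMotion.element (hW : IsCylindricalBrownianMotion W μ) (t : ℝ≥0)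
    (f : L2Torus) : Lp ℝ 2 μ := (hW.memLp t f).toLp

theorem IsCylindricalBrownianMotion.coeFn_element (hW : IsCylindricalBrownianMotion W μ) (t : ℝ≥0)
    (f : L2Torus) : hW.element t f =ᵐ[μ] W t f := (hW.memLp t f).coeFn_toLp

theorem IsCylindricalBrownianMotion.inner_element (hW : IsCylindricalBrownianMotion W μ)
    (s t : ℝ≥0) (f g : L2Torus) :
    inner ℝ (hW.element s f) (hW.element t g) = min (s : ℝ) t * inner ℝ f g := by
  have : IsProbabilityMeasure μ := hW.gaussian.isProbabilityMeasure
  rw [← hW.covariance s t f g, covariance_eq_sub (hW.memLp s f) (hW.memLp t g), hW.centred s f,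
    zero_mul, sub_zero, L2.inner_def]
  refine integral_congr_ae ?_
  filter_upwards [hW.coeFn_element s f, hW.coeFn_element t g] with ω h1 h2
  rw [h1, h2, Pi.mul_apply]
  simp [mul_comm]

/-- The Gaussian Hilbert space of a cylindrical Brownian motion. -/
def IsCylindricalBrownianMotion.gaussianSpace (hW : IsCylindricalBrownianMotion W μ) :
    Submodule ℝ (Lp ℝ 2 μ) :=
  (Submodule.span ℝ (Set.range fun p : ℝ≥0 × L2Torus => hW.element p.1 p.2)).topologicalClosure

theorem IsCylindricalBrownianMotion.element_mem (hW : IsCylindricalBrownianMotion W μ)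
    (t : ℝ≥0) (f : L2Torus) : hW.element t f ∈ hW.gaussianSpace :=
  Submodule.le_topologicalClosure _ (Submodule.subset_span ⟨(t, f), rfl⟩)

/-- Finite linear combinations of the `W_t(f)` are centred Gaussian variables, and limits inherit
their characteristic functions. -/
theorem IsCylindricalBrownianMotion.integral_exp (hW : IsCylindricalBrownianMotion W μ)
    {h : Lp ℝ 2 μ} (hh : h ∈ hW.gaussianSpace) :
    ∫ ω, Complex.exp (Complex.I * h ω) ∂μ = Complex.exp (-((‖h‖ ^ 2 / 2 : ℝ) : ℂ)) := by
  have : IsProbabilityMeasure μ := hW.gaussian.isProbabilityMeasure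
  refine closure_minimal ?_ isClosed_setOf_gaussian hh
  intro k hk
  obtain ⟨c, hc⟩ := (Finsupp.mem_span_range_iff_exists_finsupp).1 hk
  have hae : k =ᵐ[μ] fun ω => ∑ p ∈ c.support, c p • W p.1 p.2 ω := by
    have h1 : ∀ p ∈ c.support, ⇑(c p • hW.element p.1 p.2) =ᵐ[μ] fun ω => c p • W p.1 p.2 ω := by
      intro p _
      filter_upwards [Lp.coeFn_smul (c p) (hW.element p.1 p.2), hW.coeFn_element p.1 p.2]
        with ω h1 h2
      rw [h1, Pi.smul_apply, h2]
    filter_upwards [Lp.coeFn_fun_finsetSum c.support fun p => c p • hW.element p.1 p.2,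
      (ae_ball_iff c.support.countable_toSet).2 h1] with ω h2 h3
    rw [← hc, Finsupp.sum, h2]
    exact Finset.sum_congr rfl fun p hp => h3 p hp
  have hlaw : HasGaussianLaw k μ :=
    ((hW.gaussian.smul c).hasGaussianLaw_fun_sum (I := c.support)).congr hae.symm
  have h0 : ∫ ω, k ω ∂μ = 0 := by
    have hi : ∀ p ∈ c.support, Integrable (fun ω => c p • W p.1 p.2 ω) μ := fun p _ =>
      ((hW.memLp p.1 p.2).integrable (by norm_num)).smul (c p)
    rw [integral_congr_ae hae, integral_finsetSum _ hi]
    refine Finset.sum_eq_zero fun p _ => ?_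
    rw [integral_smul, hW.centred, smul_zero]
  rw [Set.mem_ofPred_eq, integral_exp_of_hasGaussianLaw hlaw h0, ← real_inner_self_eq_norm_sq,
    L2.inner_def]
  simp [sq]

variable (L : ℕ) [NeZero L]

/-- The lattice Brownian motion at a site as a curve in `L²(μ)`. -/
def IsCylindricalBrownianMotion.latticeCurve (hW : IsCylindricalBrownianMotion W μ)
    (x : Lattice L) (t : ℝ≥0) : Lp ℝ 2 μ :=
  ∑ n ∈ frequencies L, mode n (site x) • hW.element t (ContinuousMap.toLp 2 volume ℝ (mode n))

variable {L}

theorem IsCylindricalBrownianMotion.coeFn_latticeCurve (hW : IsCylindricalBrownianMotion W μ)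
    (x : Lattice L) (t : ℝ≥0) : hW.latticeCurve L x t =ᵐ[μ] latticeBM L W x t := by
  have h1 : ∀ n ∈ frequencies L, ⇑(mode n (site x) •
      hW.element t (ContinuousMap.toLp 2 volume ℝ (mode n))) =ᵐ[μ]
      fun ω => W t (ContinuousMap.toLp 2 volume ℝ (mode n)) ω * mode n (site x) := by
    intro n _
    filter_upwards [Lp.coeFn_smul (mode n (site x))
      (hW.element t (ContinuousMap.toLp 2 volume ℝ (mode n))), hW.coeFn_element t
      (ContinuousMap.toLp 2 volume ℝ (mode n))] with ω h1 h2
    rw [h1, Pi.smul_apply, h2, smul_eq_mul, mul_comm]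
  filter_upwards [Lp.coeFn_fun_finsetSum (frequencies L) fun n => mode n (site x) •
    hW.element t (ContinuousMap.toLp 2 volume ℝ (mode n)),
    (ae_ball_iff (frequencies L).countable_toSet).2 h1] with ω h2 h3
  rw [latticeCurve, h2, latticeBM]
  exact Finset.sum_congr rfl fun n hn => h3 n hn

/-- The lattice Brownian motions at distinct sites are independent, with quadratic variation
`t / ε²`. -/
theorem IsCylindricalBrownianMotion.inner_latticeCurve (hW : IsCylindricalBrownianMotion W μ)
    (x y : Lattice L) (s t : ℝ≥0) :
    inner ℝ (hW.latticeCurve L x s) (hW.latticeCurve L y t) =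
      (if x = y then (L : ℝ) ^ 2 else 0) * inner ℝ (indicatorCurve s) (indicatorCurve t) := by
  rw [inner_indicatorCurve, ← sum_mode_mul_mode, latticeCurve, latticeCurve, sum_inner,
    Finset.sum_mul]
  refine Finset.sum_congr rfl fun n hn => ?_
  rw [inner_sum, Finset.sum_eq_single n]
  · rw [real_inner_smul_left, real_inner_smul_right, hW.inner_element, inner_mode, if_pos rfl]
    ring
  · intro k _ hk
    rw [real_inner_smul_left, real_inner_smul_right, hW.inner_element, inner_mode,
      if_neg hk.symm]
    ring
  · exact fun h => absurd hn h

theorem IsCylindricalBrownianMotion.latticeCurve_mem (hW : IsCylindricalBrownianMotion W μ)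
    (x : Lattice L) (t : ℝ≥0) : hW.latticeCurve L x t ∈ hW.gaussianSpace :=
  Submodule.sum_mem _ fun _ _ => Submodule.smul_mem _ _ (hW.element_mem t _)

theorem vectorSum_mem {H : Type*} [AddCommGroup H] [Module ℝ H] {S : Submodule ℝ H} {b : ℝ≥0 → H}
    (hb : ∀ t, b t ∈ S) (f : ℝ≥0 → ℝ) (N : ℕ) : vectorSum f b N ∈ S :=
  Submodule.sum_mem _ fun _ _ => Submodule.smul_mem _ _ (Submodule.sub_mem _ (hb _) (hb _))

variable {m : ℝ}

/-- The components of `Y_∞` are represented by elements of the Gaussian Hilbert space with the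
covariance of the Gaussian free field. -/
theorem IsCylindricalBrownianMotion.exists_Yinfty (hW : IsCylindricalBrownianMotion W μ)
    (hm : 0 < m ^ 2) : ∃ Z : Lattice L → Lp ℝ 2 μ, (∀ x, Z x ∈ hW.gaussianSpace) ∧
      (∀ x, (fun ω => Yinfty L m W μ ω x) =ᵐ[μ] Z x) ∧
      ∀ x y, inner ℝ (Z x) (Z y) = gffCovariance L m x y := by
  have hF := fun x y : Lattice L =>
    tendsto_vectorSum_indicatorCurve (continuous_q hm x y) fun t => abs_q_le hm t x y
  set F : Lattice L → Lattice L → Lp ℝ 2 timeMeasure := fun x y =>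
    (memLp_timeMeasure (continuous_q hm x y) fun t => abs_q_le hm t x y).toLp
      (fun t => q L m t x y) with hFdef
  have hX := fun x y : Lattice L =>
    exists_tendsto_vectorSum (f := fun t => q L m t x y) (F := F x y) (b := hW.latticeCurve L y)
      (fun s t => hW.inner_latticeCurve y y s t) (hF x y)
  choose X hX using hX
  refine ⟨fun x => ∑ y, X x y, fun x => Submodule.sum_mem _ fun y _ => ?_, fun x => ?_,
    fun x x' => ?_⟩
  · have hcl : IsClosed (hW.gaussianSpace : Set (Lp ℝ 2 μ)) :=
      Submodule.isClosed_topologicalClosure _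
    exact hcl.mem_of_tendsto (hX x y)
      (Eventually.of_forall fun N => vectorSum_mem (hW.latticeCurve_mem y) _ N)
  · have h1 : ∀ y, wienerIntegral μ (fun s => q L m s x y) (latticeBM L W y) =ᵐ[μ] X x y :=
      fun y => wienerIntegral_ae_eq (hW.coeFn_latticeCurve y) (hX x y)
    filter_upwards [ae_all_iff.2 h1, Lp.coeFn_fun_finsetSum Finset.univ (X x)] with ω h2 h3
    rw [h3, Yinfty]
    exact Finset.sum_congr rfl fun y _ => h2 y
  · have h1 : ∀ y y', inner ℝ (X x y) (X x' y') =
        (if y = y' then (L : ℝ) ^ 2 else 0) * inner ℝ (F x y) (F x' y') := by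
      intro y y'
      have h2 := (hX x y).inner (𝕜 := ℝ) (hX x' y')
      have h3 := ((hF x y).inner (𝕜 := ℝ) (hF x' y')).const_mul
        (if y = y' then (L : ℝ) ^ 2 else 0)
      refine tendsto_nhds_unique h2 (h3.congr fun N => ?_)
      exact (inner_vectorSum (hW.inner_latticeCurve y y') _ _ N N).symm
    have h2 : ∀ y, inner ℝ (F x y) (F x' y) =
        ∫ t, q L m t x y * q L m t x' y ∂timeMeasure := by
      intro y
      rw [L2.inner_def]
      refine integral_congr_ae ?_
      filter_upwards [MemLp.coeFn_toLp (memLp_timeMeasure (continuous_q hm x y)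
        fun t => abs_q_le hm t x y), MemLp.coeFn_toLp (memLp_timeMeasure (continuous_q hm x' y)
        fun t => abs_q_le hm t x' y)] with t h3 h4
      rw [hFdef]
      simp only [h3, h4]
      simp [mul_comm]
    simp only [sum_inner, inner_sum, h1, ite_mul, zero_mul, Finset.sum_ite_eq', Finset.mem_univ, if_true, h2]
    rw [← Finset.mul_sum, ← integral_finsetSum]
    · rw [gffCovariance, Matrix.smul_apply, smul_eq_mul, ← (integral_q_mul_q hm x x').2]
      congr 1
      refine integral_congr_ae (ae_of_all _ fun t => ?_)
      simp only [Matrix.mul_apply]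
      exact Finset.sum_congr rfl fun y _ => by rw [q_symm m t y x']
    · intro y _
      exact (memLp_timeMeasure (continuous_q hm x y) fun t => abs_q_le hm t x y).integrable_mul
        (memLp_timeMeasure (continuous_q hm x' y) fun t => abs_q_le hm t x' y)

theorem IsCylindricalBrownianMotion.aemeasurable_Yinfty (hW : IsCylindricalBrownianMotion W μ)
    (hm : 0 < m ^ 2) : AEMeasurable (Yinfty L m W μ) μ := by
  obtain ⟨Z, -, hZ, -⟩ := hW.exists_Yinfty (L := L) hm
  exact aemeasurable_pi_lambda _ fun x =>
    ((Lp.aestronglyMeasurable (Z x)).aemeasurable).congr (hZ x).symm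

/-- The law of `Y_∞` is the Gaussian free field. -/
theorem IsCylindricalBrownianMotion.map_Yinfty (hW : IsCylindricalBrownianMotion W μ)
    (hm : 0 < m ^ 2) : μ.map (Yinfty L m W μ) = gff L m := by
  have : IsProbabilityMeasure μ := hW.gaussian.isProbabilityMeasure
  obtain ⟨Z, hZm, hZ, hZi⟩ := hW.exists_Yinfty (L := L) hm
  have hY := hW.aemeasurable_Yinfty (L := L) hm
  have hlp : Measurable (WithLp.toLp 2 : Field L → EuclideanSpace ℝ (Lattice L)) := by fun_prop
  have key : (μ.map (Yinfty L m W μ)).map (WithLp.toLp 2) =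
      multivariateGaussian 0 (gffCovariance L m) := by
    have := Measure.isProbabilityMeasure_map hY
    have := Measure.isProbabilityMeasure_map (μ := μ.map (Yinfty L m W μ)) hlp.aemeasurable
    refine Measure.ext_of_charFun (funext fun ξ => ?_)
    rw [charFun_multivariateGaussian (posDef_gffCovariance hm).posSemidef, charFun_apply,
      integral_map hlp.aemeasurable (by fun_prop), integral_map hY (by fun_prop)]
    set h : Lp ℝ 2 μ := ∑ x, ξ x • Z x with hh
    have hmem : h ∈ hW.gaussianSpace :=
      Submodule.sum_mem _ fun x _ => Submodule.smul_mem _ _ (hZm x)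
    have hnorm : ‖h‖ ^ 2 = ξ ⬝ᵥ (gffCovariance L m).mulVec ξ := by
      rw [← real_inner_self_eq_norm_sq, hh]
      simp only [sum_inner, inner_sum, real_inner_smul_left, real_inner_smul_right, hZi,
        dotProduct, Matrix.mulVec, Finset.mul_sum]
      refine Finset.sum_congr rfl fun x _ => Finset.sum_congr rfl fun y _ => ?_
      rw [gffCovariance_symm]
      ring
    have hcoe : h =ᵐ[μ] fun ω => ∑ x, ξ x * Yinfty L m W μ ω x := by
      have h1 : ∀ x, ⇑(ξ x • Z x) =ᵐ[μ] fun ω => ξ x * Yinfty L m W μ ω x := by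
        intro x
        filter_upwards [Lp.coeFn_smul (ξ x) (Z x), hZ x] with ω h1 h2
        rw [h1, Pi.smul_apply, ← h2, smul_eq_mul]
      filter_upwards [Lp.coeFn_fun_finsetSum Finset.univ fun x => ξ x • Z x,
        ae_all_iff.2 h1] with ω h2 h3
      rw [hh, h2]
      exact Finset.sum_congr rfl fun x _ => h3 x
    refine Eq.trans (integral_congr_ae ?_) ((hW.integral_exp hmem).trans ?_)
    · filter_upwards [hcoe] with ω hω
      rw [hω, mul_comm, PiLp.inner_apply]
      congr 3
    · rw [hnorm]
      simp
  rw [gff, ← key, Measure.map_map (by fun_prop) hlp]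
  exact Measure.map_id.symm

end law

/-! ### The energy of minimisers -/

section control

variable {L : ℕ} [NeZero L] {m : ℝ}

/-- The Cameron-Martin norm of the integrated drift `h` is at most its energy. With
`g = (-Δ^ε + m²) h`, integrate `2 ⟨q_t g, u_t⟩ ≤ ⟨q_t g, q_t g⟩ + ⟨u_t, u_t⟩` over time; by
`∫₀^∞ q_t² dt = (-Δ^ε + m²)⁻¹` the first two terms give `2 ⟨h, g⟩` and `⟨h, g⟩`. -/
theorem ofReal_dirichlet_Iinfty_le (hm : 0 < m ^ 2) {u : ℝ≥0 → Field L} (hu : Measurable u) :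
    ENNReal.ofReal (dirichlet L m (Iinfty L m u)) ≤ energy L u := by
  by_cases hE : energy L u = ∞
  · rw [hE]; exact le_top
  have hux : ∀ x, Measurable fun t => u t x := fun x => (measurable_pi_apply x).comp hu
  have hsum : Integrable (fun t => (1 / (L : ℝ)) ^ 2 * ∑ x, u t x ^ 2) timeMeasure := by
    refine ⟨((Finset.measurable_sum _ fun x _ =>
      (hux x).pow_const 2).const_mul _).aestronglyMeasurable, ?_⟩
    rw [hasFiniteIntegral_iff_ofReal (ae_of_all _ fun t => by positivity)]
    exact lt_of_le_of_ne le_top hE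
  have hL : (0 : ℝ) < (1 / (L : ℝ)) ^ 2 := by
    have := natCast_L_pos (L := L)
    positivity
  have hsum' : Integrable (fun t => ∑ x, u t x ^ 2) timeMeasure := by
    have := hsum.const_mul ((1 / (L : ℝ)) ^ 2)⁻¹
    refine this.congr (ae_of_all _ fun t => ?_)
    simp only
    rw [← mul_assoc, inv_mul_cancel₀ hL.ne', one_mul]
  have huL : ∀ x, MemLp (fun t => u t x) 2 timeMeasure := by
    intro x
    rw [memLp_two_iff_integrable_sq (hux x).aestronglyMeasurable]
    refine hsum'.mono ((hux x).pow_const 2).aestronglyMeasurable (ae_of_all _ fun t => ?_)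
    rw [Real.norm_of_nonneg (sq_nonneg _),
      Real.norm_of_nonneg (Finset.sum_nonneg fun x _ => sq_nonneg _)]
    exact Finset.single_le_sum (f := fun x => u t x ^ 2) (fun x _ => sq_nonneg _)
      (Finset.mem_univ x)
  have hqL : ∀ x y, MemLp (fun t => q L m t x y) 2 timeMeasure := fun x y =>
    memLp_timeMeasure (continuous_q hm x y) fun t => abs_q_le hm t x y
  set h := Iinfty L m u with hh
  set g := (massiveLaplacian L m).mulVec h with hg
  have hqu : ∀ x, Integrable (fun t => (q L m t).mulVec (u t) x) timeMeasure := fun x =>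
    integrable_finsetSum _ fun y _ => (hqL x y).integrable_mul (huL y)
  have hQ : ∫ t, ∑ x, g x * (q L m t).mulVec (u t) x ∂timeMeasure = h ⬝ᵥ g := by
    rw [integral_finsetSum _ fun x _ => (hqu x).const_mul _]
    refine Finset.sum_congr rfl fun x _ => ?_
    rw [integral_const_mul, mul_comm]
    rfl
  have hRi : ∀ x y, Integrable (fun t => g x * g y * (q L m t * q L m t) x y) timeMeasure :=
    fun x y => (integral_q_mul_q hm x y).1.const_mul _
  have hR : ∫ t, ∑ x, ∑ y, g x * g y * (q L m t * q L m t) x y ∂timeMeasure = h ⬝ᵥ g := by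
    rw [integral_finsetSum _ fun x _ => integrable_finsetSum _ fun y _ => hRi x y]
    have e : h = (massiveLaplacian L m)⁻¹.mulVec g := by
      rw [hg, Matrix.mulVec_mulVec, massiveLaplacian_inv_mul hm, Matrix.one_mulVec]
    refine Eq.trans (Finset.sum_congr rfl fun x _ => ?_) (congrArg (· ⬝ᵥ g) e).symm
    rw [integral_finsetSum _ fun y _ => hRi x y, Matrix.mulVec, dotProduct, Finset.sum_mul]
    refine Finset.sum_congr rfl fun y _ => ?_
    rw [integral_const_mul, (integral_q_mul_q hm x y).2]
    ring
  have hpt : ∀ t, 2 * ∑ x, g x * (q L m t).mulVec (u t) x ≤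
      ∑ x, ∑ y, g x * g y * (q L m t * q L m t) x y + ∑ x, u t x ^ 2 := by
    intro t
    set v := (q L m t).mulVec g with hv
    have h1 : ∑ x, g x * (q L m t).mulVec (u t) x = ∑ y, v y * u t y := by
      simp only [hv, Matrix.mulVec, dotProduct, Finset.mul_sum, Finset.sum_mul]
      rw [Finset.sum_comm]
      refine Finset.sum_congr rfl fun y _ => Finset.sum_congr rfl fun x _ => ?_
      rw [q_symm m t y x]
      ring
    have h2 : ∑ x, ∑ y, g x * g y * (q L m t * q L m t) x y = ∑ y, v y ^ 2 := by
      have e1 : ∀ x, ∑ y, g x * g y * (q L m t * q L m t) x y =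
          ∑ z, g x * q L m t x z * v z := by
        intro x
        simp only [hv, Matrix.mul_apply, Matrix.mulVec, dotProduct, Finset.mul_sum]
        rw [Finset.sum_comm]
        refine Finset.sum_congr rfl fun y _ => Finset.sum_congr rfl fun z _ => ?_
        ring
      simp only [e1]
      rw [Finset.sum_comm]
      refine Finset.sum_congr rfl fun z _ => ?_
      rw [← Finset.sum_mul, sq]
      congr 1
      simp only [hv, Matrix.mulVec, dotProduct]
      exact Finset.sum_congr rfl fun x _ => by rw [q_symm m t x z, mul_comm]
    rw [h1, h2, Finset.mul_sum, ← Finset.sum_add_distrib]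
    exact Finset.sum_le_sum fun x _ => by nlinarith [sq_nonneg (v x - u t x)]
  have hmono := integral_mono ((integrable_finsetSum _ fun x _ => (hqu x).const_mul (g x)).const_mul
    2) ((integrable_finsetSum _ fun x _ => integrable_finsetSum _ fun y _ => hRi x y).add hsum') hpt
  have hadd := integral_add (integrable_finsetSum Finset.univ fun x _ =>
    integrable_finsetSum Finset.univ fun y _ => hRi x y) hsum'
  rw [integral_const_mul, hQ] at hmono
  have hmono' := hmono.trans_eq hadd
  rw [hR] at hmono'
  have hfin : energy L u = ENNReal.ofReal (∫ t, (1 / (L : ℝ)) ^ 2 * ∑ x, u t x ^ 2 ∂timeMeasure) :=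
    (ofReal_integral_eq_lintegral_ofReal hsum (ae_of_all _ fun t => by positivity)).symm
  rw [hfin, dirichlet_eq, integral_const_mul]
  refine ENNReal.ofReal_le_ofReal (mul_le_mul_of_nonneg_left ?_ hL.le)
  linarith

variable {O : Type*} [MeasurableSpace O] {μ : Measure O} {W : ℝ≥0 → L2Torus → O → ℝ}

theorem IsDrift.measurable_path {u : ℝ≥0 → O → Field L} (hu : IsDrift L W μ u) (ω : O) :
    Measurable fun t => u t ω := by
  have h0 := hu.1 0
  have h1 : Measurable fun t : Set.Ici (0 : ℝ≥0) => u t ω :=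
    @Measurable.comp _ _ _ _ (Subtype.instMeasurableSpace.prod (backward W μ 0)) _ _ _ h0
      (@measurable_prodMk_right _ _ _ (backward W μ 0) ω)
  have h2 : Measurable fun t : ℝ≥0 => (⟨t, Set.mem_Ici.2 zero_le⟩ : Set.Ici (0 : ℝ≥0)) :=
    measurable_id.subtype_mk
  exact h1.comp h2

theorem energy_zero : energy L (fun _ => 0) = 0 := by
  simp [energy, normSq]

theorem isDrift_zero : IsDrift L W μ (fun _ _ => 0) := by
  refine ⟨fun t => measurable_const, ae_of_all _ fun ω => ?_⟩
  rw [energy_zero]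
  exact ENNReal.zero_lt_top

theorem Iinfty_zero : Iinfty L m (fun _ => 0) = 0 := by
  funext x
  simp [Iinfty]

/-- This also holds when `f` is not integrable: then the left-hand side is `0`. -/
theorem ofReal_neg_integral_le (f : O → ℝ) :
    ENNReal.ofReal (-∫ ω, f ω ∂μ) ≤ ∫⁻ ω, ENNReal.ofReal (-f ω) ∂μ := by
  by_cases hf : Integrable f μ
  · rw [← integral_neg]
    refine (ENNReal.ofReal_le_ofReal
      (integral_eq_lintegral_pos_part_sub_lintegral_neg_part hf.neg).le).trans ?_
    have h1 := hf.neg.lintegral_lt_top.ne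
    refine (ENNReal.ofReal_le_ofReal (sub_le_self _ ENNReal.toReal_nonneg)).trans ?_
    rw [ENNReal.ofReal_toReal h1]
    rfl
  · rw [integral_undef hf]
    simp

/-- A minimiser does at least as well as the zero drift, whose cost is `∫ V dν^{GFF} ≤ 0`. If the
interaction energy is controlled from below by a quarter of the Cameron-Martin norm of the drift,
this bounds the energy of the minimiser. -/
theorem IsMinimiser.lintegral_energy_le (hm : 0 < m ^ 2) (hW : IsCylindricalBrownianMotion W μ)
    {V : Field L → ℝ} (hVm : Measurable V) (hV0 : ∫ φ, V φ ∂gff L m ≤ 0)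
    {Z : Field L → ℝ≥0∞} (hZm : Measurable Z) {C : ℝ≥0} (hZ : ∫⁻ φ, Z φ ∂gff L m ≤ C)
    (hVZ : ∀ φ h, ENNReal.ofReal (-V (φ + h)) ≤ Z φ + ENNReal.ofReal (dirichlet L m h / 4))
    {u : ℝ≥0 → O → Field L} (hu : IsMinimiser L m V W μ u) :
    ∫⁻ ω, energy L (fun t => u t ω) ∂μ ≤ 4 * C := by
  have hY := hW.aemeasurable_Yinfty (L := L) hm
  set e := ∫⁻ ω, energy L (fun t => u t ω) ∂μ with he
  set a := ∫ ω, V (Yinfty L m W μ ω + Iinfty L m (fun t => u t ω)) ∂μ with ha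
  have hF0 : boueDupuis L m V W μ (fun _ _ => 0) ≤ 0 := by
    simp only [boueDupuis, Iinfty_zero, energy_zero, add_zero, lintegral_zero, mul_zero]
    have h1 : ∫ ω, V (Yinfty L m W μ ω) ∂μ = ∫ φ, V φ ∂gff L m := by
      rw [← hW.map_Yinfty hm, integral_map hY hVm.aestronglyMeasurable]
    rw [h1]
    simpa using hV0
  have hFu : (a : EReal) + ((2⁻¹ * e : ℝ≥0∞) : EReal) ≤ 0 := (hu.2 _ isDrift_zero).trans hF0
  -- the cost of an admissible drift of infinite energy would be `∞`
  have he_top : e ≠ ∞ := by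
    intro h
    rw [h, ENNReal.mul_top (by simp), EReal.coe_ennreal_top, EReal.coe_add_top] at hFu
    exact absurd hFu (by simp)
  have h1 : 2⁻¹ * e ≤ ENNReal.ofReal (-a) := by
    have hne : 2⁻¹ * e ≠ ∞ := by finiteness
    rw [← ENNReal.ofReal_toReal hne] at hFu ⊢
    refine ENNReal.ofReal_le_ofReal ?_
    rw [EReal.coe_ennreal_ofReal, max_eq_left ENNReal.toReal_nonneg, ← EReal.coe_add] at hFu
    have := EReal.coe_nonpos.1 hFu
    linarith
  have h2 : ENNReal.ofReal (-a) ≤ C + 4⁻¹ * e := by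
    refine (ofReal_neg_integral_le _).trans ?_
    calc _ ≤ ∫⁻ ω, (Z (Yinfty L m W μ ω) + 4⁻¹ * energy L (fun t => u t ω)) ∂μ := by
          refine lintegral_mono fun ω => (hVZ _ _).trans ?_
          gcongr
          rw [div_eq_inv_mul, ENNReal.ofReal_mul (by norm_num), ENNReal.ofReal_inv_of_pos
            (by norm_num), ENNReal.ofReal_ofNat]
          gcongr
          exact ofReal_dirichlet_Iinfty_le hm (hu.1.measurable_path ω)
      _ ≤ _ := by
          have hZY : AEMeasurable (fun ω => Z (Yinfty L m W μ ω)) μ := hZm.comp_aemeasurable hY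
          rw [lintegral_add_left' hZY, lintegral_const_mul' _ _ (by finiteness)]
          gcongr
          rw [← hW.map_Yinfty hm, lintegral_map' hZm.aemeasurable hY] at hZ
          exact hZ
  have h3 := h1.trans h2
  clear_value e
  lift e to ℝ≥0 using he_top
  have h4 : (2 : ℝ)⁻¹ * e ≤ C + 4⁻¹ * e := by
    have h5 := ENNReal.toReal_mono (by finiteness) h3
    rw [ENNReal.toReal_add (by finiteness) (by finiteness)] at h5
    simpa using h5
  have h6 : (e : ℝ) ≤ 4 * C := by linarith
  exact_mod_cast h6

end control

end PPhi2

end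

open PPhi2 in
theorem proposition4p5
    (m : ℝ) (hm : 0 < m ^ 2)
    (P : Polynomial ℝ) (hdeg : 0 < P.natDegree) (heven : Even P.natDegree)
    (hlead : 0 < P.leadingCoeff) (hconst : P.coeff 0 = 0)
    (χ : ℝ → ℝ → ℝ) (hχ : IsCutoff χ) :
    (∃ C : ℝ≥0, ∀ (O : Type*) [MeasurableSpace O] (μ : Measure O) [IsProbabilityMeasure μ]
      [μ.IsComplete] (W : ℝ≥0 → L2Torus → O → ℝ), IsCylindricalBrownianMotion W μ →
      ∀ (L : ℕ) [NeZero L] (E : ℝ), 0 < E → ∀ u : ℝ≥0 → O → Field L,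
        IsMinimiser L m (fun φ => χ E (hamiltonian L m P φ)) W μ u →
          ∫⁻ ω, energy L (fun t => u t ω) ∂μ ≤ C) ∧
    (∀ p : ℝ≥0∞, 1 ≤ p → p ≠ ∞ → ∃ C : ℝ≥0, ∀ (L : ℕ) [NeZero L],
      DensityBound L m (hamiltonian L m P) p C ∧
      ∀ E : ℝ, 0 < E → DensityBound L m (fun φ => χ E (hamiltonian L m P φ)) p C) := by
  constructor
  · obtain ⟨C, hC⟩ := exists_neg_hamiltonian_add_le hm hdeg heven hlead zero_lt_one
    refine ⟨4 * C, fun O _ μ _ _ W hW L _ E hE u hu => ?_⟩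
    obtain ⟨Z, hZm, hZ, hVZ⟩ := hC L
    have hV : Continuous fun φ => χ E (hamiltonian L m P φ) :=
      (hχ.continuous hE).comp (continuous_hamiltonian hm P)
    have : IsProbabilityMeasure (gff L m) := isProbabilityMeasure_gff
    have hmean : ∫ φ, χ E (hamiltonian L m P φ) ∂gff L m ≤ 0 := by
      by_cases hi : Integrable (fun φ => χ E (hamiltonian L m P φ)) (gff L m)
      · have h := integral_hamiltonian (L := L) hm P
        exact (integral_mono hi h.1 fun φ => hχ.le_self hE _).trans_eq h.2
      · rw [integral_undef hi]
    refine (hu.lintegral_energy_le hm hW hV.measurable hmean hZm hZ fun φ h => ?_).trans_eq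
      (by push_cast; rfl)
    refine le_trans ?_ (hVZ φ h)
    rw [one_mul]
    have h1 := hχ.min_zero_le hE (hamiltonian L m P (φ + h))
    rcases le_total (hamiltonian L m P (φ + h)) 0 with h0 | h0
    · rw [min_eq_left h0] at h1
      exact ENNReal.ofReal_le_ofReal (neg_le_neg h1)
    · rw [min_eq_right h0] at h1
      rw [ENNReal.ofReal_of_nonpos (neg_nonpos.2 h1)]
      exact zero_le
  · intro p hp hp'
    obtain ⟨C, hC⟩ := exists_densityBound hm hdeg heven hlead hp hp'
    refine ⟨C, fun L _ => ⟨?_, fun E hE => ?_⟩⟩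
    · exact hC L _ (continuous_hamiltonian hm P).measurable (fun φ => min_le_left _ _)
        fun φ => le_rfl
    · exact hC L _ ((hχ.continuous hE).comp (continuous_hamiltonian hm P)).measurable
        (fun φ => hχ.min_zero_le hE _) fun φ => hχ.le_self hE _
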